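/- Setting. Let $G$ be a Lie group whose Lie algebra $\mathfrak g$ is real semisimple with a fixed $|1|$-grading $\mathfrak g=\mathfrak g_{-1}\oplus\mathfrak g_0\oplus\mathfrak g_1$ such that no simple ideal of $\mathfrak g$ is contained in $\mathfrak g_0$. Put $\mathfrak p=\mathfrak g_0\oplus\mathfrak g_1$. Let $P\subset G$ be a Lie subgroup with Lie algebra $\mathfrak p$ which lies between the stabilizer $P_{\max}$ in $G$ (under $\mathrm{Ad}$) of the filtration $\mathfrak g\supset\mathfrak p\supset\mathfrak g_1$ and the identity component of $P_{\max}$. Let $G_0\subset P$ be the subgroup of elements whose adjoint action preserves the grading. The kernel $K$ is the largest normal subgroup of $G$ contained in $P$. Let $(p:\mathcal G\to M,\omega)$ be a Cartan geometry of type $(G,P)$ (a $|1|$-graded parabolic geometry), and let $p_0:\mathcal G_0=\mathcal G/\exp\mathfrak g_1\to M$ and $\pi:\mathcal G\to\mathcal G_0$ be the projections. A symmetry with center $x\in M$ is a locally defined diffeomorphism $s$ of $M$ with $s(x)=x$ and $T_xs=-\mathrm{id}$ which near $x$ is covered by a locally defined automorphism $\varphi$ of the Cartan geometry; such a $\varphi$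 is called a covering of $s$. A Weyl structure is a global smooth $G_0$-equivariant section $\sigma:\mathcal G_0\to\mathcal G$ of $\pi$. Its pullback is $\varphi^*\sigma=\varphi^{-1}\circ\sigma\circ\varphi_0$, where $\varphi_0$ is the local automorphism of $\mathcal G_0$ induced by $\varphi$. It is $\varphi$-invariant at $x$ if $\varphi^*\sigma=\sigma$ on $p_0^{-1}(x)$. Fix $x\in M$. (1) Let $\varphi,\psi$ be coverings of symmetries $s,t$ with center $x$, and let $\sigma$ be a Weyl structure with $\varphi^*\sigma|_{p_0^{-1}(x)}=\sigma|_{p_0^{-1}(x)}=\psi^*\sigma|_{p_0^{-1}(x)}$. Then $s=t$ on a neighborhood of $x$. Moreover there are a neighborhood $U$ of $x$ and a locally constant function $f$ on $p^{-1}(U)$ with values in $\{h\in P:\mathrm{Ad}_h=\mathrm{id}_{\mathfrak g}\}$ such that $\psi(u)=\varphi(u)\cdot f(u)$ for all $u\in p^{-1}(U)$. If $P=P_{\max}$ or $G/P$ is connected, then $f$ takes values in the kernel $K$. If every element of $P$ with trivial adjoint action commutes with $P$ (for instance if $G$ is connected), then $f$ is equal to a constant $h$, i.e. $\psi(u)=\varphi(u)\cdot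 h$ for all $u\in p^{-1}(U)$. (2) Let $\varphi,\psi$ be coverings of the same symmetry with center $x$. Then a Weyl structure is $\varphi$-invariant at $x$ if and only if it is $\psi$-invariant at $x$, and any Weyl structure $\sigma$ that is $\varphi$-invariant at $x$ coincides on $p_0^{-1}(x)$ with any Weyl structure $\tau$ that is $\psi$-invariant at $x$. (3) Every symmetry $s$ with center $x$ is involutive, i.e. $s\circ s=\mathrm{id}$ near $x$, and $x$ is an isolated fixed point of $s$. -/

import Mathlib

open scoped Manifold ContDiff Topology

namespace ParabolicGeometry

noncomputable section

/-- A smooth real Lie group is in particular of the class for which Mathlib defines its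
Lie algebra. -/
instance lieGroupMinSmoothness {n : ℕ} {G : Type*} [TopologicalSpace G]
    [ChartedSpace (EuclideanSpace ℝ (Fin n)) G] [Group G] [LieGroup (𝓡 n) ∞ G] :
    LieGroup (𝓡 n) (minSmoothness ℝ 3) G :=
  LieGroup.of_le (n := ∞) (by
    rw [minSmoothness_of_isRCLikeNormedField]
    exact WithTop.coe_le_coe.2 (le_top : (3 : ℕ∞) ≤ ⊤))

section LieGroups

variable {n : ℕ} (G : Type*) [TopologicalSpace G]
  [ChartedSpace (EuclideanSpace ℝ (Fin n)) G] [Group G]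

/-- The Lie algebra `𝔤 = T₁G`, with the bracket of left invariant vector fields. -/
abbrev LieAlg : Type := GroupLieAlgebra (𝓡 n) G

variable {G}

/-- The adjoint action `Ad_g : 𝔤 → 𝔤`, the differential at `1` of `a ↦ g a g⁻¹`. -/
def Ad (g : G) : LieAlg (n := n) G →L[ℝ] LieAlg (n := n) G :=
  mfderiv (𝓡 n) (𝓡 n) (fun a : G => g * a * g⁻¹) 1

/-- `exp V` for `V ⊆ 𝔤`: the values at time `1` of the one-parameter subgroups `γ` of `G`
with `γ'(0) ∈ V`. -/
def expSet (V : Set (LieAlg (n := n) G)) : Set G :=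
  {g | ∃ γ : ℝ → G, ContMDiff 𝓘(ℝ, ℝ) (𝓡 n) ∞ γ ∧ (∀ s t, γ (s + t) = γ s * γ t) ∧
    (mfderiv 𝓘(ℝ, ℝ) (𝓡 n) γ 0 (1 : ℝ) : EuclideanSpace ℝ (Fin n)) ∈ V ∧ γ 1 = g}

end LieGroups

/-- A `|1|`-grading `L = L₋₁ ⊕ L₀ ⊕ L₁` of a Lie algebra such that no simple ideal of `L` is
contained in `L₀`. (`L₋ = L₋₁` is generated by `L₋₁` trivially.) -/
structure OneGrading (L : Type*) [LieRing L] [LieAlgebra ℝ L] where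
  gr : ℤ → Submodule ℝ L
  isInternal : DirectSum.IsInternal gr
  lie_mem : ∀ i j : ℤ, ∀ X ∈ gr i, ∀ Y ∈ gr j, ⁅X, Y⁆ ∈ gr (i + j)
  eq_bot : ∀ i : ℤ, 1 < |i| → gr i = ⊥
  no_simple_ideal : ∀ J : LieIdeal ℝ L, LieAlgebra.IsSimple ℝ J → ¬ (J.toSubmodule ≤ gr 0)

/-- The filtration `Lⁱ = ⨁_{j ≥ i} L_j`; in particular `L⁰ = 𝔭`. -/
def OneGrading.filtration {L : Type*} [LieRing L] [LieAlgebra ℝ L] (Γ : OneGrading L) (i : ℤ) :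
    Submodule ℝ L :=
  ⨆ (j : ℤ) (_ : i ≤ j), Γ.gr j

section Types

variable {n : ℕ} {G : Type*} [TopologicalSpace G]
  [ChartedSpace (EuclideanSpace ℝ (Fin n)) G] [Group G] [LieGroup (𝓡 n) ∞ G]

/-- The largest choice of the parabolic subgroup: the elements of `G` whose adjoint action
preserves the filtration of `𝔤`. -/
def filtrationStabilizer (Γ : OneGrading (LieAlg (n := n) G)) : Set G :=
  {g | ∀ i : ℤ, ∀ X ∈ Γ.filtration i, Ad g X ∈ Γ.filtration i}

/-- `P` is an embedded Lie subgroup of `G` with Lie algebra `𝔭`, lying between the identity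
component of the stabilizer of the filtration and the whole stabilizer.
(`P` carries the subspace topology; its smooth structure makes the inclusion an immersion.) -/
structure IsParabolic {k : ℕ} (Γ : OneGrading (LieAlg (n := n) G)) (P : Subgroup G)
    [ChartedSpace (EuclideanSpace ℝ (Fin k)) P] : Prop where
  lieGroup : LieGroup (𝓡 k) ∞ P
  contMDiff_val : ContMDiff (𝓡 k) (𝓡 n) ∞ (Subtype.val : P → G)
  injective_mfderiv : Function.Injective (mfderiv (𝓡 k) (𝓡 n) (Subtype.val : P → G) 1)
  range_mfderiv : Set.range (fun Y => (mfderiv (𝓡 k) (𝓡 n) (Subtype.val : P → G) 1 Y :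
    EuclideanSpace ℝ (Fin n))) = (Γ.filtration 0 : Set (LieAlg (n := n) G))
  le_stabilizer : (P : Set G) ⊆ filtrationStabilizer Γ
  component_le : connectedComponentIn (filtrationStabilizer Γ) 1 ⊆ (P : Set G)

/-- The subgroup `G₀ ⊆ P` of the elements whose adjoint action preserves the grading of `𝔤`,
as a set of elements of `P`. -/
def gZero (Γ : OneGrading (LieAlg (n := n) G)) (P : Subgroup G) : Set P :=
  {g | ∀ i : ℤ, ∀ X ∈ Γ.gr i, Ad (g : G) X ∈ Γ.gr i}

/-- The subgroup `P₊ = exp 𝔤₁` of `P`. -/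
def pPlus (Γ : OneGrading (LieAlg (n := n) G)) (P : Subgroup G) : Subgroup P :=
  (Subgroup.closure (expSet (Γ.gr 1 : Set (LieAlg (n := n) G)))).subgroupOf P

end Types

/-- The right action `u · h` of a group `P` on the total space of a `P`-bundle. -/
def rAct {P B : Type*} [Monoid P] [MulAction Pᵐᵒᵖ B] (u : B) (h : P) : B :=
  MulOpposite.op h • u

section Cartan

variable {n k m : ℕ} {G : Type*} [TopologicalSpace G]
  [ChartedSpace (EuclideanSpace ℝ (Fin n)) G] [Group G]
  (P : Subgroup G) [ChartedSpace (EuclideanSpace ℝ (Fin k)) P]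
  (B : Type*) [TopologicalSpace B] [ChartedSpace (EuclideanSpace ℝ (Fin n)) B]
  [IsManifold (𝓡 n) ∞ B] [MulAction (↥P)ᵐᵒᵖ B]
  (M : Type*) [TopologicalSpace M] [ChartedSpace (EuclideanSpace ℝ (Fin m)) M]

/-- A Cartan geometry of type `(G, P)` on `M`: a smooth principal (right) `P`-bundle
`proj : B → M` with a Cartan connection `conn = ω ∈ Ω¹(B, 𝔤)`. -/
structure CartanGeometry where
  proj : B → M
  contMDiff_proj : ContMDiff (𝓡 n) (𝓡 m) ∞ proj
  contMDiff_rAct : ContMDiff ((𝓡 n).prod (𝓡 k)) (𝓡 n) ∞ (fun q : B × P => rAct q.1 q.2)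
  proj_rAct : ∀ (u : B) (h : P), proj (rAct u h) = proj u
  /-- Smooth equivariant local trivializations. -/
  exists_trivialization : ∀ x : M, ∃ e : Bundle.Trivialization P proj, x ∈ e.baseSet ∧
    ContMDiffOn (𝓡 n) ((𝓡 m).prod (𝓡 k)) ∞ e.toOpenPartialHomeomorph e.source ∧
    ContMDiffOn ((𝓡 m).prod (𝓡 k)) (𝓡 n) ∞ e.toOpenPartialHomeomorph.symm e.target ∧
    ∀ u ∈ e.source, ∀ h : P, e (rAct u h) = ((e u).1, (e u).2 * h)
  conn : ∀ u : B, TangentSpace (𝓡 n) u →L[ℝ] LieAlg (n := n) G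
  contMDiff_conn : ContMDiff (M' := EuclideanSpace ℝ (Fin n)) (𝓡 n).tangent (𝓡 n) ∞
    (fun v : TangentBundle (𝓡 n) B => conn v.proj v.2)
  /-- `(rʰ)^* ω = Ad_{h⁻¹} ∘ ω`. -/
  conn_rAct : ∀ (u : B) (h : P) (ξ : TangentSpace (𝓡 n) u),
    conn (rAct u h) (mfderiv (𝓡 n) (𝓡 n) (fun w : B => rAct w h) u ξ) = Ad ((h : G)⁻¹) (conn u ξ)
  /-- `ω` reproduces the generators of fundamental vector fields. -/
  conn_fundamental : ∀ (u : B) (Y : TangentSpace (𝓡 k) (1 : P)),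
    conn (rAct u (1 : P)) (mfderiv (𝓡 k) (𝓡 n) (fun h : P => rAct u h) 1 Y) =
      mfderiv (𝓡 k) (𝓡 n) (Subtype.val : P → G) 1 Y
  bijective_conn : ∀ u : B, Function.Bijective (conn u)

variable {P B M}

/-- A locally defined automorphism of a Cartan geometry: a principal bundle isomorphism
`total : proj⁻¹(U) → proj⁻¹(V)` over a diffeomorphism `base : U → V` of open subsets of `M`
which preserves the Cartan connection. -/
structure LocalAutomorphism (C : CartanGeometry (n := n) (k := k) (m := m) P B M) where
  base : OpenPartialHomeomorph M M
  total : OpenPartialHomeomorph B B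
  source_eq : total.source = C.proj ⁻¹' base.source
  target_eq : total.target = C.proj ⁻¹' base.target
  contMDiffOn_base : ContMDiffOn (𝓡 m) (𝓡 m) ∞ base base.source
  contMDiffOn_base_symm : ContMDiffOn (𝓡 m) (𝓡 m) ∞ base.symm base.target
  contMDiffOn_total : ContMDiffOn (𝓡 n) (𝓡 n) ∞ total total.source
  contMDiffOn_total_symm : ContMDiffOn (𝓡 n) (𝓡 n) ∞ total.symm total.target
  proj_total : ∀ u ∈ total.source, C.proj (total u) = base (C.proj u)
  total_rAct : ∀ u ∈ total.source, ∀ h : P, total (rAct u h) = rAct (total u) h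
  conn_total : ∀ u ∈ total.source, ∀ ξ : TangentSpace (𝓡 n) u,
    C.conn (total u) (mfderiv (𝓡 n) (𝓡 n) total u ξ) = C.conn u ξ

/-- The local automorphism `φ` covers the locally defined map `s` around `x`. -/
def LocalAutomorphism.Covers {C : CartanGeometry (n := n) (k := k) (m := m) P B M} (φ : LocalAutomorphism C)
    (s : OpenPartialHomeomorph M M) (x : M) : Prop :=
  x ∈ φ.base.source ∧ ∀ᶠ y in 𝓝 x, s y = φ.base y

/-- A (local) symmetry with center at `x` of a `|1|`-graded geometry (where `T⁻¹M = TM`): a locally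
defined diffeomorphism `s` of `M` with `s x = x` and `T_x s = -id`, covered near `x` by a local
automorphism of the geometry. -/
structure IsSymmetryAt (C : CartanGeometry (n := n) (k := k) (m := m) P B M) (s : OpenPartialHomeomorph M M) (x : M) :
    Prop where
  mem_source : x ∈ s.source
  contMDiffOn : ContMDiffOn (𝓡 m) (𝓡 m) ∞ s s.source
  contMDiffOn_symm : ContMDiffOn (𝓡 m) (𝓡 m) ∞ s.symm s.target
  map_center : s x = x
  mfderiv_center : ∀ ξ : TangentSpace (𝓡 m) x,
    (mfderiv (𝓡 m) (𝓡 m) s x ξ : EuclideanSpace ℝ (Fin m)) = (-ξ : TangentSpace (𝓡 m) x)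
  exists_covering : ∃ φ : LocalAutomorphism C, φ.Covers s x

end Cartan

section Weyl

variable {n k m : ℕ} {G : Type*} [TopologicalSpace G]
  [ChartedSpace (EuclideanSpace ℝ (Fin n)) G] [Group G] [LieGroup (𝓡 n) ∞ G]
  {P : Subgroup G} [ChartedSpace (EuclideanSpace ℝ (Fin k)) P]
  {B : Type*} [TopologicalSpace B] [ChartedSpace (EuclideanSpace ℝ (Fin n)) B]
  [IsManifold (𝓡 n) ∞ B] [MulAction (↥P)ᵐᵒᵖ B]
  {M : Type*} [TopologicalSpace M] [ChartedSpace (EuclideanSpace ℝ (Fin m)) M]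

/-- Two frames are equivalent if they lie in the same `P₊`-orbit. -/
def pPlusSetoid (Γ : OneGrading (LieAlg (n := n) G)) (P : Subgroup G) (B : Type*)
    [MulAction (↥P)ᵐᵒᵖ B] : Setoid B where
  r u w := ∃ h ∈ pPlus Γ P, w = rAct u h
  iseqv :=
    { refl := fun u => ⟨1, one_mem _, by simp [rAct]⟩
      symm := by
        rintro u w ⟨h, hh, rfl⟩
        exact ⟨h⁻¹, inv_mem hh, by simp [rAct]⟩
      trans := by
        rintro u w z ⟨h, hh, rfl⟩ ⟨l, hl, rfl⟩
        exact ⟨h * l, mul_mem hh hl, by simp [rAct, mul_smul]⟩ }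

/-- The underlying bundle `B₀ = B / exp 𝔤₁`. -/
def BZero (Γ : OneGrading (LieAlg (n := n) G)) (P : Subgroup G) (B : Type*)
    [MulAction (↥P)ᵐᵒᵖ B] : Type _ :=
  Quotient (pPlusSetoid Γ P B)

/-- The projection `π : B → B₀`. -/
def toBZero (Γ : OneGrading (LieAlg (n := n) G)) (P : Subgroup G) {B : Type*}
    [MulAction (↥P)ᵐᵒᵖ B] (u : B) : BZero Γ P B :=
  Quotient.mk (pPlusSetoid Γ P B) u

/-- The projection `p₀ : B₀ → M`. -/
def projZero (Γ : OneGrading (LieAlg (n := n) G)) (C : CartanGeometry (n := n) (k := k) (m := m) P B M) :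
    BZero Γ P B → M :=
  Quotient.lift C.proj (by
    rintro u w ⟨h, -, rfl⟩
    exact (C.proj_rAct u h).symm)

/-- A Weyl structure: a global smooth `G₀`-equivariant section `σ` of `π : B → B₀`. The action of
`G₀` on `B₀` is `π(u) · g = π(u · g)`, and since `π` is a surjective submersion, `σ` is smooth if
and only if `σ ∘ π` is. -/
structure WeylStructure (Γ : OneGrading (LieAlg (n := n) G)) (C : CartanGeometry (n := n) (k := k) (m := m) P B M) where
  toFun : BZero Γ P B → B
  isSection : ∀ v, toBZero Γ P (toFun v) = v
  equivariant : ∀ u : B, ∀ g ∈ gZero Γ P,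
    toFun (toBZero Γ P (rAct u g)) = rAct (toFun (toBZero Γ P u)) g
  contMDiff : ContMDiff (𝓡 n) (𝓡 n) ∞ (fun u : B => toFun (toBZero Γ P u))

/-- The underlying local automorphism `φ₀` of `B₀`, given by `φ₀(π(u)) = π(φ(u))` for `u` in the
domain of `φ` (see `underlying_toBZero`). -/
def LocalAutomorphism.underlying (Γ : OneGrading (LieAlg (n := n) G)) {C : CartanGeometry (n := n) (k := k) (m := m) P B M}
    (φ : LocalAutomorphism C) (v : BZero Γ P B) : BZero Γ P B :=
  toBZero Γ P (φ.total (Quotient.out v))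

theorem LocalAutomorphism.underlying_toBZero (Γ : OneGrading (LieAlg (n := n) G))
    {C : CartanGeometry (n := n) (k := k) (m := m) P B M} (φ : LocalAutomorphism C) {u : B} (hu : u ∈ φ.total.source) :
    φ.underlying Γ (toBZero Γ P u) = toBZero Γ P (φ.total u) := by
  have h := Quotient.mk_out (s := pPlusSetoid Γ P B) u
  obtain ⟨l, hl, hul⟩ := (pPlusSetoid Γ P B).symm h
  refine Quotient.sound ((pPlusSetoid Γ P B).symm ⟨l, hl, ?_⟩)
  have h2 : (Quotient.out (toBZero Γ P u) : B) = rAct u l := hul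
  exact (congrArg φ.total h2).trans (φ.total_rAct u hu l)

/-- The pullback `φ^*σ = φ⁻¹ ∘ σ ∘ φ₀` of a Weyl structure (over the domain of `φ`). -/
def LocalAutomorphism.pullback {Γ : OneGrading (LieAlg (n := n) G)} {C : CartanGeometry (n := n) (k := k) (m := m) P B M}
    (φ : LocalAutomorphism C) (σ : WeylStructure Γ C) (v : BZero Γ P B) : B :=
  φ.total.symm (σ.toFun (φ.underlying Γ v))

/-- The Weyl structure `σ` is `φ`-invariant at `x`: `φ^*σ = σ` on the fiber of `B₀` over `x`. -/
def WeylStructure.InvariantAt {Γ : OneGrading (LieAlg (n := n) G)} {C : CartanGeometry (n := n) (k := k) (m := m) P B M}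
    (σ : WeylStructure Γ C) (φ : LocalAutomorphism C) (x : M) : Prop :=
  ∀ v : BZero Γ P B, projZero Γ C v = x → φ.pullback σ v = σ.toFun v

end Weyl

end

end ParabolicGeometry

/-! Let `E` be the grading element; it exists because derivations of a semisimple Lie algebra are
inner. If `φ` covers a symmetry at `x` and `u` is a frame over `x`, then `φ(u) = u · g` with `g ∈
P`. Since `φ` preserves `ω` and the symmetry has differential `-id` at `x`, `Ad g` acts by `-1` on
`𝔤/𝔭` (`CartanGeometry.actsBy_neg_one`).

Algebra (`OneGrading.ActsBy`): an automorphism which preserves the filtration and acts by a sign `ε`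
on `𝔤/𝔭` acts by `ε` on `𝔤₁` and moves `E` only by an element of `𝔤₁`. If it fixes `E`, it is `ε`,
`1`, `ε` on `𝔤₋₁`, `𝔤₀`, `𝔤₁`. Moreover `Ad (exp Z) E = E - Z` for `Z ∈ 𝔤₁`. So frames can be
compared through the motion of `E`: a Weyl structure is `φ`-invariant at `x` iff `Ad g E = E` at the
frames `u` over `x` in its image (`WeylStructure.invariantAt_iff`).

Analysis: `ω` is an absolute parallelism, so two maps which pull it back to the same form and agree
at a frame agree near it (`CartanGeometry.eventuallyEq_of_form`). Right translation by `h` preserves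
`ω` if `Ad h = id`.

For (1), at a frame in the image of the common Weyl structure the elements belonging to `φ` and `ψ`
both fix `E` and act by `-1`. Hence they have the same adjoint action, and by rigidity `ψ = φ · h`
near the frame with `Ad h = id`. Equivariance spreads this over the fiber, with `h` replaced by its
conjugates. Elements with trivial adjoint action form a normal subgroup inside the stabilizer of the
filtration, which settles the kernel if `P` is this stabilizer. If `G/P` is connected, the
centralizer of such an element is open, hence transitive on `G/P`, which gives the same.

For (2), coverings of one symmetry satisfy `ψ = φ · f` with `f` smooth, and comparing pullbacks
gives `ω = Ad(f⁻¹) ω + δf`, with `δf` the logarithmic derivative of `f`. As `δf` lies in `𝔭`, `Ad f`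
is trivial on `𝔤/𝔭`. Differentiating this puts `δf` into `𝔤₁`, so `Ad(f⁻¹) - id` has values in `𝔤₁`,
which forces `Ad f = id`. For uniqueness, two invariant Weyl structures give frames `u` and `u · exp
Z`. Then `Ad g` fixes `E` and `E - Z` but sends `Z` to `-Z`, so `Z = 0`.

For (3), `Ad (g * g) = id` and `φ(φ(u)) = u · (g * g)`, so by rigidity `φ ∘ φ` is a right
translation near `u` and covers the identity. The fixed point is isolated because `s - id` has
differential `-2 id` there. -/

namespace ParabolicGeometry
noncomputable section

/-! ### Algebra of `|1|`-gradings: components, filtration, grading element. -/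

namespace OneGrading

variable {L : Type*} [LieRing L] [LieAlgebra ℝ L] (Γ : OneGrading L)

/-- Indicator functions `c` give the projections onto the components; `c i = i` gives the grading
derivation. -/
theorem exists_linearMap (c : ℤ → ℝ) : ∃ D : L →ₗ[ℝ] L, ∀ i, ∀ X ∈ Γ.gr i, D X = c i • X := by
  classical
  let e := LinearEquiv.ofBijective (DirectSum.coeLinearMap Γ.gr) Γ.isInternal
  refine ⟨(DirectSum.toModule ℝ ℤ L fun i => c i • (Γ.gr i).subtype) ∘ₗ e.symm.toLinearMap, ?_⟩
  intro i X hX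
  have h : e.symm X = DirectSum.lof ℝ ℤ (fun i => Γ.gr i) i ⟨X, hX⟩ := by
    rw [LinearEquiv.symm_apply_eq]
    simp only [e]
    exact (DirectSum.coeLinearMap_lof Γ.gr i ⟨X, hX⟩).symm
  simp [h]

theorem iSup_gr : ⨆ i, Γ.gr i = ⊤ := Γ.isInternal.submodule_iSup_eq_top

theorem eq_of_abs_le {i : ℤ} (h : |i| ≤ 1) : i = -1 ∨ i = 0 ∨ i = 1 := by
  rw [abs_le] at h; omega

theorem exists_decomp (X : L) : ∃ A ∈ Γ.gr (-1), ∃ B ∈ Γ.gr 0, ∃ C ∈ Γ.gr 1, X = A + B + C := by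
  have hX : X ∈ ⨆ i, Γ.gr i := by rw [Γ.iSup_gr]; trivial
  refine Submodule.iSup_induction Γ.gr (motive := fun X => ∃ A ∈ Γ.gr (-1), ∃ B ∈ Γ.gr 0,
    ∃ C ∈ Γ.gr 1, X = A + B + C) hX ?_ ?_ ?_
  · intro i X hX
    by_cases hi : |i| ≤ 1
    · rcases eq_of_abs_le hi with rfl | rfl | rfl
      · exact ⟨X, hX, 0, zero_mem _, 0, zero_mem _, by simp⟩
      · exact ⟨0, zero_mem _, X, hX, 0, zero_mem _, by simp⟩
      · exact ⟨0, zero_mem _, 0, zero_mem _, X, hX, by simp⟩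
    · rw [Γ.eq_bot i (not_le.1 hi), Submodule.mem_bot] at hX
      exact ⟨0, zero_mem _, 0, zero_mem _, 0, zero_mem _, by simp [hX]⟩
  · exact ⟨0, zero_mem _, 0, zero_mem _, 0, zero_mem _, by simp⟩
  · rintro X Y ⟨A, hA, B, hB, C, hC, rfl⟩ ⟨A', hA', B', hB', C', hC', rfl⟩
    exact ⟨A + A', add_mem hA hA', B + B', add_mem hB hB', C + C', add_mem hC hC', by abel⟩

theorem eq_zero_of_add_eq_zero {A B C : L} (hA : A ∈ Γ.gr (-1)) (hB : B ∈ Γ.gr 0)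
    (hC : C ∈ Γ.gr 1) (h : A + B + C = 0) : A = 0 ∧ B = 0 ∧ C = 0 := by
  obtain ⟨D, hD⟩ := Γ.exists_linearMap (fun i => if i = -1 then 1 else 0)
  obtain ⟨D', hD'⟩ := Γ.exists_linearMap (fun i => if i = 1 then 1 else 0)
  have h1 := congrArg D h
  have h2 := congrArg D' h
  rw [map_add, map_add, hD _ A hA, hD _ B hB, hD _ C hC] at h1
  rw [map_add, map_add, hD' _ A hA, hD' _ B hB, hD' _ C hC] at h2
  norm_num at h1 h2
  refine ⟨h1, ?_, h2⟩
  simpa [h1, h2] using h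

theorem eq_zero_of_mem_of_mem {i j : ℤ} (hij : i ≠ j) {X : L} (hi : X ∈ Γ.gr i)
    (hj : X ∈ Γ.gr j) : X = 0 := by
  obtain ⟨D, hD⟩ := Γ.exists_linearMap (fun l => if l = i then 1 else 0)
  have h1 := hD i X hi
  rw [hD j X hj] at h1
  simpa [hij.symm] using h1.symm

theorem mem_filtration_zero {X : L} :
    X ∈ Γ.filtration 0 ↔ ∃ B ∈ Γ.gr 0, ∃ C ∈ Γ.gr 1, X = B + C := by
  have h : Γ.filtration 0 = Γ.gr 0 ⊔ Γ.gr 1 := by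
    refine le_antisymm (iSup₂_le fun j hj => ?_) (sup_le ?_ ?_)
    · by_cases hi : |j| ≤ 1
      · rcases eq_of_abs_le hi with rfl | rfl | rfl
        · omega
        · exact le_sup_left
        · exact le_sup_right
      · rw [Γ.eq_bot j (not_le.1 hi)]; exact bot_le
    · exact le_iSup₂_of_le (f := fun j (_ : (0 : ℤ) ≤ j) => Γ.gr j) 0 le_rfl le_rfl
    · exact le_iSup₂_of_le (f := fun j (_ : (0 : ℤ) ≤ j) => Γ.gr j) 1 (by norm_num) le_rfl
  rw [h, Submodule.mem_sup]
  constructor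
  · rintro ⟨B, hB, C, hC, rfl⟩; exact ⟨B, hB, C, hC, rfl⟩
  · rintro ⟨B, hB, C, hC, rfl⟩; exact ⟨B, hB, C, hC, rfl⟩

theorem filtration_one : Γ.filtration 1 = Γ.gr 1 := by
  refine le_antisymm (iSup₂_le fun j hj => ?_) ?_
  · by_cases hi : |j| ≤ 1
    · rcases eq_of_abs_le hi with rfl | rfl | rfl
      · omega
      · omega
      · exact le_rfl
    · rw [Γ.eq_bot j (not_le.1 hi)]; exact bot_le
  · exact le_iSup₂_of_le (f := fun j (_ : (1 : ℤ) ≤ j) => Γ.gr j) 1 le_rfl le_rfl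

theorem filtration_of_one_lt {i : ℤ} (h : 1 < i) : Γ.filtration i = ⊥ := by
  refine le_antisymm (iSup₂_le fun j hj => ?_) bot_le
  rw [Γ.eq_bot j (by rw [abs_of_pos] <;> omega)]

theorem mem_filtration_of_lt_zero {i : ℤ} (h : i < 0) (X : L) : X ∈ Γ.filtration i := by
  have hm : ∀ j, i ≤ j → ∀ Y ∈ Γ.gr j, Y ∈ Γ.filtration i := fun j hj Y hY =>
    (le_iSup₂_of_le (f := fun j (_ : i ≤ j) => Γ.gr j) j hj le_rfl) hY
  obtain ⟨A, hA, B, hB, C, hC, rfl⟩ := Γ.exists_decomp X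
  exact add_mem (add_mem (hm _ (by omega) A hA) (hm _ (by omega) B hB)) (hm _ (by omega) C hC)

theorem gr_zero_le : Γ.gr 0 ≤ Γ.filtration 0 := fun B hB =>
  Γ.mem_filtration_zero.2 ⟨B, hB, 0, zero_mem _, by simp⟩

theorem gr_one_le : Γ.gr 1 ≤ Γ.filtration 0 := fun C hC =>
  Γ.mem_filtration_zero.2 ⟨0, zero_mem _, C, hC, by simp⟩

theorem eq_zero_of_mem_filtration_zero {X : L} (h : X ∈ Γ.filtration 0) (h' : X ∈ Γ.gr (-1)) :
    X = 0 := by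
  obtain ⟨B, hB, C, hC, rfl⟩ := Γ.mem_filtration_zero.1 h
  have := Γ.eq_zero_of_add_eq_zero (neg_mem h') hB hC (by abel)
  simp [this.2.1, this.2.2]

/-- The bracket of elements of degrees `i`, `j` lies in degree `l = i + j`. -/
theorem lie_mem' {i j : ℤ} (l : ℤ) (h : i + j = l) {X Y : L} (hX : X ∈ Γ.gr i) (hY : Y ∈ Γ.gr j) :
    ⁅X, Y⁆ ∈ Γ.gr l := h ▸ Γ.lie_mem i j X hX Y hY

theorem lie_eq_zero {i j : ℤ} (h : 1 < |i + j|) {X Y : L} (hX : X ∈ Γ.gr i) (hY : Y ∈ Γ.gr j) :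
    ⁅X, Y⁆ = 0 := by
  have := Γ.lie_mem i j X hX Y hY
  rwa [Γ.eq_bot _ h, Submodule.mem_bot] at this

/-- `p = L₀ ⊕ L₁` acts on `L₁`, and `L₁` acts trivially on `L₁`. -/
theorem lie_gr_one_of_mem {X Z : L} (hX : X ∈ Γ.filtration 0) (hZ : Z ∈ Γ.gr 1) :
    ⁅X, Z⁆ ∈ Γ.gr 1 := by
  obtain ⟨B, hB, C, hC, rfl⟩ := Γ.mem_filtration_zero.1 hX
  rw [add_lie, Γ.lie_eq_zero (by norm_num) hC hZ, add_zero]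
  exact Γ.lie_mem' 1 (by norm_num) hB hZ

theorem lie_mem_filtration_zero {X Y : L} (hX : X ∈ Γ.filtration 0) (hY : Y ∈ Γ.filtration 0) :
    ⁅X, Y⁆ ∈ Γ.filtration 0 := by
  obtain ⟨B, hB, C, hC, rfl⟩ := Γ.mem_filtration_zero.1 hY
  rw [lie_add]
  refine add_mem ?_ (Γ.gr_one_le (Γ.lie_gr_one_of_mem hX hC))
  obtain ⟨B', hB', C', hC', rfl⟩ := Γ.mem_filtration_zero.1 hX
  rw [add_lie]
  exact add_mem (Γ.gr_zero_le (Γ.lie_mem' 0 (by norm_num) hB' hB))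
    (Γ.gr_one_le (Γ.lie_mem' 1 (by norm_num) hC' hB))

/-- The grading element. -/
structure IsGradingElement (E : L) : Prop where
  lie_eq : ∀ i : ℤ, ∀ X ∈ Γ.gr i, ⁅E, X⁆ = (i : ℝ) • X

/-- Multiplication by the degree is a derivation because the bracket adds degrees, and every
derivation of a Killing Lie algebra is inner. -/
theorem exists_gradingElement [FiniteDimensional ℝ L] [LieAlgebra.IsKilling ℝ L] :
    ∃ E, Γ.IsGradingElement E := by
  obtain ⟨D, hD⟩ := Γ.exists_linearMap (fun i => (i : ℝ))
  have hlie : ∀ X Y, D ⁅X, Y⁆ = ⁅X, D Y⁆ - ⁅Y, D X⁆ := by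
    intro X Y
    have hX : X ∈ ⨆ i, Γ.gr i := by rw [Γ.iSup_gr]; trivial
    have hY : Y ∈ ⨆ i, Γ.gr i := by rw [Γ.iSup_gr]; trivial
    induction hX using Submodule.iSup_induction' with
    | mem i X hX =>
      induction hY using Submodule.iSup_induction' with
      | mem j Y hY =>
        rw [hD _ _ (Γ.lie_mem i j X hX Y hY), hD _ _ hX, hD _ _ hY, lie_smul, lie_smul,
          ← lie_skew X Y]
        push_cast
        module
      | zero => simp
      | add Y Y' _ _ h h' =>
        rw [lie_add, map_add, h, h', map_add, lie_add, add_lie]; abel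
    | zero => simp
    | add X X' _ _ h h' =>
      rw [add_lie, map_add, h, h', map_add, lie_add, add_lie]; abel
  obtain ⟨E, hE⟩ := LieDerivation.IsKilling.exists_eq_ad (R := ℝ) (L := L) ⟨D, hlie⟩
  refine ⟨E, ⟨fun i X hX => ?_⟩⟩
  have h := congrArg (fun d : LieDerivation ℝ L L => d X) hE
  simp only [LieDerivation.ad_apply_apply] at h
  exact h.trans (hD i X hX)

variable {Γ}

/-! ### Killing form duality and faithfulness of the actions on `L₋₁`. -/

namespace IsGradingElement

variable {E : L} (hE : Γ.IsGradingElement E)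
include hE

theorem lie_neg {X : L} (h : X ∈ Γ.gr (-1)) : ⁅E, X⁆ = -X := by simpa using hE.lie_eq _ X h
theorem lie_zero {X : L} (h : X ∈ Γ.gr 0) : ⁅E, X⁆ = 0 := by simpa using hE.lie_eq _ X h
theorem lie_one {X : L} (h : X ∈ Γ.gr 1) : ⁅E, X⁆ = X := by simpa using hE.lie_eq _ X h

/-- The eigenvalues `-1`, `0`, `1` of `ad E` are distinct, so the two foreign components vanish.
Thus an automorphism which fixes `E` preserves the whole grading. -/
theorem mem_of_lie_eq {i : ℤ} (hi : |i| ≤ 1) {X : L} (h : ⁅E, X⁆ = (i : ℝ) • X) : X ∈ Γ.gr i := by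
  obtain ⟨A, hA, B, hB, C, hC, rfl⟩ := Γ.exists_decomp X
  rw [lie_add, lie_add, hE.lie_neg hA, hE.lie_zero hB, hE.lie_one hC] at h
  rcases eq_of_abs_le hi with rfl | rfl | rfl
  · have := Γ.eq_zero_of_add_eq_zero (zero_mem _) hB ((Γ.gr 1).smul_mem 2 hC) (by
      linear_combination (norm := (push_cast; module)) (1 : ℝ) • h)
    rw [this.2.1, (smul_eq_zero_iff_right (two_ne_zero' ℝ)).1 this.2.2]; simpa using hA
  · have := Γ.eq_zero_of_add_eq_zero hA (zero_mem _) (neg_mem hC) (by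
      linear_combination (norm := (push_cast; module)) (-1 : ℝ) • h)
    rw [this.1, neg_eq_zero.1 this.2.2]; simpa using hB
  · have := Γ.eq_zero_of_add_eq_zero ((Γ.gr (-1)).smul_mem 2 hA) hB (zero_mem _) (by
      linear_combination (norm := (push_cast; module)) (-1 : ℝ) • h)
    rw [this.2.1, (smul_eq_zero_iff_right (two_ne_zero' ℝ)).1 this.1]; simpa using hC

theorem mem_gr_zero : E ∈ Γ.gr 0 := hE.mem_of_lie_eq (by norm_num) (by simp)

/-- Invariance of the form under `ad E` gives `(i + j) * K(X, Y) = 0`. -/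
theorem killingForm_eq_zero {i j : ℤ} (hij : i + j ≠ 0) {X Y : L} (hX : X ∈ Γ.gr i)
    (hY : Y ∈ Γ.gr j) : killingForm ℝ L X Y = 0 := by
  have h := LieModule.traceForm_apply_lie_apply' ℝ L L E X Y
  rw [hE.lie_eq i X hX, hE.lie_eq j Y hY] at h
  simp only [map_smul, LinearMap.smul_apply, smul_eq_mul] at h
  have : ((i + j : ℤ) : ℝ) ≠ 0 := by exact_mod_cast hij
  have h2 : ((i + j : ℤ) : ℝ) * LieModule.traceForm ℝ L L X Y = 0 := by push_cast; linarith
  exact (mul_eq_zero.1 h2).resolve_left this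

variable [LieAlgebra.IsKilling ℝ L]

theorem eq_zero_of_killingForm {W : L} (hW : W ∈ Γ.gr 1)
    (h : ∀ X ∈ Γ.gr (-1), killingForm ℝ L W X = 0) : W = 0 := by
  refine (LieAlgebra.IsKilling.killingForm_nondegenerate ℝ L).1 W fun Y => ?_
  obtain ⟨A, hA, B, hB, C, hC, rfl⟩ := Γ.exists_decomp Y
  rw [map_add, map_add, h A hA, hE.killingForm_eq_zero (by norm_num) hW hB,
    hE.killingForm_eq_zero (by norm_num) hW hC]
  simp

/-- `K(W, X) = K([E, W], X) = K(E, [W, X]) = 0`, and `L₁` is dual to `L₋₁`. -/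
theorem eq_zero_of_lie_gr_neg_one {W : L} (hW : W ∈ Γ.gr 1) (h : ∀ X ∈ Γ.gr (-1), ⁅W, X⁆ = 0) :
    W = 0 := by
  refine hE.eq_zero_of_killingForm hW fun X hX => ?_
  have h1 := LieModule.traceForm_apply_lie_apply ℝ L L E W X
  rw [hE.lie_one hW, h X hX] at h1
  simpa using h1

/-- This is where the exclusion of simple ideals in `L₀` enters: the kernel of `L₀` acting on `L₋₁`
is an ideal of `L` inside `L₀`, and a nonzero ideal of a semisimple algebra contains a simple one.
-/
theorem eq_zero_of_gr_zero_lie_gr_neg_one (hss : LieAlgebra.IsSemisimple ℝ L) {A : L}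
    (hA : A ∈ Γ.gr 0)
    (h : ∀ X ∈ Γ.gr (-1), ⁅A, X⁆ = 0) : A = 0 := by
  -- By duality the action on `L₁` vanishes too: `K([A, Z], X) = -K(Z, [A, X]) = 0`. This makes the
  -- kernel an ideal.
  have key : ∀ A ∈ Γ.gr 0, (∀ X ∈ Γ.gr (-1), ⁅A, X⁆ = 0) → ∀ Z ∈ Γ.gr 1, ⁅A, Z⁆ = 0 := by
    intro A hA h Z hZ
    refine hE.eq_zero_of_killingForm (Γ.lie_mem' 1 (by norm_num) hA hZ) fun X hX => ?_
    rw [LieModule.traceForm_apply_lie_apply', h X hX]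
    simp
  let J : LieIdeal ℝ L :=
    { carrier := {A | A ∈ Γ.gr 0 ∧ ∀ X ∈ Γ.gr (-1), ⁅A, X⁆ = 0}
      add_mem' := fun ha hb => ⟨add_mem ha.1 hb.1, fun X hX => by
        rw [add_lie, ha.2 X hX, hb.2 X hX, add_zero]⟩
      zero_mem' := ⟨zero_mem _, fun X _ => zero_lie X⟩
      smul_mem' := fun c A ha => ⟨Submodule.smul_mem _ c ha.1, fun X hX => by
        rw [smul_lie, ha.2 X hX, smul_zero]⟩
      lie_mem := by
        intro Y A hA
        obtain ⟨N, hN, B, hB, C, hC, rfl⟩ := Γ.exists_decomp Y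
        have h1 : ⁅N, A⁆ = 0 := by rw [← lie_skew, hA.2 _ hN, neg_zero]
        have h2 : ⁅C, A⁆ = 0 := by rw [← lie_skew, key A hA.1 hA.2 _ hC, neg_zero]
        rw [add_lie, add_lie, h1, h2, zero_add, add_zero]
        refine ⟨Γ.lie_mem' 0 (by norm_num) hB hA.1, fun X hX => ?_⟩
        rw [lie_lie, hA.2 X hX, _root_.lie_zero, hA.2 _ (Γ.lie_mem' (-1) (by norm_num) hB hX), sub_zero] }
  have hJ : J = ⊥ := by
    by_contra hne
    obtain ⟨I, hI, hIJ⟩ := (IsAtomic.eq_bot_or_exists_atom_le J).resolve_left hne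
    exact Γ.no_simple_ideal I (LieAlgebra.IsSemisimple.isSimple_of_isAtom I hI)
      fun Y hY => (hIJ hY).1
  have : A ∈ J := ⟨hA, h⟩
  rwa [hJ, LieSubmodule.mem_bot] at this

/-- On `L / L⁰`, a copy of `L₋₁`, the degree-one part of `D` acts by zero and the degree-zero part
acts faithfully. -/
theorem mem_gr_one_of_lie (hss : LieAlgebra.IsSemisimple ℝ L) {D : L} (hD : D ∈ Γ.filtration 0)
    (h : ∀ X ∈ Γ.gr (-1), ⁅D, X⁆ ∈ Γ.filtration 0) : D ∈ Γ.gr 1 := by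
  obtain ⟨B, hB, C, hC, rfl⟩ := Γ.mem_filtration_zero.1 hD
  have : B = 0 := hE.eq_zero_of_gr_zero_lie_gr_neg_one hss hB fun X hX => by
    refine Γ.eq_zero_of_mem_filtration_zero ?_ (Γ.lie_mem' (-1) (by norm_num) hB hX)
    have h1 := h X hX
    rw [add_lie] at h1
    exact (Submodule.add_mem_iff_left _ (Γ.gr_zero_le (Γ.lie_mem' 0 (by norm_num) hC hX))).1 h1
  rw [this, zero_add]; exact hC

end IsGradingElement

/-- `α` preserves the filtration of `L` (in both directions) and acts as `ε` on `L / L⁰`. -/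
structure ActsBy (Γ : OneGrading L) (α : L ≃ₗ⁅ℝ⁆ L) (ε : ℝ) : Prop where
  map_zero : ∀ X ∈ Γ.filtration 0, α X ∈ Γ.filtration 0
  map_one : ∀ X ∈ Γ.gr 1, α X ∈ Γ.gr 1
  symm_sub : ∀ X, α.symm X - ε • X ∈ Γ.filtration 0
  sq : ε * ε = 1

/-! ### Automorphisms preserving the filtration and acting by a sign on `L / L⁰`. -/

namespace ActsBy

variable {α : L ≃ₗ⁅ℝ⁆ L} {ε : ℝ} (hα : Γ.ActsBy α ε)
include hα

/-- `ActsBy` is phrased with `α.symm` because `ω` transforms by `Ad(h⁻¹)`. As `ε` is its own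
inverse, the same condition holds for `α`. -/
theorem sub_mem (X : L) : α X - ε • X ∈ Γ.filtration 0 := by
  have h := hα.map_zero _ (hα.symm_sub X)
  rw [map_sub, LieEquiv.apply_symm_apply, map_smul] at h
  have h2 := Submodule.smul_mem (Γ.filtration 0) (-ε) h
  rw [smul_sub, smul_smul, neg_mul, hα.sq] at h2
  convert h2 using 1
  module

-- Splitting `α⁻¹ X` into `ε X` and an error, which lies in `L⁰` under `ActsBy`, reduces `[α Y, X]`
-- to brackets of `Y` with known elements.
omit hα in
theorem lie_apply (α : L ≃ₗ⁅ℝ⁆ L) (ε : ℝ) (Y X : L) :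
    ⁅α Y, X⁆ = α ⁅Y, α.symm X - ε • X⁆ + ε • α ⁅Y, X⁆ := by
  have hX' : X = α (α.symm X) := by simp
  conv_lhs => rw [hX']
  rw [← LieEquiv.map_lie, lie_sub, lie_smul, map_sub, map_smul]
  abel

variable {E : L} (hE : Γ.IsGradingElement E) [LieAlgebra.IsKilling ℝ L]
include hE

/-- On `L / L⁰` the map `α` is a scalar, so conjugating by it changes nothing: `α Y` and `Y` act
there in the same way. Elements of `L⁰` acting trivially on `L / L⁰` lie in `L₁`. -/
theorem sub_mem_gr_one (hss : LieAlgebra.IsSemisimple ℝ L) [FiniteDimensional ℝ L] {Y : L}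
    (hY : Y ∈ Γ.filtration 0) : α Y - Y ∈ Γ.gr 1 := by
  refine hE.mem_gr_one_of_lie hss (_root_.sub_mem (hα.map_zero Y hY) hY) fun X _ => ?_
  have h : ⁅α Y - Y, X⁆ = α ⁅Y, α.symm X - ε • X⁆ + ε • (α ⁅Y, X⁆ - ε • ⁅Y, X⁆) := by
    rw [sub_lie, lie_apply α ε, smul_sub, smul_smul, hα.sq, one_smul]; abel
  rw [h]
  exact add_mem (hα.map_zero _ (Γ.lie_mem_filtration_zero hY (hα.symm_sub X)))
    (Submodule.smul_mem _ _ (hα.sub_mem _))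

/-- For `X` of degree `-1` the bracket of `α Z - ε Z` with `X` has degree `0`, but `lie_apply` and
`sub_mem_gr_one` also put it in `L₁`. So it vanishes, and `L₁` acts faithfully on `L₋₁`. -/
theorem apply_gr_one (hss : LieAlgebra.IsSemisimple ℝ L) [FiniteDimensional ℝ L] {Z : L}
    (hZ : Z ∈ Γ.gr 1) : α Z = ε • Z := by
  rw [← sub_eq_zero]
  have hm : α Z - ε • Z ∈ Γ.gr 1 := _root_.sub_mem (hα.map_one Z hZ) (Submodule.smul_mem _ _ hZ)
  refine hE.eq_zero_of_lie_gr_neg_one hm fun X hX => ?_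
  have hZX : ⁅Z, X⁆ ∈ Γ.gr 0 := Γ.lie_mem' 0 (by norm_num) hZ hX
  have h : ⁅α Z - ε • Z, X⁆ = α ⁅Z, α.symm X - ε • X⁆ + ε • (α ⁅Z, X⁆ - ⁅Z, X⁆) := by
    rw [sub_lie, lie_apply α ε, smul_sub, smul_lie]; abel
  refine Γ.eq_zero_of_mem_of_mem (i := 0) (j := 1) (by norm_num)
    (Γ.lie_mem' 0 (by norm_num) hm hX) ?_
  rw [h]
  refine add_mem (hα.map_one _ ?_)
    (Submodule.smul_mem _ _ (hα.sub_mem_gr_one hE hss (Γ.gr_zero_le hZX)))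
  rw [← lie_skew]
  exact neg_mem (Γ.lie_gr_one_of_mem (hα.symm_sub X) hZ)

theorem sub_gradingElement_mem (hss : LieAlgebra.IsSemisimple ℝ L) [FiniteDimensional ℝ L] :
    α E - E ∈ Γ.gr 1 :=
  hα.sub_mem_gr_one hE hss (Γ.gr_zero_le hE.mem_gr_zero)

omit hα [LieAlgebra.IsKilling ℝ L] in
theorem map_gr (h : α E = E) (i : ℤ) {X : L} (hX : X ∈ Γ.gr i) : α X ∈ Γ.gr i := by
  by_cases hi : |i| ≤ 1
  · refine hE.mem_of_lie_eq hi ?_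
    conv_lhs => rw [← h]
    rw [← LieEquiv.map_lie, hE.lie_eq i X hX, map_smul]
  · rw [Γ.eq_bot i (not_le.1 hi), Submodule.mem_bot] at hX ⊢
    rw [hX, _root_.map_zero]

/-- An automorphism of a graded semisimple Lie algebra which fixes the grading element is determined
by its action on `L / L⁰`. -/
theorem apply_eq (hss : LieAlgebra.IsSemisimple ℝ L) [FiniteDimensional ℝ L] (h : α E = E)
    {A B C : L} (hA : A ∈ Γ.gr (-1)) (hB : B ∈ Γ.gr 0) (hC : C ∈ Γ.gr 1) :
    α (A + B + C) = ε • A + B + ε • C := by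
  have h1 : α A = ε • A := by
    rw [← sub_eq_zero]
    exact Γ.eq_zero_of_mem_filtration_zero (hα.sub_mem A)
      (_root_.sub_mem (map_gr hE h _ hA) (Submodule.smul_mem _ _ hA))
  have h2 : α B = B := by
    rw [← sub_eq_zero]
    exact Γ.eq_zero_of_mem_of_mem (i := 0) (j := 1) (by norm_num)
      (_root_.sub_mem (map_gr hE h _ hB) hB) (hα.sub_mem_gr_one hE hss (Γ.gr_zero_le hB))
  rw [map_add, map_add, h1, h2, hα.apply_gr_one hE hss hC]

theorem eq_of_apply_gradingElement (hss : LieAlgebra.IsSemisimple ℝ L) [FiniteDimensional ℝ L]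
    {β : L ≃ₗ⁅ℝ⁆ L} (hβ : Γ.ActsBy β ε) (h : α E = E) (h' : β E = E) (X : L) : α X = β X := by
  obtain ⟨A, hA, B, hB, C, hC, rfl⟩ := Γ.exists_decomp X
  rw [hα.apply_eq hE hss h hA hB hC, hβ.apply_eq hE hss h' hA hB hC]

end ActsBy
end OneGrading
end
end ParabolicGeometry
-- The adjoint action by Lie algebra automorphisms.
namespace ParabolicGeometry
noncomputable section

section Adjoint

variable {n : ℕ} {G : Type*} [TopologicalSpace G]
  [ChartedSpace (EuclideanSpace ℝ (Fin n)) G] [Group G] [LieGroup (𝓡 n) ∞ G]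

instance finiteDimensional_lieAlg : FiniteDimensional ℝ (LieAlg (n := n) G) :=
  inferInstanceAs (FiniteDimensional ℝ (EuclideanSpace ℝ (Fin n)))

theorem contMDiff_conj (g : G) : ContMDiff (𝓡 n) (𝓡 n) ∞ (fun a : G => g * a * g⁻¹) :=
  (contMDiff_mul_right (a := g⁻¹)).comp (contMDiff_mul_left (a := g))

theorem mdifferentiable_conj (g : G) : MDifferentiable (𝓡 n) (𝓡 n) (fun a : G => g * a * g⁻¹) :=
  (contMDiff_conj g).mdifferentiable (by simp)

theorem mdifferentiable_mul_left' (g : G) : MDifferentiable (𝓡 n) (𝓡 n) (fun a : G => g * a) :=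
  (contMDiff_mul_left (I := 𝓡 n) (n := ∞) (a := g)).mdifferentiable (by simp)

omit [LieGroup (𝓡 n) ∞ G] in
theorem Ad_one : Ad (n := n) (1 : G) = ContinuousLinearMap.id ℝ (LieAlg (n := n) G) := by
  have h : (fun a : G => 1 * a * 1⁻¹) = id := by ext; simp
  unfold Ad
  rw [h]
  exact mfderiv_id

theorem Ad_mul_apply (g h : G) (X : LieAlg (n := n) G) : Ad (g * h) X = Ad g (Ad h X) := by
  have e : (fun a : G => g * h * a * (g * h)⁻¹) =
      (fun a : G => g * a * g⁻¹) ∘ (fun a : G => h * a * h⁻¹) := by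
    ext a; simp only [Function.comp]; group
  have h1 : h * 1 * h⁻¹ = 1 := by group
  have h2 := mfderiv_comp (I := 𝓡 n) (I' := 𝓡 n) (I'' := 𝓡 n) (1 : G)
    (mdifferentiable_conj (n := n) g (h * 1 * h⁻¹)) (mdifferentiable_conj (n := n) h 1)
  rw [← e] at h2
  have h3 : Ad (n := n) (g * h) X = mfderiv (𝓡 n) (𝓡 n) (fun a : G => g * a * g⁻¹) (h * 1 * h⁻¹)
      (Ad (n := n) h X) := congrArg (fun T => T X) h2
  rw [h3, h1]
  rfl

theorem Ad_inv_apply (g : G) (X : LieAlg (n := n) G) : Ad g⁻¹ (Ad g X) = X := by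
  rw [← Ad_mul_apply, inv_mul_cancel, Ad_one]; rfl

theorem Ad_apply_inv (g : G) (X : LieAlg (n := n) G) : Ad g (Ad g⁻¹ X) = X := by
  rw [← Ad_mul_apply, mul_inv_cancel, Ad_one]; rfl

/-- Conjugation is a group homomorphism, so it intertwines left translations. -/
theorem mfderiv_conj_mulInvariantVectorField (g a : G) (X : LieAlg (n := n) G) :
    (mfderiv (𝓡 n) (𝓡 n) (fun a : G => g * a * g⁻¹) a (mulInvariantVectorField X a) :
      EuclideanSpace ℝ (Fin n)) =
    mulInvariantVectorField (I := 𝓡 n) (Ad g X) (g * a * g⁻¹) := by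
  have e : (fun b : G => g * b * g⁻¹) ∘ (fun b : G => a * b) =
      (fun b : G => (g * a * g⁻¹) * b) ∘ (fun b : G => g * b * g⁻¹) := by
    ext b; simp only [Function.comp]; group
  have h1 := mfderiv_comp (I := 𝓡 n) (I' := 𝓡 n) (I'' := 𝓡 n) (1 : G)
    (mdifferentiable_conj (n := n) g (a * 1)) (mdifferentiable_mul_left' (n := n) a 1)
  have h2 := mfderiv_comp (I := 𝓡 n) (I' := 𝓡 n) (I'' := 𝓡 n) (1 : G)
    (mdifferentiable_mul_left' (n := n) (g * a * g⁻¹) (g * 1 * g⁻¹))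
    (mdifferentiable_conj (n := n) g 1)
  rw [e] at h1
  have h3 := congrArg (fun T => T X) (h1.symm.trans h2)
  have h4 : g * 1 * g⁻¹ = 1 := by group
  change mfderiv (𝓡 n) (𝓡 n) (fun a : G => g * a * g⁻¹) (a * 1) (mulInvariantVectorField X a) =
    mfderiv (𝓡 n) (𝓡 n) (fun b : G => (g * a * g⁻¹) * b) (g * 1 * g⁻¹) (Ad g X) at h3
  rw [mul_one a, h4] at h3
  exact h3

theorem mfderiv_conj_inv_apply (g a : G) (v : EuclideanSpace ℝ (Fin n)) :
    (mfderiv (𝓡 n) (𝓡 n) (fun b : G => g⁻¹ * b * g) (g * a * g⁻¹)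
      (mfderiv (𝓡 n) (𝓡 n) (fun b : G => g * b * g⁻¹) a v) : EuclideanSpace ℝ (Fin n)) = v := by
  have e : (fun b : G => g⁻¹ * b * g) ∘ (fun b : G => g * b * g⁻¹) = id := by
    ext b; simp only [Function.comp, id]; group
  have hd := mdifferentiable_conj (n := n) g⁻¹ (g * a * g⁻¹)
  rw [inv_inv] at hd
  have h1 := mfderiv_comp (I := 𝓡 n) (I' := 𝓡 n) (I'' := 𝓡 n) a hd
    (mdifferentiable_conj (n := n) g a)
  rw [e] at h1
  have h2 := congrArg (fun T => T v) (h1.symm.trans mfderiv_id)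
  exact h2

theorem isInvertible_mfderiv_conj (g a : G) :
    (mfderiv (𝓡 n) (𝓡 n) (fun a : G => g * a * g⁻¹) a).IsInvertible := by
  have h := mfderiv_conj_inv_apply (n := n) g⁻¹ (g * a * g⁻¹)
  have e : g⁻¹ * (g * a * g⁻¹) * g⁻¹⁻¹ = a := by group
  rw [e, inv_inv] at h
  exact ⟨ContinuousLinearEquiv.equivOfInverse
    (mfderiv (𝓡 n) (𝓡 n) (fun a : G => g * a * g⁻¹) a :
      EuclideanSpace ℝ (Fin n) →L[ℝ] EuclideanSpace ℝ (Fin n))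
    (mfderiv (𝓡 n) (𝓡 n) (fun b : G => g⁻¹ * b * g) (g * a * g⁻¹) :
      EuclideanSpace ℝ (Fin n) →L[ℝ] EuclideanSpace ℝ (Fin n))
    (mfderiv_conj_inv_apply g a) h, rfl⟩

open VectorField in
theorem mpullback_conj (g : G) (X : LieAlg (n := n) G) :
    mpullback (𝓡 n) (𝓡 n) (fun a : G => g * a * g⁻¹) (mulInvariantVectorField (Ad g X)) =
      mulInvariantVectorField X := by
  funext a
  rw [mpullback_apply, (isInvertible_mfderiv_conj g a).inverse_apply_eq]
  exact (mfderiv_conj_mulInvariantVectorField g a X).symm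

-- Brackets are natural under pullback by the diffeomorphism `a ↦ g a g⁻¹`; evaluate
-- `mpullback_conj` at `1`.
open VectorField in
theorem Ad_lie (g : G) (X Y : LieAlg (n := n) G) : Ad g ⁅X, Y⁆ = ⁅Ad g X, Ad g Y⁆ := by
  have h := mpullback_mlieBracket (I := 𝓡 n) (I' := 𝓡 n) (n := ∞)
    (f := fun a : G => g * a * g⁻¹) (x₀ := 1)
    (mdifferentiableAt_mulInvariantVectorField (Ad (n := n) g X))
    (mdifferentiableAt_mulInvariantVectorField (Ad (n := n) g Y)) (contMDiff_conj g).contMDiffAt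
    (by rw [minSmoothness_of_isRCLikeNormedField]; exact WithTop.coe_le_coe.2 le_top)
  rw [mpullback_conj, mpullback_conj, mpullback_apply,
    (isInvertible_mfderiv_conj g 1).inverse_apply_eq] at h
  have h4 : g * 1 * g⁻¹ = 1 := by group
  rw [h4] at h
  exact h.symm

/-- The adjoint action by Lie algebra automorphisms. -/
def adEquiv (g : G) : LieAlg (n := n) G ≃ₗ⁅ℝ⁆ LieAlg (n := n) G :=
  { (Ad (n := n) g : LieAlg (n := n) G →ₗ[ℝ] LieAlg (n := n) G) with
    map_lie' := fun {X Y} => Ad_lie g X Y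
    invFun := Ad (n := n) g⁻¹
    left_inv := Ad_inv_apply g
    right_inv := Ad_apply_inv g }

@[simp] theorem adEquiv_apply (g : G) (X : LieAlg (n := n) G) : adEquiv g X = Ad g X := rfl

@[simp] theorem adEquiv_symm_apply (g : G) (X : LieAlg (n := n) G) :
    (adEquiv g).symm X = Ad g⁻¹ X := rfl

end Adjoint
end
end ParabolicGeometry
-- The derivative of `Ad` for a local group on a vector space.
namespace ParabolicGeometry
noncomputable section

section LocalGroup

variable {F : Type*} [NormedAddCommGroup F] [NormedSpace ℝ F]

/-- The adjoint action of a local Lie group with product `μ`, unit `c` and conjugation `κ` is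
differentiable at the unit, with derivative given by the Lie bracket of left invariant vector
fields. -/
theorem hasFDerivAt_localAd {μ κ : F × F → F} {c : F} (hμ : ContDiffAt ℝ 2 μ (c, c))
    (hκ : ContDiffAt ℝ 2 κ (c, c)) (h1 : ∀ᶠ y in 𝓝 c, μ (y, c) = y)
    (h2 : ∀ᶠ y in 𝓝 c, μ (c, y) = y) (hκc : ∀ᶠ y in 𝓝 c, κ (y, c) = c)
    (h3 : ∀ᶠ z in 𝓝 c, κ (c, z) = z) (hμκ : ∀ᶠ p in 𝓝 (c, c), μ p = μ (κ p, p.1)) (X : F) :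
    ∃ A' : F →L[ℝ] F, HasFDerivAt (fun y => fderiv ℝ κ (y, c) (0, X)) A' c ∧
      ∀ Z, A' Z = VectorField.lieBracket ℝ (fun y => fderiv ℝ μ (y, c) (0, Z))
        (fun y => fderiv ℝ μ (y, c) (0, X)) c := by
  have hμ' : DifferentiableAt ℝ (fderiv ℝ μ) (c, c) :=
    (hμ.fderiv_right (m := 1) (by norm_num)).differentiableAt (by norm_num)
  have hκ' : DifferentiableAt ℝ (fderiv ℝ κ) (c, c) :=
    (hκ.fderiv_right (m := 1) (by norm_num)).differentiableAt (by norm_num)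
  have hμd : ∀ᶠ p in 𝓝 (c, c), DifferentiableAt ℝ μ p := by
    filter_upwards [hμ.eventually (by simp)] with p hp using hp.differentiableAt (by norm_num)
  have hκd : ∀ᶠ p in 𝓝 (c, c), DifferentiableAt ℝ κ p := by
    filter_upwards [hκ.eventually (by simp)] with p hp using hp.differentiableAt (by norm_num)
  have il : ∀ y : F, HasFDerivAt (fun y : F => (y, c)) (ContinuousLinearMap.inl ℝ F F) y :=
    fun y => hasFDerivAt_prodMk_left y c
  have ir : ∀ y z : F, HasFDerivAt (fun z : F => (y, z)) (ContinuousLinearMap.inr ℝ F F) z :=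
    fun y z => hasFDerivAt_prodMk_right y z
  have tl : Filter.Tendsto (fun y : F => (y, c)) (𝓝 c) (𝓝 (c, c)) := (il c).continuousAt
  have tr : Filter.Tendsto (fun y : F => (c, y)) (𝓝 c) (𝓝 (c, c)) := (ir c c).continuousAt
  -- the derivatives of `μ` and `κ` along a slot at a fixed unit
  have dμr : ∀ W, fderiv ℝ μ (c, c) (0, W) = W := fun W => by
    have h := (hμ.differentiableAt (by norm_num)).hasFDerivAt.comp c (ir c c)
    have h' := h.unique ((hasFDerivAt_id (𝕜 := ℝ) c).congr_of_eventuallyEq h2)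
    simpa using congrArg (fun T => T W) h'
  have dμl : ∀ W, fderiv ℝ μ (c, c) (W, 0) = W := fun W => by
    have h := (hμ.differentiableAt (by norm_num)).hasFDerivAt.comp (f := fun y : F => (y, c)) c (il c)
    have h' := h.unique ((hasFDerivAt_id (𝕜 := ℝ) c).congr_of_eventuallyEq h1)
    simpa using congrArg (fun T => T W) h'
  have dκr : ∀ W, fderiv ℝ κ (c, c) (0, W) = W := fun W => by
    have h := (hκ.differentiableAt (by norm_num)).hasFDerivAt.comp c (ir c c)
    have h' := h.unique ((hasFDerivAt_id (𝕜 := ℝ) c).congr_of_eventuallyEq h3)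
    simpa using congrArg (fun T => T W) h'
  have hA := (hκ'.hasFDerivAt.comp (f := fun y : F => (y, c)) c (il c)).clm_apply (hasFDerivAt_const ((0 : F), X) c)
  have hμ2 : ∀ W : F, HasFDerivAt (fun y => fderiv ℝ μ (y, c) (0, W)) _ c := fun W =>
    (hμ'.hasFDerivAt.comp (f := fun y : F => (y, c)) c (il c)).clm_apply (hasFDerivAt_const ((0 : F), W) c)
  have hsymm : IsSymmSndFDerivAt ℝ μ (c, c) := hμ.isSymmSndFDerivAt (by simp)
  refine ⟨_, hA, fun Z => ?_⟩
  -- differentiate `μ (y, z) = μ (κ (y, z), y)` in `z`, then in `y`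
  have key : ∀ᶠ y in 𝓝 c, fderiv ℝ μ (y, c) (0, X) =
      fderiv ℝ μ (c, y) (fderiv ℝ κ (y, c) (0, X), 0) := by
    filter_upwards [tl.eventually hμκ.eventually_nhds, tl.eventually hμd, tl.eventually hκd,
      tr.eventually hμd, hκc] with y hy hyμ hyκ hyμ' hyc
    have e1 := hyμ.hasFDerivAt.comp c (ir y c)
    have e2 := (hyκ.hasFDerivAt.comp c (ir y c)).prodMk (hasFDerivAt_const y c)
    have e3 : HasFDerivAt μ (fderiv ℝ μ (c, y)) ((κ ∘ fun z => (y, z)) c, y) := by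
      simpa [hyc] using hyμ'.hasFDerivAt
    have e4 := HasFDerivAt.comp (f := fun z => ((κ ∘ fun z => (y, z)) z, y)) c e3 e2
    have e5 := e1.unique (e4.congr_of_eventuallyEq ((ir y c).continuousAt.eventually hy))
    simpa using congrArg (fun T => T X) e5
  have hR := (hμ'.hasFDerivAt.comp (f := fun y : F => (c, y)) c (ir c c)).clm_apply
    (hA.prodMk (hasFDerivAt_const (0 : F) c))
  have e := (hμ2 X).unique (hR.congr_of_eventuallyEq key)
  have eZ := congrArg (fun T => T Z) e
  rw [VectorField.lieBracket, (hμ2 X).fderiv, (hμ2 Z).fderiv]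
  simp [dμr, dμl, dκr] at eZ ⊢
  -- The differentiated identity reads `D²μ((Z,0),(0,X)) = D²μ((0,Z),(X,0)) + A' Z`. Symmetry of
  -- `D²μ` turns the middle term into the second term of the Lie bracket.
  have hs := hsymm.eq (X, 0) (0, Z)
  rw [hs, eZ]
  abel

end LocalGroup
end
end ParabolicGeometry
-- The derivative of `Ad` at `1` in the chart of `G`.
namespace ParabolicGeometry
noncomputable section

section AdDerivative

variable {n : ℕ} {G : Type*} [TopologicalSpace G]
  [ChartedSpace (EuclideanSpace ℝ (Fin n)) G] [Group G] [LieGroup (𝓡 n) ∞ G]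

theorem hasFDerivAt_of_hasMFDerivAt {M : Type*} [TopologicalSpace M]
    {F F' : Type*} [NormedAddCommGroup F] [NormedSpace ℝ F] [NormedAddCommGroup F']
    [NormedSpace ℝ F'] [ChartedSpace F M] {M' : Type*} [TopologicalSpace M'] [ChartedSpace F' M']
    {f : M → M'} {x : M} {f' : F →L[ℝ] F'} (h : HasMFDerivAt 𝓘(ℝ, F) 𝓘(ℝ, F') f x f') :
    HasFDerivAt (extChartAt 𝓘(ℝ, F') (f x) ∘ f ∘ (extChartAt 𝓘(ℝ, F) x).symm) f'
      (extChartAt 𝓘(ℝ, F) x x) := by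
  have := h.2
  rw [ModelWithCorners.range_eq_univ] at this
  exact hasFDerivWithinAt_univ.1 this

theorem contDiffAt_extChartAt_comp {m : ℕ} {M : Type*} [TopologicalSpace M]
    [ChartedSpace (EuclideanSpace ℝ (Fin m)) M] [IsManifold (𝓡 m) ∞ M]
    {F : Type*} [NormedAddCommGroup F] [NormedSpace ℝ F] {x : M} {f : F → M} {p : F}
    (hf : ContMDiffAt 𝓘(ℝ, F) (𝓡 m) ∞ f p) (hx : f p ∈ (extChartAt (𝓡 m) x).source) :
    ContDiffAt ℝ ∞ (fun q => extChartAt (𝓡 m) x (f q)) p := by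
  rw [← contMDiffAt_iff_contDiffAt]
  rw [extChartAt_source] at hx
  exact (contMDiffAt_extChartAt' hx).comp p hf

theorem contMDiffAt_extChartAt_symm_comp {m : ℕ} {M : Type*} [TopologicalSpace M]
    [ChartedSpace (EuclideanSpace ℝ (Fin m)) M] [IsManifold (𝓡 m) ∞ M]
    {F : Type*} [NormedAddCommGroup F] [NormedSpace ℝ F] {x : M}
    {f : F → EuclideanSpace ℝ (Fin m)} {p : F}
    (hf : ContDiffAt ℝ ∞ f p) (hx : f p ∈ (extChartAt (𝓡 m) x).target) :
    ContMDiffAt 𝓘(ℝ, F) (𝓡 m) ∞ (fun q => (extChartAt (𝓡 m) x).symm (f q)) p := by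
  have h := (contMDiffOn_extChartAt_symm (I := 𝓡 m) (n := ∞) x).contMDiffAt
    ((isOpen_extChartAt_target x).mem_nhds hx)
  exact h.comp p hf.contMDiffAt

variable (G) in
/-- The product of `G` in the chart at `1`. -/
def chartMul (p : EuclideanSpace ℝ (Fin n) × EuclideanSpace ℝ (Fin n)) :
    EuclideanSpace ℝ (Fin n) :=
  extChartAt (𝓡 n) (1 : G) ((extChartAt (𝓡 n) (1 : G)).symm p.1 *
    (extChartAt (𝓡 n) (1 : G)).symm p.2)

variable (G) in
/-- The conjugation of `G` in the chart at `1`. -/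
def chartConj (p : EuclideanSpace ℝ (Fin n) × EuclideanSpace ℝ (Fin n)) :
    EuclideanSpace ℝ (Fin n) :=
  extChartAt (𝓡 n) (1 : G) ((extChartAt (𝓡 n) (1 : G)).symm p.1 *
    (extChartAt (𝓡 n) (1 : G)).symm p.2 * ((extChartAt (𝓡 n) (1 : G)).symm p.1)⁻¹)

theorem contDiffAt_chartMul {p : EuclideanSpace ℝ (Fin n) × EuclideanSpace ℝ (Fin n)}
    (h1 : p.1 ∈ (extChartAt (𝓡 n) (1 : G)).target) (h2 : p.2 ∈ (extChartAt (𝓡 n) (1 : G)).target)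
    (h : (extChartAt (𝓡 n) (1 : G)).symm p.1 * (extChartAt (𝓡 n) (1 : G)).symm p.2 ∈
      (extChartAt (𝓡 n) (1 : G)).source) : ContDiffAt ℝ ∞ (chartMul G) p :=
  contDiffAt_extChartAt_comp
    ((contMDiffAt_extChartAt_symm_comp contDiffAt_fst h1).mul
      (contMDiffAt_extChartAt_symm_comp contDiffAt_snd h2)) h

theorem contDiffAt_chartConj {p : EuclideanSpace ℝ (Fin n) × EuclideanSpace ℝ (Fin n)}
    (h1 : p.1 ∈ (extChartAt (𝓡 n) (1 : G)).target) (h2 : p.2 ∈ (extChartAt (𝓡 n) (1 : G)).target)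
    (h : (extChartAt (𝓡 n) (1 : G)).symm p.1 * (extChartAt (𝓡 n) (1 : G)).symm p.2 *
      ((extChartAt (𝓡 n) (1 : G)).symm p.1)⁻¹ ∈
      (extChartAt (𝓡 n) (1 : G)).source) : ContDiffAt ℝ ∞ (chartConj G) p :=
  contDiffAt_extChartAt_comp
    (((contMDiffAt_extChartAt_symm_comp contDiffAt_fst h1).mul
      (contMDiffAt_extChartAt_symm_comp contDiffAt_snd h2)).mul
      (contMDiffAt_extChartAt_symm_comp contDiffAt_fst h1).inv) h

local notation "φ₁" => extChartAt (𝓡 n) (1 : G)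

theorem Ad_eq_fderiv_chartConj {y : EuclideanSpace ℝ (Fin n)} (hy : y ∈ (φ₁).target)
    (X : LieAlg (n := n) G) :
    (Ad ((φ₁).symm y) X : EuclideanSpace ℝ (Fin n)) =
      fderiv ℝ (chartConj G) (y, φ₁ 1) ((0, X) :
        EuclideanSpace ℝ (Fin n) × EuclideanSpace ℝ (Fin n)) := by
  set g := (φ₁).symm y with hg
  have hs : (φ₁).symm (φ₁ 1) = 1 := extChartAt_to_inv 1
  have h4 : g * 1 * g⁻¹ = 1 := by group
  have h1 := hasFDerivAt_of_hasMFDerivAt (F := EuclideanSpace ℝ (Fin n))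
    (F' := EuclideanSpace ℝ (Fin n)) (f := fun a : G => g * a * g⁻¹) (f' := Ad (n := n) g)
    ((mdifferentiable_conj (n := n) g) 1).hasMFDerivAt
  rw [h4] at h1
  have h2 := (contDiffAt_chartConj (p := (y, φ₁ 1)) hy (mem_extChartAt_target 1) (by
    simp only [hs]; rw [← hg, h4]; exact mem_extChartAt_source 1)).differentiableAt (by simp)
  have h3 := h2.hasFDerivAt.comp (f := fun z : EuclideanSpace ℝ (Fin n) => (y, z)) (φ₁ 1)
    (hasFDerivAt_prodMk_right y (φ₁ 1))
  have h5 := congrArg (fun T : EuclideanSpace ℝ (Fin n) →L[ℝ] EuclideanSpace ℝ (Fin n) => T X) (h1.unique h3)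
  exact h5

/-- A left invariant field at `g` is the derivative of `a ↦ g a` at `1`, hence in coordinates a
partial derivative of the product. Brackets and smoothness of such fields are computed from this
formula. -/
theorem mfderiv_extChartAt_mulInvariantVectorField {g : G} (hgs : g ∈ (φ₁).source)
    (X : LieAlg (n := n) G) :
    (mfderiv (𝓡 n) 𝓘(ℝ, EuclideanSpace ℝ (Fin n)) φ₁ g (mulInvariantVectorField X g) :
      EuclideanSpace ℝ (Fin n)) =
      fderiv ℝ (chartMul G) (φ₁ g, φ₁ 1) ((0, X) :
        EuclideanSpace ℝ (Fin n) × EuclideanSpace ℝ (Fin n)) := by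
  have : IsManifold (𝓡 n) 1 G := IsManifold.of_le (n := ∞) (by simp)
  have hg : (φ₁).symm (φ₁ g) = g := (φ₁).left_inv hgs
  have hs : (φ₁).symm (φ₁ 1) = 1 := extChartAt_to_inv 1
  have hgs' : g ∈ (chartAt (EuclideanSpace ℝ (Fin n)) (1 : G)).source := by
    rwa [← extChartAt_source (𝓡 n)]
  have hd : MDifferentiableAt (𝓡 n) 𝓘(ℝ, EuclideanSpace ℝ (Fin n)) φ₁ (g * 1) := by
    rw [mul_one]; exact mdifferentiableAt_extChartAt hgs'
  have h1 := hasFDerivAt_of_hasMFDerivAt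
    (hd.hasMFDerivAt.comp 1 ((mdifferentiable_mul_left' (n := n) g) 1).hasMFDerivAt)
  have h2 := (contDiffAt_chartMul (p := (φ₁ g, φ₁ 1)) ((φ₁).map_source hgs)
    (mem_extChartAt_target 1) (by
    simp only [hs, hg, mul_one]; exact hgs)).differentiableAt (by simp)
  have h3 := h2.hasFDerivAt.comp (f := fun z : EuclideanSpace ℝ (Fin n) => (φ₁ g, z)) (φ₁ 1)
    (hasFDerivAt_prodMk_right (φ₁ g) (φ₁ 1))
  have h4 : ((φ₁ ∘ (fun a => g * a)) ∘ (φ₁).symm) = chartMul G ∘ fun z => (φ₁ g, z) := by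
    funext z
    simp only [Function.comp, chartMul, hg]
  have h5 : mfderiv (𝓡 n) 𝓘(ℝ, EuclideanSpace ℝ (Fin n)) φ₁ (g * 1) (mulInvariantVectorField X g) =
      fderiv ℝ (chartMul G) (φ₁ g, φ₁ 1) ((0, X) :
        EuclideanSpace ℝ (Fin n) × EuclideanSpace ℝ (Fin n)) := by
    rw [← h4] at h3
    exact congrArg (fun T : EuclideanSpace ℝ (Fin n) →L[ℝ] EuclideanSpace ℝ (Fin n) => T X)
      (h1.unique h3)
  rw [mul_one] at h5
  exact h5

open VectorField in
theorem mpullbackWithin_mulInvariantVectorField {y : EuclideanSpace ℝ (Fin n)}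
    (hy : y ∈ (φ₁).target) (X : LieAlg (n := n) G) :
    mpullbackWithin 𝓘(ℝ, EuclideanSpace ℝ (Fin n)) (𝓡 n) (φ₁).symm (mulInvariantVectorField X)
      (Set.range (𝓡 n)) y =
      fderiv ℝ (chartMul G) (y, φ₁ 1) ((0, X) :
        EuclideanSpace ℝ (Fin n) × EuclideanSpace ℝ (Fin n)) := by
  have : IsManifold (𝓡 n) 1 G := IsManifold.of_le (n := ∞) (by simp)
  have h5 := mfderiv_extChartAt_mulInvariantVectorField ((φ₁).map_target hy) X
  rw [(φ₁).right_inv hy] at h5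
  have h6 := mfderivWithin_extChartAt_symm_comp_mfderiv_extChartAt (I := 𝓡 n) (x := (1 : G)) hy
  have h7 := congrArg (fun T : EuclideanSpace ℝ (Fin n) →L[ℝ] EuclideanSpace ℝ (Fin n) =>
    T (show EuclideanSpace ℝ (Fin n) from
      mulInvariantVectorField (I := 𝓡 n) X ((φ₁).symm y))) h6
  refine Eq.trans ?_ h5
  exact ((isInvertible_mfderivWithin_extChartAt_symm hy).inverse_apply_eq).2 h7.symm

/-- The formula `d(Ad)(Z) X = [Z, X]` is the only link used between `Ad` as a function on `G` and
the bracket. It is `hasFDerivAt_localAd` for the product and conjugation in the chart, where `(g a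
g⁻¹) g = g a`. -/
theorem hasMFDerivAt_Ad_one (X : LieAlg (n := n) G) :
    ∃ A' : EuclideanSpace ℝ (Fin n) →L[ℝ] EuclideanSpace ℝ (Fin n),
      HasMFDerivAt (M' := EuclideanSpace ℝ (Fin n)) (𝓡 n) 𝓘(ℝ, EuclideanSpace ℝ (Fin n))
        (fun g : G => Ad g X) 1 A' ∧
      ∀ Z : LieAlg (n := n) G, A' Z = ⁅Z, X⁆ := by
  have : IsManifold (𝓡 n) 1 G := IsManifold.of_le (n := ∞) (by simp)
  have : IsTopologicalGroup G := topologicalGroup_of_lieGroup (𝓡 n) ∞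
  have hs : (φ₁).symm (φ₁ 1) = 1 := extChartAt_to_inv 1
  have ht : (φ₁).target ∈ 𝓝 (φ₁ 1) := extChartAt_target_mem_nhds 1
  have hcs : ContinuousAt (φ₁).symm (φ₁ 1) := continuousAt_extChartAt_symm 1
  have hsrc : (φ₁).source ∈ 𝓝 (1 : G) := extChartAt_source_mem_nhds 1
  have c1 : ContinuousAt (fun p : EuclideanSpace ℝ (Fin n) × EuclideanSpace ℝ (Fin n) =>
      (φ₁).symm p.1) (φ₁ 1, φ₁ 1) := ContinuousAt.comp (f := Prod.fst) hcs continuousAt_fst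
  have c2 : ContinuousAt (fun p : EuclideanSpace ℝ (Fin n) × EuclideanSpace ℝ (Fin n) =>
      (φ₁).symm p.2) (φ₁ 1, φ₁ 1) := ContinuousAt.comp (f := Prod.snd) hcs continuousAt_snd
  have hκs : ∀ᶠ p : EuclideanSpace ℝ (Fin n) × EuclideanSpace ℝ (Fin n) in 𝓝 (φ₁ 1, φ₁ 1),
      (φ₁).symm p.1 * (φ₁).symm p.2 * ((φ₁).symm p.1)⁻¹ ∈ (φ₁).source := by
    refine ((c1.mul c2).mul c1.inv).eventually_mem ?_
    simpa [hs] using hsrc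
  obtain ⟨A', hA, hA'⟩ := hasFDerivAt_localAd (μ := chartMul G) (κ := chartConj G) (c := φ₁ 1)
    ((contDiffAt_chartMul (mem_extChartAt_target 1) (mem_extChartAt_target 1)
      (by rw [hs, mul_one]; exact mem_extChartAt_source 1)).of_le (WithTop.coe_le_coe.2 le_top))
    ((contDiffAt_chartConj (mem_extChartAt_target 1) (mem_extChartAt_target 1)
      (by rw [hs, mul_one, inv_one, mul_one]; exact mem_extChartAt_source 1)).of_le (WithTop.coe_le_coe.2 le_top))
    (by filter_upwards [ht] with y hy; simp only [chartMul, hs, mul_one]; exact (φ₁).right_inv hy)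
    (by filter_upwards [ht] with y hy; simp only [chartMul, hs, one_mul]; exact (φ₁).right_inv hy)
    (by filter_upwards [ht] with y hy; simp only [chartConj, hs, mul_one, mul_inv_cancel])
    (by
      filter_upwards [ht] with y hy
      simp only [chartConj, hs, one_mul, inv_one, mul_one]; exact (φ₁).right_inv hy)
    (by
      filter_upwards [hκs] with p hp
      simp only [chartMul, chartConj, (φ₁).left_inv hp, inv_mul_cancel_right]) X
  have hB : HasFDerivAt (F := EuclideanSpace ℝ (Fin n))
      (fun y => (Ad (n := n) ((φ₁).symm y) X)) A' (φ₁ 1) :=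
    HasFDerivAt.congr_of_eventuallyEq hA (by filter_upwards [ht] with y hy; exact Ad_eq_fderiv_chartConj hy X)
  have hφ := (mdifferentiableAt_extChartAt (I := 𝓡 n) (mem_chart_source _ (1 : G))).hasMFDerivAt
  rw [mfderiv_extChartAt_self] at hφ
  have hC := HasMFDerivAt.comp (1 : G) hB.hasMFDerivAt hφ
  refine ⟨A', ?_, fun Z => ?_⟩
  · refine HasMFDerivAt.congr_of_eventuallyEq hC ?_
    filter_upwards [hsrc] with g hg
    simp only [Function.comp, (φ₁).left_inv hg]
    rfl
  · let V : LieAlg (n := n) G → EuclideanSpace ℝ (Fin n) → EuclideanSpace ℝ (Fin n) := fun W =>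
      VectorField.mpullbackWithin 𝓘(ℝ, EuclideanSpace ℝ (Fin n)) (𝓡 n) (φ₁).symm
        (mulInvariantVectorField W) (Set.range (𝓡 n))
    have e : ∀ W : LieAlg (n := n) G,
        (fun y => fderiv ℝ (chartMul G) (y, φ₁ 1) (0, W)) =ᶠ[𝓝 (φ₁ 1)] V W := fun W => by
      filter_upwards [ht] with y hy
      exact (mpullbackWithin_mulInvariantVectorField hy W).symm
    have h1 := (hA' Z).trans ((e Z).lieBracket_vectorField_eq (e X))
    rw [← VectorField.lieBracketWithin_univ] at h1
    rw [h1, GroupLieAlgebra.bracket_def, VectorField.mlieBracket,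
      VectorField.mlieBracketWithin_apply, mfderiv_extChartAt_self, Set.preimage_univ,
      Set.univ_inter]
    have hid : (ContinuousLinearMap.id ℝ (EuclideanSpace ℝ (Fin n))).inverse =
      ContinuousLinearMap.id ℝ (EuclideanSpace ℝ (Fin n)) := ContinuousLinearMap.inverse_id
    change _ = (ContinuousLinearMap.id ℝ (EuclideanSpace ℝ (Fin n))).inverse
      (VectorField.lieBracketWithin ℝ (V Z) (V X) (Set.range (𝓡 n)) (φ₁ 1))
    rw [hid, ModelWithCorners.range_eq_univ]
    rfl

end AdDerivative
end
end ParabolicGeometry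
-- One-parameter subgroups: existence, uniqueness, smoothness.
namespace ParabolicGeometry
noncomputable section

theorem hasMFDerivAt_congr_point {F F' H H' N N' : Type*} [NormedAddCommGroup F] [NormedSpace ℝ F]
    [NormedAddCommGroup F'] [NormedSpace ℝ F'] [TopologicalSpace H] [TopologicalSpace H']
    [TopologicalSpace N] [TopologicalSpace N'] [ChartedSpace H N] [ChartedSpace H' N']
    {I : ModelWithCorners ℝ F H} {I' : ModelWithCorners ℝ F' H'} {f : N → N'} {x y : N}
    {f' : F →L[ℝ] F'} (h : HasMFDerivAt I I' f x f') (e : x = y) : HasMFDerivAt I I' f y f' := by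
  subst e; exact h

/-- Solutions of an autonomous smooth ordinary differential equation are smooth. -/
theorem contDiffAt_of_hasDerivAt_comp {F : Type*} [NormedAddCommGroup F] [NormedSpace ℝ F]
    {v : F → F} {y : ℝ → F} {t₀ : ℝ} (hy : ∀ᶠ t in 𝓝 t₀, HasDerivAt y (v (y t)) t)
    (hv : ∀ᶠ z in 𝓝 (y t₀), ContDiffAt ℝ ∞ v z) : ContDiffAt ℝ ∞ y t₀ := by
  obtain ⟨U, hU, hUo, ht₀⟩ := eventually_nhds_iff.1
    (hy.and (hy.self_of_nhds.continuousAt.eventually hv))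
  -- Bootstrapping: if `y` is `C^k`, then so is `y' = v ∘ y`.
  have key : ∀ k : ℕ, ContDiffOn ℝ k y U := by
    intro k
    induction k with
    | zero => exact contDiffOn_zero.2 fun t ht => (hU t ht).1.continuousAt.continuousWithinAt
    | succ k ih =>
      push_cast
      rw [contDiffOn_succ_iff_deriv_of_isOpen hUo]
      refine ⟨fun t ht => (hU t ht).1.differentiableAt.differentiableWithinAt, by simp, ?_⟩
      have : Set.EqOn (deriv y) (fun t => v (y t)) U := fun t ht => (hU t ht).1.deriv
      refine ContDiffOn.congr (fun t ht => ?_) this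
      exact ((hU t ht).2.of_le (by exact_mod_cast le_top)).comp_contDiffWithinAt t (ih t ht)
  exact (contDiffOn_infty.2 key).contDiffAt (hUo.mem_nhds ht₀)

section OneParameter

variable {n : ℕ} {G : Type*} [TopologicalSpace G]
  [ChartedSpace (EuclideanSpace ℝ (Fin n)) G] [Group G]

/-- `γ` is the one-parameter subgroup with initial velocity `Z`. -/
structure IsOneParameter (γ : ℝ → G) (Z : LieAlg (n := n) G) : Prop where
  contMDiff : ContMDiff 𝓘(ℝ, ℝ) (𝓡 n) ∞ γ
  map_add : ∀ s t, γ (s + t) = γ s * γ t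
  mfderiv_zero : (mfderiv 𝓘(ℝ, ℝ) (𝓡 n) γ 0 (1 : ℝ) : EuclideanSpace ℝ (Fin n)) = Z

theorem mem_expSet {V : Set (LieAlg (n := n) G)} {g : G} :
    g ∈ expSet V ↔ ∃ γ : ℝ → G, ∃ Z ∈ V, IsOneParameter γ Z ∧ γ 1 = g :=
  ⟨fun ⟨γ, h1, h2, h3, h4⟩ => ⟨γ, _, h3, ⟨h1, h2, rfl⟩, h4⟩,
    fun ⟨γ, _, hZ, h, h4⟩ => ⟨γ, h.contMDiff, h.map_add, h.mfderiv_zero ▸ hZ, h4⟩⟩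

/-- The linear map `ℝ → 𝔤` with value `Z` at `1`. -/
def lineTo (Z : LieAlg (n := n) G) : ℝ →L[ℝ] EuclideanSpace ℝ (Fin n) :=
  (1 : ℝ →L[ℝ] ℝ).smulRight (show EuclideanSpace ℝ (Fin n) from Z)

theorem lineTo_one (Z : LieAlg (n := n) G) : lineTo Z 1 = Z := one_smul ℝ (show EuclideanSpace ℝ (Fin n) from Z)

namespace IsOneParameter

variable {γ δ : ℝ → G} {Z W : LieAlg (n := n) G}

theorem map_zero (h : IsOneParameter γ Z) : γ 0 = 1 := by
  have := h.map_add 0 0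
  rw [add_zero] at this
  exact left_eq_mul.1 this

theorem map_neg (h : IsOneParameter γ Z) (t : ℝ) : γ (-t) = (γ t)⁻¹ := by
  rw [eq_inv_iff_mul_eq_one, ← h.map_add, neg_add_cancel, h.map_zero]

theorem hasMFDerivAt_zero (h : IsOneParameter γ Z) :
    HasMFDerivAt 𝓘(ℝ, ℝ) (𝓡 n) γ 0 (lineTo Z) := by
  have h1 := (h.contMDiff.mdifferentiable (by simp) 0).hasMFDerivAt
  have e : (mfderiv 𝓘(ℝ, ℝ) (𝓡 n) γ 0 : ℝ →L[ℝ] EuclideanSpace ℝ (Fin n)) = lineTo Z := by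
    refine ContinuousLinearMap.ext_ring ?_
    refine h.mfderiv_zero.trans ?_
    exact (one_smul ℝ (show EuclideanSpace ℝ (Fin n) from Z)).symm
  exact h1.congr_mfderiv e

variable [LieGroup (𝓡 n) ∞ G]

theorem isMIntegralCurve (h : IsOneParameter γ Z) :
    IsMIntegralCurve (I := 𝓡 n) γ (mulInvariantVectorField Z) := by
  intro t
  have h1 : HasMFDerivAt 𝓘(ℝ, ℝ) 𝓘(ℝ, ℝ) (fun s : ℝ => s - t) t (ContinuousLinearMap.id ℝ ℝ) :=
    ((hasFDerivAt_id t).sub_const t).hasMFDerivAt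
  have h2 := HasMFDerivAt.comp (f := fun s : ℝ => s - t) t (hasMFDerivAt_congr_point h.hasMFDerivAt_zero (sub_self t).symm) h1
  have h3 : HasMFDerivAt (𝓡 n) (𝓡 n) (fun a : G => γ t * a) (γ (t - t))
      (mfderiv (𝓡 n) (𝓡 n) (fun a : G => γ t * a) 1 :) :=
    hasMFDerivAt_congr_point ((mdifferentiable_mul_left' (γ t)) 1).hasMFDerivAt
      (by rw [sub_self, h.map_zero])
  have h4 := HasMFDerivAt.comp t h3 h2
  have e : (fun a : G => γ t * a) ∘ γ ∘ (fun s : ℝ => s - t) = γ := by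
    funext s; simp only [Function.comp, ← h.map_add]; congr 1; ring
  rw [e] at h4
  refine h4.congr_mfderiv ?_
  refine ContinuousLinearMap.ext_ring ?_
  exact (ContinuousLinearMap.map_smul
    (mfderiv (𝓡 n) (𝓡 n) (fun a : G => γ t * a) 1 : EuclideanSpace ℝ (Fin n) →L[ℝ]
      EuclideanSpace ℝ (Fin n)) (1 : ℝ) (show EuclideanSpace ℝ (Fin n) from Z))

theorem contMDiff_one_mulInvariantVectorField (Z : LieAlg (n := n) G) :
    ContMDiff (𝓡 n) (𝓡 n).tangent 1
      (fun g : G => (⟨g, mulInvariantVectorField Z g⟩ : TangentBundle (𝓡 n) G)) :=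
  (contMDiff_mulInvariantVectorField Z).of_le (by
    rw [minSmoothness_of_isRCLikeNormedField]; exact WithTop.coe_le_coe.2 (by norm_num))

theorem unique [T2Space G] (hγ : IsOneParameter γ Z) (hδ : IsOneParameter δ Z) : γ = δ := by
  have : IsManifold (𝓡 n) 1 G := IsManifold.of_le (n := ∞) (by simp)
  exact isMIntegralCurve_Ioo_eq_of_contMDiff_boundaryless (t₀ := 0)
    (contMDiff_one_mulInvariantVectorField Z) hγ.isMIntegralCurve hδ.isMIntegralCurve
    (by rw [hγ.map_zero, hδ.map_zero])

end IsOneParameter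

variable [LieGroup (𝓡 n) ∞ G]

theorem mulInvariantVectorField_mul (Z : LieAlg (n := n) G) (g a : G) :
    (mfderiv (𝓡 n) (𝓡 n) (fun b : G => g * b) a (mulInvariantVectorField Z a) :
      EuclideanSpace ℝ (Fin n)) = mulInvariantVectorField (I := 𝓡 n) Z (g * a) := by
  have h1 := mfderiv_comp (I := 𝓡 n) (I' := 𝓡 n) (I'' := 𝓡 n) (1 : G)
    (mdifferentiable_mul_left' (n := n) g (a * 1)) (mdifferentiable_mul_left' (n := n) a 1)
  have e : (fun b : G => g * b) ∘ (fun b : G => a * b) = fun b : G => g * a * b := by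
    funext b; simp [mul_assoc]
  rw [e] at h1
  have h2 := congrArg (fun T : EuclideanSpace ℝ (Fin n) →L[ℝ] EuclideanSpace ℝ (Fin n) => T Z) h1
  change mulInvariantVectorField Z (g * a) = mfderiv (𝓡 n) (𝓡 n) (fun b : G => g * b) (a * 1)
    (mulInvariantVectorField Z a) at h2
  rw [mul_one a] at h2
  exact h2.symm

theorem contDiffAt_leftInvariant (Z : LieAlg (n := n) G) {z : EuclideanSpace ℝ (Fin n)}
    (hz : z ∈ (extChartAt (𝓡 n) (1 : G)).target) :
    ContDiffAt ℝ ∞ (fun z => fderiv ℝ (chartMul G) (z, extChartAt (𝓡 n) (1 : G) 1)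
      ((0, Z) : EuclideanSpace ℝ (Fin n) × EuclideanSpace ℝ (Fin n))) z := by
  have h1 := contDiffAt_chartMul (p := (z, extChartAt (𝓡 n) (1 : G) 1)) hz
    (mem_extChartAt_target 1) (by
      simp only [extChartAt_to_inv, mul_one]; exact (extChartAt (𝓡 n) (1 : G)).map_target hz)
  have h2 : ContDiffAt ℝ ∞ (fderiv ℝ (chartMul G)) (z, extChartAt (𝓡 n) (1 : G) 1) :=
    h1.fderiv_right (by simp)
  have h3 : ContDiffAt ℝ ∞ (fun z : EuclideanSpace ℝ (Fin n) =>
      (z, extChartAt (𝓡 n) (1 : G) 1)) z := contDiffAt_id.prodMk contDiffAt_const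
  exact (h2.comp z h3).clm_apply contDiffAt_const

/-- Regularity of the differential equation in the chart gives smoothness at `0`; the identity `γ s
= γ t * γ (s - t)` carries it to every `t`. -/
theorem contMDiff_of_isMIntegralCurve {Z : LieAlg (n := n) G} {γ : ℝ → G} (h0 : γ 0 = 1)
    (hadd : ∀ s t, γ (s + t) = γ s * γ t)
    (hγ : IsMIntegralCurve (I := 𝓡 n) γ (mulInvariantVectorField Z)) :
    ContMDiff 𝓘(ℝ, ℝ) (𝓡 n) ∞ γ := by
  have : IsManifold (𝓡 n) 1 G := IsManifold.of_le (n := ∞) (by simp)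
  have hsrc : ∀ᶠ t in 𝓝 (0 : ℝ), γ t ∈ (extChartAt (𝓡 n) (1 : G)).source :=
    hγ.continuous.continuousAt.eventually_mem (by rw [h0]; exact extChartAt_source_mem_nhds 1)
  have hy : ∀ᶠ t in 𝓝 (0 : ℝ), HasDerivAt (fun t => extChartAt (𝓡 n) (1 : G) (γ t))
      (fderiv ℝ (chartMul G) (extChartAt (𝓡 n) (1 : G) (γ t), extChartAt (𝓡 n) (1 : G) 1)
      ((0, Z) : EuclideanSpace ℝ (Fin n) × EuclideanSpace ℝ (Fin n))) t := by
    filter_upwards [hsrc] with t ht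
    have ht' : γ t ∈ (chartAt (EuclideanSpace ℝ (Fin n)) (1 : G)).source := by
      rwa [← extChartAt_source (𝓡 n)]
    have h1 := HasMFDerivAt.comp t
      (mdifferentiableAt_extChartAt (I := 𝓡 n) ht').hasMFDerivAt (hγ t)
    have h2 : HasFDerivAt (fun t => extChartAt (𝓡 n) (1 : G) (γ t)) _ t := h1.hasFDerivAt
    rw [← mfderiv_extChartAt_mulInvariantVectorField ht]
    refine (hasDerivAt_iff_hasFDerivAt.2 (h2.congr_fderiv (ContinuousLinearMap.ext_ring ?_)))
    exact ContinuousLinearMap.map_smul (mfderiv (𝓡 n) 𝓘(ℝ, EuclideanSpace ℝ (Fin n))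
      (extChartAt (𝓡 n) (1 : G)) (γ t) : EuclideanSpace ℝ (Fin n) →L[ℝ]
      EuclideanSpace ℝ (Fin n)) (1 : ℝ)
      (show EuclideanSpace ℝ (Fin n) from mulInvariantVectorField (I := 𝓡 n) Z (γ t))
  have hy' := contDiffAt_of_hasDerivAt_comp (v := fun z => fderiv ℝ (chartMul G)
    (z, extChartAt (𝓡 n) (1 : G) 1) ((0, Z) : EuclideanSpace ℝ (Fin n) × EuclideanSpace ℝ (Fin n)))
    hy (by
      rw [h0]
      filter_upwards [extChartAt_target_mem_nhds (I := 𝓡 n) (1 : G)] with z hz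
      exact contDiffAt_leftInvariant Z hz)
  have hγ0 : ContMDiffAt 𝓘(ℝ, ℝ) (𝓡 n) ∞ γ 0 := by
    refine (contMDiffAt_extChartAt_symm_comp (x := (1 : G)) hy' ?_).congr_of_eventuallyEq ?_
    · rw [h0]; exact mem_extChartAt_target 1
    · filter_upwards [hsrc] with t ht
      exact ((extChartAt (𝓡 n) (1 : G)).left_inv ht).symm
  intro t
  have e : γ = (fun a => γ t * a) ∘ γ ∘ (fun s => s - t) := by
    funext s; simp only [Function.comp, ← hadd]; congr 1; ring
  rw [e]
  refine (contMDiff_mul_left (I := 𝓡 n) (n := ∞) (a := γ t)).contMDiffAt.comp t ?_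
  refine ContMDiffAt.comp t ?_ (contDiff_id.sub contDiff_const).contDiffAt.contMDiffAt
  simpa using hγ0

/-- Left translates of integral curves of left invariant vector fields are integral curves. -/
theorem hasMFDerivAt_mul_left {Z : LieAlg (n := n) G} {γ : ℝ → G} {s : Set ℝ} {t : ℝ} (g : G)
    (h : HasMFDerivWithinAt 𝓘(ℝ, ℝ) (𝓡 n) γ s t
      ((1 : ℝ →L[ℝ] ℝ).smulRight (mulInvariantVectorField Z (γ t)))) :
    HasMFDerivWithinAt 𝓘(ℝ, ℝ) (𝓡 n) (fun t => g * γ t) s t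
      ((1 : ℝ →L[ℝ] ℝ).smulRight (mulInvariantVectorField Z (g * γ t))) := by
  have h1 := ((mdifferentiable_mul_left' (n := n) g) (γ t)).hasMFDerivAt.comp_hasMFDerivWithinAt t h
  refine h1.congr_mfderiv ?_
  refine ContinuousLinearMap.ext_ring ?_
  have h2 := mulInvariantVectorField_mul Z g (γ t)
  refine (ContinuousLinearMap.map_smul
    (mfderiv (𝓡 n) (𝓡 n) (fun a : G => g * a) (γ t) : EuclideanSpace ℝ (Fin n) →L[ℝ]
      EuclideanSpace ℝ (Fin n)) (1 : ℝ)
      (show EuclideanSpace ℝ (Fin n) from mulInvariantVectorField (I := 𝓡 n) Z (γ t))).trans ?_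
  exact congrArg (fun w : EuclideanSpace ℝ (Fin n) => (1 : ℝ) • w) h2

/-- Left translates of one short integral curve through `1` exist for the same time at every point,
so the field is complete. Additivity follows from uniqueness of integral curves. -/
theorem exists_isOneParameter [T2Space G] (Z : LieAlg (n := n) G) :
    ∃ γ : ℝ → G, IsOneParameter γ Z := by
  have : IsManifold (𝓡 n) 1 G := IsManifold.of_le (n := ∞) (by simp)
  have hV := IsOneParameter.contMDiff_one_mulInvariantVectorField Z
  obtain ⟨γ₀, hγ₀, hγ₀'⟩ := exists_isMIntegralCurveAt_of_contMDiffAt_boundaryless (t₀ := 0)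
    (hV.contMDiffAt (x := 1))
  obtain ⟨ε, hε, hb⟩ := isMIntegralCurveAt_iff'.1 hγ₀'
  have hloc : ∀ g : G, ∃ γ : ℝ → G, γ 0 = g ∧
      IsMIntegralCurveOn (I := 𝓡 n) γ (mulInvariantVectorField Z) (Set.Ioo (-ε) ε) := by
    intro g
    refine ⟨fun t => g * γ₀ t, by simp [hγ₀], fun t ht => hasMFDerivAt_mul_left g ?_⟩
    have := hb t (by rw [Real.ball_eq_Ioo]; simpa using ht)
    rw [Real.ball_eq_Ioo] at this
    simpa using this
  obtain ⟨γ, hγ0, hγ⟩ := exists_isMIntegralCurve_of_isMIntegralCurveOn hV hε hloc 1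
  have hadd : ∀ s t, γ (s + t) = γ s * γ t := by
    intro s
    have h1 : IsMIntegralCurve (I := 𝓡 n) (γ ∘ (· + s)) (mulInvariantVectorField Z) := hγ.comp_add s
    have h2 : IsMIntegralCurve (I := 𝓡 n) (fun t => γ s * γ t) (mulInvariantVectorField Z) := by
      intro t
      exact hasMFDerivWithinAt_univ.1 (hasMFDerivAt_mul_left (γ s)
        (hasMFDerivWithinAt_univ.2 (hγ t)))
    have h3 := isMIntegralCurve_Ioo_eq_of_contMDiff_boundaryless (t₀ := 0) hV h1 h2
      (by simp [hγ0])
    intro t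
    rw [add_comm]
    exact congrFun h3 t
  refine ⟨γ, contMDiff_of_isMIntegralCurve hγ0 hadd hγ, hadd, ?_⟩
  have h1 := congrArg (fun T : ℝ →L[ℝ] EuclideanSpace ℝ (Fin n) => T 1) (hγ 0).mfderiv
  refine h1.trans ?_
  refine (one_smul ℝ (show EuclideanSpace ℝ (Fin n) from
    mulInvariantVectorField (I := 𝓡 n) Z (γ 0))).trans ?_
  rw [hγ0]
  have e : (fun a : G => 1 * a) = id := by funext a; simp
  unfold mulInvariantVectorField
  rw [e, mfderiv_id]
  rfl

end OneParameter
end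
end ParabolicGeometry
-- Calculus of one-parameter subgroups under `Ad`.
namespace ParabolicGeometry
noncomputable section

section ProductRule

variable {F₀ F₁ F₂ F₃ N₀ N₁ N₂ N₃ : Type*} [NormedAddCommGroup F₀] [NormedSpace ℝ F₀]
  [NormedAddCommGroup F₁] [NormedSpace ℝ F₁] [NormedAddCommGroup F₂] [NormedSpace ℝ F₂]
  [NormedAddCommGroup F₃] [NormedSpace ℝ F₃] [TopologicalSpace N₀] [TopologicalSpace N₁]
  [TopologicalSpace N₂] [TopologicalSpace N₃] [ChartedSpace F₀ N₀] [ChartedSpace F₁ N₁]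
  [ChartedSpace F₂ N₂] [ChartedSpace F₃ N₃]

/-- The product rule: the derivative of `x ↦ Φ (a x, b x)` is the sum of the partial derivatives. -/
theorem mfderiv_comp_prodMk {Φ : N₁ × N₂ → N₃} {a : N₀ → N₁} {b : N₀ → N₂} {x : N₀}
    (hΦ : MDifferentiableAt (𝓘(ℝ, F₁).prod 𝓘(ℝ, F₂)) 𝓘(ℝ, F₃) Φ (a x, b x))
    (ha : MDifferentiableAt 𝓘(ℝ, F₀) 𝓘(ℝ, F₁) a x) (hb : MDifferentiableAt 𝓘(ℝ, F₀) 𝓘(ℝ, F₂) b x)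
    (ξ : F₀) :
    (mfderiv 𝓘(ℝ, F₀) 𝓘(ℝ, F₃) (fun x => Φ (a x, b x)) x ξ : F₃) =
      (mfderiv 𝓘(ℝ, F₁) 𝓘(ℝ, F₃) (fun z => Φ (z, b x)) (a x)
        (mfderiv 𝓘(ℝ, F₀) 𝓘(ℝ, F₁) a x ξ) : F₃) +
      (mfderiv 𝓘(ℝ, F₂) 𝓘(ℝ, F₃) (fun z => Φ (a x, z)) (b x)
        (mfderiv 𝓘(ℝ, F₀) 𝓘(ℝ, F₂) b x ξ) : F₃) := by
  have h1 := HasMFDerivAt.comp (f := fun x => (a x, b x)) x hΦ.hasMFDerivAt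
    (ha.hasMFDerivAt.prodMk hb.hasMFDerivAt)
  have h2 := congrArg (fun T : F₀ →L[ℝ] F₃ => T ξ) h1.mfderiv
  refine h2.trans ?_
  exact mfderiv_prod_eq_add_apply hΦ

end ProductRule

section OneParameter

variable {n : ℕ} {G : Type*} [TopologicalSpace G]
  [ChartedSpace (EuclideanSpace ℝ (Fin n)) G] [Group G] [LieGroup (𝓡 n) ∞ G]

theorem mfderiv_Ad_comp {F N : Type*} [NormedAddCommGroup F] [NormedSpace ℝ F] [TopologicalSpace N]
    [ChartedSpace F N] {f : N → G} {w : N} {f' : F →L[ℝ] EuclideanSpace ℝ (Fin n)}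
    (hf : HasMFDerivAt 𝓘(ℝ, F) (𝓡 n) f w f') (h1 : f w = 1) (X : LieAlg (n := n) G) :
    ∃ A' : F →L[ℝ] EuclideanSpace ℝ (Fin n),
      HasMFDerivAt (M' := EuclideanSpace ℝ (Fin n)) 𝓘(ℝ, F) 𝓘(ℝ, EuclideanSpace ℝ (Fin n))
        (fun w => Ad (f w) X) w A' ∧ ∀ ξ : F, A' ξ = ⁅(show LieAlg (n := n) G from f' ξ), X⁆ := by
  obtain ⟨A', hA, hA'⟩ := hasMFDerivAt_Ad_one X
  exact ⟨A'.comp f', HasMFDerivAt.comp w (hasMFDerivAt_congr_point hA h1.symm) hf,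
    fun ξ => hA' (f' ξ)⟩

namespace IsOneParameter

variable {γ δ : ℝ → G} {Z W : LieAlg (n := n) G}

theorem hasDerivAt_Ad (h : IsOneParameter γ Z) (X : LieAlg (n := n) G) (t : ℝ) :
    HasDerivAt (F := EuclideanSpace ℝ (Fin n)) (fun t => Ad (n := n) (γ t) X)
      (Ad (n := n) (γ t) ⁅Z, X⁆) t := by
  obtain ⟨A', hA, hA'⟩ := mfderiv_Ad_comp h.hasMFDerivAt_zero h.map_zero X
  have h0 : HasFDerivAt (F := EuclideanSpace ℝ (Fin n)) (fun s : ℝ => Ad (n := n) (γ s) X) A' 0 :=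
    hA.hasFDerivAt
  have h1 := h0.hasDerivAt
  have h2 : A' 1 = (⁅Z, X⁆ : LieAlg (n := n) G) :=
    (hA' 1).trans (congrArg (fun Y : LieAlg (n := n) G => ⁅Y, X⁆) (lineTo_one Z))
  rw [h2] at h1
  have h3 : HasDerivAt (F := EuclideanSpace ℝ (Fin n)) (fun s : ℝ => Ad (n := n) (γ (s - t)) X)
      (⁅Z, X⁆ : LieAlg (n := n) G) t := HasDerivAt.comp_sub_const t t (by rwa [sub_self])
  let A : EuclideanSpace ℝ (Fin n) →L[ℝ] EuclideanSpace ℝ (Fin n) := Ad (n := n) (γ t)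
  have h4 := (A.hasFDerivAt (x := Ad (n := n) (γ (t - t)) X)).comp_hasDerivAt t h3
  refine h4.congr_of_eventuallyEq (Filter.Eventually.of_forall fun s => ?_)
  change Ad (n := n) (γ s) X = Ad (γ t) (Ad (γ (s - t)) X)
  rw [← Ad_mul_apply, ← h.map_add, add_sub_cancel]

theorem Ad_apply_of_lie_eq_zero (h : IsOneParameter γ Z) {X : LieAlg (n := n) G} (hX : ⁅Z, X⁆ = 0)
    (t : ℝ) : Ad (γ t) X = X := by
  have h1 := h.hasDerivAt_Ad X
  rw [hX] at h1
  have h2 := is_const_of_deriv_eq_zero (G := EuclideanSpace ℝ (Fin n))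
    (f := fun t => Ad (n := n) (γ t) X) (fun t => (h1 t).differentiableAt)
    (fun t => (h1 t).deriv.trans (_root_.map_zero (Ad (n := n) (γ t)))) t 0
  refine h2.trans ?_
  change Ad (n := n) (γ 0) X = X
  rw [h.map_zero, Ad_one]; rfl

/-- The series of `e^{t ad Z}` stops after the linear term: the derivative `Ad (γ t) [Z, X]` is
constantly `[Z, X]`. -/
theorem Ad_apply_of_lie_lie_eq_zero (h : IsOneParameter γ Z) {X : LieAlg (n := n) G}
    (hX : ⁅Z, ⁅Z, X⁆⁆ = 0) (t : ℝ) : Ad (γ t) X = X + t • ⁅Z, X⁆ := by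
  have h1 := h.hasDerivAt_Ad X
  have h2 : ∀ t, HasDerivAt (F := EuclideanSpace ℝ (Fin n))
      (fun t : ℝ => Ad (n := n) (γ t) X - t • ⁅Z, X⁆) 0 t := by
    intro t
    have h3 := (h1 t).sub ((hasDerivAt_id t).smul_const (F := EuclideanSpace ℝ (Fin n))
      (⁅Z, X⁆ : LieAlg (n := n) G))
    rw [h.Ad_apply_of_lie_eq_zero hX t] at h3
    have e : (⁅Z, X⁆ : LieAlg (n := n) G) - (1 : ℝ) • ⁅Z, X⁆ = 0 := by rw [one_smul, sub_self]
    exact e ▸ h3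
  have h4 := is_const_of_deriv_eq_zero (fun t => (h2 t).differentiableAt)
    (fun t => (h2 t).deriv) t 0
  have h5 : Ad (n := n) (γ 0) X = X := by rw [h.map_zero, Ad_one]; rfl
  have h6 : Ad (n := n) (γ t) X - t • ⁅Z, X⁆ = Ad (n := n) (γ 0) X - (0 : ℝ) • ⁅Z, X⁆ := h4
  rw [h5, zero_smul, sub_zero] at h6
  exact sub_eq_iff_eq_add.1 h6

theorem conj (h : IsOneParameter γ Z) (g : G) :
    IsOneParameter (fun t => g * γ t * g⁻¹) (Ad (n := n) g Z) where
  contMDiff := (contMDiff_conj (n := n) g).comp h.contMDiff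
  map_add s t := by rw [h.map_add]; group
  mfderiv_zero := by
    have h1 := HasMFDerivAt.comp 0 (hasMFDerivAt_congr_point
      (mdifferentiable_conj (n := n) g 1).hasMFDerivAt h.map_zero.symm) h.hasMFDerivAt_zero
    have h2 := congrArg (fun T : ℝ →L[ℝ] EuclideanSpace ℝ (Fin n) => T 1) h1.mfderiv
    refine h2.trans ?_
    exact congrArg (Ad (n := n) g) (one_smul ℝ (show EuclideanSpace ℝ (Fin n) from Z))

omit [LieGroup (𝓡 n) ∞ G] in
theorem neg (h : IsOneParameter γ Z) : IsOneParameter (fun t => γ (-t)) (-Z) where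
  contMDiff := h.contMDiff.comp contDiff_neg.contMDiff
  map_add s t := by rw [neg_add, h.map_add]
  mfderiv_zero := by
    have h1 := HasMFDerivAt.comp (f := fun t : ℝ => -t) 0
      (hasMFDerivAt_congr_point h.hasMFDerivAt_zero neg_zero.symm)
      ((hasFDerivAt_id (𝕜 := ℝ) (0 : ℝ)).neg).hasMFDerivAt
    have h2 := congrArg (fun T : ℝ →L[ℝ] EuclideanSpace ℝ (Fin n) => T 1) h1.mfderiv
    refine h2.trans ?_
    change (-1 : ℝ) • (show EuclideanSpace ℝ (Fin n) from Z) = -(show EuclideanSpace ℝ (Fin n) from Z)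
    exact neg_one_smul ℝ _

omit [LieGroup (𝓡 n) ∞ G] in
theorem const_one : IsOneParameter (fun _ => (1 : G)) (0 : LieAlg (n := n) G) where
  contMDiff := contMDiff_const
  map_add s t := (one_mul 1).symm
  mfderiv_zero := by
    rw [mfderiv_const]; rfl

/-- Conjugating `δ` by `γ s` gives the one-parameter subgroup of `Ad (γ s) W = W`, which is `δ`
again. -/
theorem commute [T2Space G] (hγ : IsOneParameter γ Z) (hδ : IsOneParameter δ W) (h : ⁅Z, W⁆ = 0)
    (s t : ℝ) : γ s * δ t = δ t * γ s := by
  have h1 := hδ.conj (γ s)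
  rw [hγ.Ad_apply_of_lie_eq_zero h s] at h1
  have h2 := congrFun (h1.unique hδ) t
  exact mul_inv_eq_iff_eq_mul.1 h2

theorem mul [T2Space G] (hγ : IsOneParameter γ Z) (hδ : IsOneParameter δ W) (h : ⁅Z, W⁆ = 0) :
    IsOneParameter (fun t => γ t * δ t) (Z + W) where
  contMDiff := hγ.contMDiff.mul hδ.contMDiff
  map_add s t := by
    rw [hγ.map_add, hδ.map_add, mul_assoc, mul_assoc, ← mul_assoc (γ t), ← mul_assoc (δ s),
      hγ.commute hδ h]
  mfderiv_zero := by
    have h1 := mfderiv_comp_prodMk (Φ := fun p : G × G => p.1 * p.2) (a := γ) (b := δ) (x := 0)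
      ((contMDiff_mul (𝓡 n) ∞).mdifferentiable (by simp) _)
      (hγ.contMDiff.mdifferentiable (by simp) 0) (hδ.contMDiff.mdifferentiable (by simp) 0) (1 : ℝ)
    refine h1.trans ?_
    have e1 : mfderiv (𝓡 n) (𝓡 n) (fun z : G => z * δ 0) (γ 0) =
        ContinuousLinearMap.id ℝ (EuclideanSpace ℝ (Fin n)) := by
      have : (fun z : G => z * δ 0) = id := by funext z; simp [hδ.map_zero]
      rw [this]; exact mfderiv_id
    have e2 : mfderiv (𝓡 n) (𝓡 n) (fun z : G => γ 0 * z) (δ 0) =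
        ContinuousLinearMap.id ℝ (EuclideanSpace ℝ (Fin n)) := by
      have : (fun z : G => γ 0 * z) = id := by funext z; simp [hγ.map_zero]
      rw [this]; exact mfderiv_id
    exact congrArg₂ (fun a b : EuclideanSpace ℝ (Fin n) => a + b)
      ((congrArg (fun T : EuclideanSpace ℝ (Fin n) →L[ℝ] EuclideanSpace ℝ (Fin n) => T _) e1).trans
        hγ.mfderiv_zero)
      ((congrArg (fun T : EuclideanSpace ℝ (Fin n) →L[ℝ] EuclideanSpace ℝ (Fin n) => T _) e2).trans
        hδ.mfderiv_zero)

end IsOneParameter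

end OneParameter
end
end ParabolicGeometry
-- The subgroup `exp 𝔤₁` and elements of `P` acting by a sign on `𝔤 / 𝔭`.
namespace ParabolicGeometry
noncomputable section

section Parabolic

variable {n k : ℕ} {G : Type*} [TopologicalSpace G]
  [ChartedSpace (EuclideanSpace ℝ (Fin n)) G] [Group G] [LieGroup (𝓡 n) ∞ G]
  {Γ : OneGrading (LieAlg (n := n) G)}

theorem IsOneParameter.Ad_mem_filtration {γ : ℝ → G} {Z : LieAlg (n := n) G}
    (h : IsOneParameter γ Z) (hZ : Z ∈ Γ.gr 1) (t : ℝ) : γ t ∈ filtrationStabilizer Γ := by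
  have h1 : ∀ C ∈ Γ.gr 1, Ad (γ t) C = C := fun C hC =>
    h.Ad_apply_of_lie_eq_zero (Γ.lie_eq_zero (by norm_num) hZ hC) t
  intro i X hX
  rcases lt_trichotomy i 0 with hi | rfl | hi
  · exact Γ.mem_filtration_of_lt_zero hi _
  · obtain ⟨B, hB, C, hC, rfl⟩ := Γ.mem_filtration_zero.1 hX
    have hZB : ⁅Z, B⁆ ∈ Γ.gr 1 := Γ.lie_mem' 1 (by norm_num) hZ hB
    rw [_root_.map_add, h1 C hC, h.Ad_apply_of_lie_lie_eq_zero (Γ.lie_eq_zero (by norm_num) hZ hZB)]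
    exact add_mem (add_mem (Γ.gr_zero_le hB) (Γ.gr_one_le (Submodule.smul_mem _ _ hZB)))
      (Γ.gr_one_le hC)
  · rcases (show (1 : ℤ) ≤ i by omega).eq_or_lt with rfl | hi
    · rw [Γ.filtration_one] at hX ⊢
      rwa [h1 X hX]
    · rw [Γ.filtration_of_one_lt hi, Submodule.mem_bot] at hX ⊢
      rw [hX, _root_.map_zero]

theorem IsOneParameter.Ad_gradingElement {γ : ℝ → G} {Z E : LieAlg (n := n) G}
    (h : IsOneParameter γ Z) (hZ : Z ∈ Γ.gr 1) (hE : Γ.IsGradingElement E) (t : ℝ) :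
    Ad (γ t) E = E - t • Z := by
  have h1 : ⁅Z, E⁆ = -Z := by rw [← lie_skew, hE.lie_one hZ]
  rw [h.Ad_apply_of_lie_lie_eq_zero (by rw [h1]; simp), h1, smul_neg, sub_eq_add_neg]

/-- The curve `γ` joins `1` to `γ 1` inside the stabilizer of the filtration. -/
theorem IsParabolic.apply_one_mem {P : Subgroup G} [ChartedSpace (EuclideanSpace ℝ (Fin k)) P]
    (hP : IsParabolic (k := k) Γ P) {γ : ℝ → G} {Z : LieAlg (n := n) G}
    (h : IsOneParameter γ Z) (hZ : Z ∈ Γ.gr 1) : γ 1 ∈ P := by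
  refine hP.component_le ?_
  refine (isPreconnected_range h.contMDiff.continuous).subset_connectedComponentIn ⟨0, h.map_zero⟩
    ?_ ⟨1, rfl⟩
  rintro _ ⟨t, rfl⟩
  exact h.Ad_mem_filtration hZ t

/-- Since `𝔤₁` is abelian, products of exponentials of elements of `𝔤₁` are again such exponentials.
-/
theorem exists_isOneParameter_of_mem_closure [T2Space G] {q : G}
    (hq : q ∈ Subgroup.closure (expSet (Γ.gr 1 : Set (LieAlg (n := n) G)))) :
    ∃ γ : ℝ → G, ∃ Z ∈ Γ.gr 1, IsOneParameter γ Z ∧ γ 1 = q := by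
  induction hq using Subgroup.closure_induction with
  | mem q hq => exact mem_expSet.1 hq
  | one => exact ⟨_, 0, zero_mem _, .const_one, rfl⟩
  | mul a b _ _ ha hb =>
    obtain ⟨γ, Z, hZ, h, rfl⟩ := ha
    obtain ⟨δ, W, hW, h', rfl⟩ := hb
    exact ⟨_, Z + W, add_mem hZ hW, h.mul h' (Γ.lie_eq_zero (by norm_num) hZ hW), rfl⟩
  | inv a _ ha =>
    obtain ⟨γ, Z, hZ, h, rfl⟩ := ha
    exact ⟨_, -Z, neg_mem hZ, h.neg, h.map_neg 1⟩

theorem exists_mem_pPlus [T2Space G] {P : Subgroup G} [ChartedSpace (EuclideanSpace ℝ (Fin k)) P]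
    (hP : IsParabolic (k := k) Γ P) {E Z : LieAlg (n := n) G} (hE : Γ.IsGradingElement E)
    (hZ : Z ∈ Γ.gr 1) : ∃ q ∈ pPlus Γ P, Ad (q : G) E = E - Z := by
  obtain ⟨γ, h⟩ := exists_isOneParameter Z
  refine ⟨⟨γ 1, hP.apply_one_mem h hZ⟩, ?_, ?_⟩
  · exact Subgroup.mem_subgroupOf.2 (Subgroup.subset_closure (mem_expSet.2 ⟨γ, Z, hZ, h, rfl⟩))
  · rw [h.Ad_gradingElement hZ hE, one_smul]

/-- An element of `P₊` is determined by its action on the grading element. -/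
theorem exists_Ad_eq_of_mem_pPlus [T2Space G] {P : Subgroup G} {E : LieAlg (n := n) G}
    (hE : Γ.IsGradingElement E) {q : P} (hq : q ∈ pPlus Γ P) :
    ∃ Z ∈ Γ.gr 1, Ad (q : G) E = E - Z ∧ (Z = 0 → q = 1) := by
  obtain ⟨γ, Z, hZ, h, hγ⟩ := exists_isOneParameter_of_mem_closure (Subgroup.mem_subgroupOf.1 hq)
  refine ⟨Z, hZ, ?_, fun h0 => ?_⟩
  · rw [← hγ, h.Ad_gradingElement hZ hE, one_smul]
  · subst h0
    rw [h.unique .const_one] at hγ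
    exact Subtype.ext hγ.symm

theorem mem_gZero_of_Ad_eq {P : Subgroup G} {E : LieAlg (n := n) G} (hE : Γ.IsGradingElement E)
    {g : P} (hg : Ad (g : G) E = E) : g ∈ gZero Γ P :=
  fun i _ hX => OneGrading.ActsBy.map_gr (α := adEquiv (g : G)) hE hg i hX

section ActsBy

variable {P : Subgroup G} [ChartedSpace (EuclideanSpace ℝ (Fin k)) P]
  (hP : IsParabolic (k := k) Γ P)
include hP

theorem IsParabolic.Ad_mem (g : P) {X : LieAlg (n := n) G} (hX : X ∈ Γ.filtration 0) :
    Ad (g : G) X ∈ Γ.filtration 0 := hP.le_stabilizer g.2 0 X hX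

theorem IsParabolic.actsBy {g : P} {ε : ℝ} (hε : ε * ε = 1)
    (h : ∀ X : LieAlg (n := n) G, Ad ((g : G)⁻¹) X - ε • X ∈ Γ.filtration 0) :
    Γ.ActsBy (adEquiv (g : G)) ε where
  map_zero X hX := hP.Ad_mem g hX
  map_one X hX := by
    have := hP.le_stabilizer g.2 1 X
    rw [Γ.filtration_one] at this
    exact this hX
  symm_sub := h
  sq := hε

theorem IsParabolic.actsBy_of_Ad_eq {g : P} (h : Ad (n := n) (g : G) =
    ContinuousLinearMap.id ℝ (LieAlg (n := n) G)) : Γ.ActsBy (adEquiv (g : G)) 1 :=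
  hP.actsBy (one_mul 1) fun X => by
    have h1 := Ad_inv_apply (n := n) (g : G) X
    rw [h] at h1
    have h2 : Ad (g : G)⁻¹ X = X := h1
    rw [h2, one_smul, sub_self]
    exact zero_mem _

variable (hss : LieAlgebra.IsSemisimple ℝ (LieAlg (n := n) G)) {E : LieAlg (n := n) G}
  (hE : Γ.IsGradingElement E)
include hss hE

/-- A substitute for the decomposition `P = G₀ · P₊`: a factor from `P₊` corrects `g` to an element
fixing `E`, hence in `G₀`. -/
theorem exists_mem_pPlus_Ad_mul [T2Space G] {g : P} {ε : ℝ}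
    (h : Γ.ActsBy (adEquiv (g : G)) ε) : ∃ q ∈ pPlus Γ P, Ad ((g * q : P) : G) E = E := by
  have hW := h.sub_gradingElement_mem hE hss
  -- With `W = Ad g E - E`, the choice `Ad q E = E - ε W` works because `Ad g W = ε W` and `ε * ε =
  -- 1`.
  obtain ⟨q, hq, hqE⟩ := exists_mem_pPlus hP hE (Submodule.smul_mem _ ε hW)
  refine ⟨q, hq, ?_⟩
  rw [Subgroup.coe_mul, Ad_mul_apply, hqE]
  have h1 := h.apply_gr_one hE hss hW
  rw [← adEquiv_apply, map_sub, map_smul, h1, smul_smul, h.sq, one_smul, sub_sub_cancel]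

theorem Ad_eq_id {g : P} (h : Γ.ActsBy (adEquiv (g : G)) 1) (hg : Ad (g : G) E = E) :
    Ad (n := n) (g : G) = ContinuousLinearMap.id ℝ (LieAlg (n := n) G) := by
  refine ContinuousLinearMap.ext fun X => ?_
  have h1 : Γ.ActsBy (adEquiv ((1 : P) : G)) 1 := hP.actsBy_of_Ad_eq Ad_one
  have := h.eq_of_apply_gradingElement hE hss h1 hg (by
    rw [adEquiv_apply, OneMemClass.coe_one, Ad_one]; rfl) X
  rw [adEquiv_apply, adEquiv_apply, OneMemClass.coe_one, Ad_one] at this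
  exact this

omit [ChartedSpace (EuclideanSpace ℝ (Fin k)) P] hP in
/-- Two elements of `G₀` which act by the same sign on `𝔤 / 𝔭` have the same adjoint action. -/
theorem Ad_inv_mul_eq_id {g h : P} {ε : ℝ} (hg : Γ.ActsBy (adEquiv (g : G)) ε)
    (hh : Γ.ActsBy (adEquiv (h : G)) ε) (hgE : Ad (g : G) E = E) (hhE : Ad (h : G) E = E) :
    Ad (n := n) ((g⁻¹ * h : P) : G) = ContinuousLinearMap.id ℝ (LieAlg (n := n) G) := by
  refine ContinuousLinearMap.ext fun X => ?_
  have h1 := hg.eq_of_apply_gradingElement hE hss hh hgE hhE X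
  rw [adEquiv_apply, adEquiv_apply] at h1
  rw [Subgroup.coe_mul, Ad_mul_apply, ← h1, InvMemClass.coe_inv, Ad_inv_apply]
  rfl

/-- The square of an element acting by `-1` on `𝔤 / 𝔭` has trivial adjoint action. -/
theorem Ad_mul_self_eq_id {g : P} (hg : Γ.ActsBy (adEquiv (g : G)) (-1)) :
    Ad (n := n) ((g * g : P) : G) = ContinuousLinearMap.id ℝ (LieAlg (n := n) G) := by
  refine Ad_eq_id hP hss hE (hP.actsBy (one_mul 1) fun X => ?_) ?_
  · have h1 := hg.symm_sub (adEquiv (g : G)⁻¹ X)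
    have h2 := hg.symm_sub X
    rw [adEquiv_symm_apply] at h1 h2
    rw [adEquiv_apply] at h1
    have e : Ad ((g * g : P) : G)⁻¹ X = Ad (g : G)⁻¹ (Ad (g : G)⁻¹ X) := by
      rw [← Ad_mul_apply, Subgroup.coe_mul, mul_inv_rev]
    rw [e]
    convert sub_mem h1 h2 using 1
    module
  -- With `W = Ad g E - E` one has `Ad g W = -W`, so applying `Ad g` to `E + W` returns `E`.
  · have h1 := hg.sub_gradingElement_mem hE hss
    have h2 := hg.apply_gr_one hE hss h1
    rw [adEquiv_apply] at h1 h2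
    rw [Subgroup.coe_mul, Ad_mul_apply]
    rw [adEquiv_apply, map_sub] at h2
    linear_combination (norm := module) (1 : ℝ) • h2

end ActsBy

end Parabolic
end
end ParabolicGeometry
-- Rigidity of maps preserving an absolute parallelism.
namespace ParabolicGeometry
noncomputable section

/-- Two maps which pull back an absolute parallelism `κ` to the same form and agree at a point
agree near this point. -/
theorem eventuallyEq_of_coframe {E F : Type*} [NormedAddCommGroup E] [NormedSpace ℝ E]
    [NormedAddCommGroup F] [NormedSpace ℝ F] [FiniteDimensional ℝ F] {κ : F → F →L[ℝ] F} {z₀ : E}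
    {f f' : E → F} (hκ : ContDiffAt ℝ 1 κ (f z₀)) (hi : Function.Injective (κ (f z₀)))
    (h0 : f z₀ = f' z₀) (hf : ContDiffAt ℝ 1 f z₀) (hf' : ContDiffAt ℝ 1 f' z₀)
    (h : ∀ᶠ z in 𝓝 z₀, ∀ v, κ (f z) (fderiv ℝ f z v) = κ (f' z) (fderiv ℝ f' z v)) :
    f =ᶠ[𝓝 z₀] f' := by
  obtain ⟨K, t, ht, hK⟩ := hκ.exists_lipschitzOnWith
  obtain ⟨c, hc0, hc⟩ := (κ (f z₀) : F →ₗ[ℝ] F).exists_antilipschitzWith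
    (LinearMap.ker_eq_bot.2 hi)
  have hc' : ∀ v, ‖v‖ ≤ c * ‖κ (f z₀) v‖ := by
    intro v
    have := hc.le_mul_dist v 0
    simpa using this
  have hc0' : (0 : ℝ) < c := hc0
  have e1 : ∀ᶠ z in 𝓝 z₀, f z ∈ t := hf.continuousAt.eventually ht
  have e2 : ∀ᶠ z in 𝓝 z₀, f' z ∈ t := hf'.continuousAt.eventually (h0 ▸ ht)
  have e3 : ∀ᶠ z in 𝓝 z₀, ‖κ (f z) - κ (f z₀)‖ < 1 / (2 * c) := by
    have h1 : Filter.Tendsto (fun z => κ (f z)) (𝓝 z₀) (𝓝 (κ (f z₀))) :=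
      hκ.continuousAt.tendsto.comp hf.continuousAt.tendsto
    have := (h1.sub_const (κ (f z₀))).norm
    rw [sub_self, norm_zero] at this
    exact this.eventually_lt_const (by positivity)
  have e4 : ∀ᶠ z in 𝓝 z₀, ‖fderiv ℝ f' z‖ < ‖fderiv ℝ f' z₀‖ + 1 :=
    ((hf'.fderiv_right (m := 0) (by simp)).continuousAt.norm).eventually_lt_const
      (lt_add_one _)
  have e5 : ∀ᶠ z in 𝓝 z₀, DifferentiableAt ℝ f z :=
    (hf.eventually (by simp)).mono fun z hz => hz.differentiableAt (by simp)
  have e6 : ∀ᶠ z in 𝓝 z₀, DifferentiableAt ℝ f' z :=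
    (hf'.eventually (by simp)).mono fun z hz => hz.differentiableAt (by simp)
  obtain ⟨r, hr, hball⟩ := Metric.eventually_nhds_iff_ball.1
    (e1.and (e2.and (e3.and (e4.and (e5.and (e6.and h))))))
  set D := ‖fderiv ℝ f' z₀‖ + 1 with hD
  -- Equality of the pullbacks gives `κ(f) (Df v - Df' v) = (κ(f') - κ(f)) (Df' v)`, and `κ` is
  -- Lipschitz. So `f - f'` satisfies a linear differential inequality, and Grönwall along segments
  -- from `z₀` makes it vanish.
  have key : ∀ z ∈ Metric.ball z₀ r, ∀ v, ‖fderiv ℝ f z v - fderiv ℝ f' z v‖ ≤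
      2 * c * K * D * ‖v‖ * ‖f z - f' z‖ := by
    intro z hz v
    obtain ⟨h1, h2, h3, h4, -, -, h7⟩ := hball z hz
    set w := fderiv ℝ f z v - fderiv ℝ f' z v with hw
    have a1 : ‖κ (f z) w‖ ≤ K * ‖f z - f' z‖ * (D * ‖v‖) := by
      have : κ (f z) w = (κ (f' z) - κ (f z)) (fderiv ℝ f' z v) := by
        rw [hw, map_sub, h7 v]; rfl
      rw [this]
      refine (ContinuousLinearMap.le_opNorm _ _).trans ?_
      have b1 := hK.dist_le_mul _ h2 _ h1
      rw [dist_eq_norm, dist_eq_norm, norm_sub_rev (f' z)] at b1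
      have b2 := (ContinuousLinearMap.le_opNorm (fderiv ℝ f' z) v).trans
        (mul_le_mul_of_nonneg_right h4.le (norm_nonneg v))
      gcongr
    have a2 : ‖κ (f z₀) w‖ ≤ ‖κ (f z) w‖ + 1 / (2 * c) * ‖w‖ := by
      have : κ (f z₀) w = κ (f z) w - (κ (f z) - κ (f z₀)) w := by
        rw [sub_apply]; abel
      rw [this]
      refine (norm_sub_le _ _).trans ?_
      gcongr
      exact ((κ (f z) - κ (f z₀)).le_opNorm w).trans (by gcongr)
    have a3 : ‖w‖ ≤ c * (‖κ (f z) w‖ + 1 / (2 * c) * ‖w‖) :=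
      (hc' w).trans (by gcongr)
    have a4 : c * (‖κ (f z) w‖ + 1 / (2 * c) * ‖w‖) = c * ‖κ (f z) w‖ + ‖w‖ / 2 := by
      field_simp
    have a5 : ‖w‖ ≤ 2 * c * ‖κ (f z) w‖ := by linarith
    calc ‖w‖ ≤ 2 * c * ‖κ (f z) w‖ := a5
      _ ≤ 2 * c * (K * ‖f z - f' z‖ * (D * ‖v‖)) := by gcongr
      _ = _ := by ring
  refine Metric.eventually_nhds_iff_ball.2 ⟨r, hr, fun z hz => ?_⟩
  have hseg : ∀ s ∈ Set.Icc (0 : ℝ) 1, z₀ + s • (z - z₀) ∈ Metric.ball z₀ r := by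
    intro s hs
    rw [mem_ball_iff_norm, add_sub_cancel_left, norm_smul, Real.norm_eq_abs, abs_of_nonneg hs.1]
    rw [mem_ball_iff_norm] at hz
    nlinarith [norm_nonneg (z - z₀), hs.2]
  have hder : ∀ s ∈ Set.Icc (0 : ℝ) 1, HasDerivAt
      (fun s : ℝ => f (z₀ + s • (z - z₀)) - f' (z₀ + s • (z - z₀)))
      (fderiv ℝ f (z₀ + s • (z - z₀)) (z - z₀) - fderiv ℝ f' (z₀ + s • (z - z₀)) (z - z₀)) s := by
    intro s hs
    obtain ⟨-, -, -, -, h5, h6, -⟩ := hball _ (hseg s hs)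
    have hl : HasDerivAt (fun s : ℝ => z₀ + s • (z - z₀)) (z - z₀) s := by
      simpa using ((hasDerivAt_id s).smul_const (z - z₀)).const_add z₀
    exact (h5.hasFDerivAt.comp_hasDerivAt s hl).sub (h6.hasFDerivAt.comp_hasDerivAt s hl)
  have := eq_zero_of_abs_deriv_le_mul_abs_self_of_eq_zero_right
    (K := 2 * c * K * D * ‖z - z₀‖)
    (fun s hs => (hder s hs).continuousAt.continuousWithinAt)
    (fun s hs => (hder s (Set.Ico_subset_Icc_self hs)).hasDerivWithinAt)
    (by simp [h0])
    (fun s hs => key _ (hseg s (Set.Ico_subset_Icc_self hs)) _) 1 (by simp)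
  simpa [sub_eq_zero] using this

section

variable {n : ℕ} {N : Type*} [TopologicalSpace N]
  [ChartedSpace (EuclideanSpace ℝ (Fin n)) N] [IsManifold (𝓡 n) ∞ N]

local notation "ℰ" => EuclideanSpace ℝ (Fin n)

theorem fderiv_extChartAt_comp_symm {F : N → N} {u b : N} {z : ℰ}
    (hz : z ∈ (extChartAt (𝓡 n) u).target)
    (hF : ContMDiffAt (𝓡 n) (𝓡 n) ∞ F ((extChartAt (𝓡 n) u).symm z))
    (hb : F ((extChartAt (𝓡 n) u).symm z) ∈ (extChartAt (𝓡 n) b).source) (v : ℰ) :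
    fderiv ℝ (fun z => extChartAt (𝓡 n) b (F ((extChartAt (𝓡 n) u).symm z))) z v =
      mfderiv (𝓡 n) 𝓘(ℝ, ℰ) (extChartAt (𝓡 n) b) (F ((extChartAt (𝓡 n) u).symm z))
        (mfderiv (𝓡 n) (𝓡 n) F ((extChartAt (𝓡 n) u).symm z)
          (mfderiv 𝓘(ℝ, ℰ) (𝓡 n) (extChartAt (𝓡 n) u).symm z v)) := by
  have h1 : MDifferentiableAt 𝓘(ℝ, ℰ) (𝓡 n) (extChartAt (𝓡 n) u).symm z :=
    ((contMDiffOn_extChartAt_symm (I := 𝓡 n) (n := ∞) u).contMDiffAt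
      ((isOpen_extChartAt_target u).mem_nhds hz)).mdifferentiableAt (by simp)
  rw [extChartAt_source] at hb
  have h2 : MDifferentiableAt (𝓡 n) 𝓘(ℝ, ℰ) (extChartAt (𝓡 n) b)
      (F ((extChartAt (𝓡 n) u).symm z)) :=
    (contMDiffAt_extChartAt' (I := 𝓡 n) (n := ∞) hb).mdifferentiableAt (by simp)
  have h3 := hF.mdifferentiableAt (by simp)
  have h4 := (h2.hasMFDerivAt.comp (f := F ∘ (extChartAt (𝓡 n) u).symm) z
    (h3.hasMFDerivAt.comp z h1.hasMFDerivAt))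
  have h5 : HasFDerivAt (𝕜 := ℝ) (E := ℰ) (F := ℰ)
      (fun z => extChartAt (𝓡 n) b (F ((extChartAt (𝓡 n) u).symm z))) _ z :=
    hasFDerivAt_of_hasMFDerivAt (M := ℰ) (F := ℰ) (M' := ℰ) (F' := ℰ) h4
  have h5 := h5.fderiv
  exact congrArg (fun T : ℰ →L[ℝ] ℰ => T v) h5

/-- The version of `eventuallyEq_of_coframe` on a manifold `N`, for an absolute parallelism `θ`
which is smooth in coordinates. -/
theorem eventuallyEq_of_coframe_manifold {F F' : N → N} {u b : N} {κ : ℰ → ℰ →L[ℝ] ℰ}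
    {θ : N → ℰ →L[ℝ] ℰ}
    (hκ : ContDiffAt ℝ 1 κ (extChartAt (𝓡 n) b b))
    (hκθ : ∀ᶠ y in 𝓝 b, ∀ v : TangentSpace (𝓡 n) y,
      κ (extChartAt (𝓡 n) b y) (mfderiv (𝓡 n) 𝓘(ℝ, ℰ) (extChartAt (𝓡 n) b) y v) = θ y v)
    (hi : Function.Injective (θ b)) (hFu : F u = b) (hFu' : F' u = b)
    (hF : ∀ᶠ w in 𝓝 u, ContMDiffAt (𝓡 n) (𝓡 n) ∞ F w)
    (hF' : ∀ᶠ w in 𝓝 u, ContMDiffAt (𝓡 n) (𝓡 n) ∞ F' w)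
    (h : ∀ᶠ w in 𝓝 u, ∀ ξ : TangentSpace (𝓡 n) w,
      θ (F w) (mfderiv (𝓡 n) (𝓡 n) F w ξ) = θ (F' w) (mfderiv (𝓡 n) (𝓡 n) F' w ξ)) :
    F =ᶠ[𝓝 u] F' := by
  have : IsManifold (𝓡 n) 1 N := IsManifold.of_le (n := ∞) (by simp)
  set α := extChartAt (𝓡 n) u
  set β := extChartAt (𝓡 n) b
  have hαu : α.symm (α u) = u := extChartAt_to_inv u
  have hαt : α.target ∈ 𝓝 (α u) := extChartAt_target_mem_nhds u
  have hα : ContinuousAt α.symm (α u) := continuousAt_extChartAt_symm u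
  have tα : Filter.Tendsto α.symm (𝓝 (α u)) (𝓝 u) := by
    have := hα.tendsto; rwa [hαu] at this
  have hβs : ∀ {H : N → N}, H u = b → ContMDiffAt (𝓡 n) (𝓡 n) ∞ H u →
      ∀ᶠ w in 𝓝 u, H w ∈ β.source := fun {H} hH hc =>
    hc.continuousAt.eventually (by rw [hH]; exact extChartAt_source_mem_nhds b)
  have hsm : ∀ {H : N → N}, H u = b → ContMDiffAt (𝓡 n) (𝓡 n) ∞ H u →
      ContDiffAt ℝ 1 (fun z => β (H (α.symm z))) (α u) := by
    intro H hH hc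
    refine ContDiffAt.of_le (n := ∞) (contDiffAt_extChartAt_comp ?_ ?_)
      (WithTop.coe_le_coe.2 le_top)
    · refine ContMDiffAt.comp (I' := 𝓡 n) (g := H) _ (by rwa [hαu]) ?_
      exact (contMDiffOn_extChartAt_symm (I := 𝓡 n) (n := ∞) u).contMDiffAt hαt
    · rw [hαu, hH]; exact mem_extChartAt_source b
  have hmain := eventuallyEq_of_coframe (κ := κ) (z₀ := α u) (f := fun z => β (F (α.symm z)))
    (f' := fun z => β (F' (α.symm z))) (by simpa only [hαu, hFu] using hκ)
    (by
      simp only [hαu, hFu]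
      intro v w hvw
      have hinv := isInvertible_mfderiv_extChartAt (I := 𝓡 n) (mem_extChartAt_source (I := 𝓡 n) b)
      obtain ⟨v', rfl⟩ := hinv.surjective v
      obtain ⟨w', rfl⟩ := hinv.surjective w
      have hb := hκθ.self_of_nhds
      exact congrArg _ (hi (((hb v').symm.trans hvw).trans (hb w'))))
    (by simp only [hαu, hFu, hFu']) (hsm hFu hF.self_of_nhds) (hsm hFu' hF'.self_of_nhds)
    (by
      have e1 : ∀ᶠ w in 𝓝 u, ∀ v : TangentSpace (𝓡 n) (F w),
          κ (β (F w)) (mfderiv (𝓡 n) 𝓘(ℝ, ℰ) β (F w) v) = θ (F w) v :=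
        hF.self_of_nhds.continuousAt.eventually (by rw [hFu]; exact hκθ)
      have e2 : ∀ᶠ w in 𝓝 u, ∀ v : TangentSpace (𝓡 n) (F' w),
          κ (β (F' w)) (mfderiv (𝓡 n) 𝓘(ℝ, ℰ) β (F' w) v) = θ (F' w) v :=
        hF'.self_of_nhds.continuousAt.eventually (by rw [hFu']; exact hκθ)
      filter_upwards [hαt, tα.eventually (h.and (e1.and (e2.and ((hβs hFu hF.self_of_nhds).and
        ((hβs hFu' hF'.self_of_nhds).and (hF.and hF'))))))]
        with z hz ⟨h1, h2, h3, h4, h5, h6, h7⟩ v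
      have q1 := fderiv_extChartAt_comp_symm hz h6 h4 v
      have q2 := fderiv_extChartAt_comp_symm hz h7 h5 v
      refine (congrArg (κ (β (F (α.symm z)))) q1).trans ?_
      refine Eq.trans ?_ (congrArg (κ (β (F' (α.symm z)))) q2).symm
      exact (h2 _).trans ((h1 _).trans (h3 _).symm))
  filter_upwards [(continuousAt_extChartAt (I := 𝓡 n) u).tendsto.eventually hmain,
    extChartAt_source_mem_nhds (I := 𝓡 n) u, hβs hFu hF.self_of_nhds, hβs hFu' hF'.self_of_nhds] with w hw h1 h2 h3
  have hw1 : β (F (α.symm (α w))) = β (F' (α.symm (α w))) := hw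
  rw [α.left_inv h1] at hw1
  exact β.injOn h2 h3 hw1

end
end
end ParabolicGeometry
-- Elements with trivial adjoint action and the kernel.
namespace ParabolicGeometry
noncomputable section

section

variable {n : ℕ} {G : Type*} [TopologicalSpace G]
  [ChartedSpace (EuclideanSpace ℝ (Fin n)) G] [Group G] [LieGroup (𝓡 n) ∞ G]

local notation "ℰ" => EuclideanSpace ℝ (Fin n)
local notation "φ₁" => extChartAt (𝓡 n) (1 : G)

variable (G) in
/-- The frame of left invariant vector fields in the chart at `1`. -/
def leftFrame (z : ℰ) : ℰ →L[ℝ] ℰ :=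
  (fderiv ℝ (chartMul G) (z, φ₁ 1)).comp (ContinuousLinearMap.inr ℝ ℰ ℰ)

theorem leftFrame_apply {g : G} (hg : g ∈ (φ₁).source) (X : LieAlg (n := n) G) :
    leftFrame G (φ₁ g) X =
      mfderiv (𝓡 n) 𝓘(ℝ, ℰ) φ₁ g (mulInvariantVectorField (I := 𝓡 n) X g) :=
  (mfderiv_extChartAt_mulInvariantVectorField hg X).symm

theorem contDiffAt_leftFrame : ContDiffAt ℝ ∞ (leftFrame (n := n) G) (φ₁ 1) := by
  have h1 := contDiffAt_chartMul (G := G) (p := (φ₁ 1, φ₁ 1)) (mem_extChartAt_target 1)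
    (mem_extChartAt_target 1) (by
      simp only [extChartAt_to_inv, mul_one]; exact mem_extChartAt_source 1)
  have h2 : ContDiffAt ℝ ∞ (fderiv ℝ (chartMul G)) (φ₁ 1, φ₁ 1) := h1.fderiv_right (by simp)
  have h3 : ContDiffAt ℝ ∞ (fun z : ℰ => (z, φ₁ 1)) (φ₁ 1) := contDiffAt_id.prodMk contDiffAt_const
  exact (ContDiffAt.comp (f := fun z : ℰ => (z, φ₁ 1)) (φ₁ 1) h2 h3).clm_comp contDiffAt_const

omit [LieGroup (𝓡 n) ∞ G] in
theorem mulInvariantVectorField_one (X : LieAlg (n := n) G) :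
    (mulInvariantVectorField (I := 𝓡 n) X (1 : G) : ℰ) = X := by
  have e : (fun a : G => 1 * a) = id := funext one_mul
  have h := mfderiv_id (I := 𝓡 n) (x := (1 : G))
  rw [← e] at h
  exact congrArg (fun T : ℰ →L[ℝ] ℰ => T X) h

theorem isInvertible_leftFrame : (leftFrame (n := n) G (φ₁ 1)).IsInvertible := by
  have : IsManifold (𝓡 n) 1 G := IsManifold.of_le (n := ∞) (by simp)
  have h := isInvertible_mfderiv_extChartAt (I := 𝓡 n) (mem_extChartAt_source (I := 𝓡 n) (1 : G))
  have e : leftFrame G (φ₁ 1) = (mfderiv (𝓡 n) 𝓘(ℝ, ℰ) φ₁ (1 : G) : ℰ →L[ℝ] ℰ) := by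
    refine ContinuousLinearMap.ext fun X => ?_
    refine (leftFrame_apply (mem_extChartAt_source 1) X).trans ?_
    exact congrArg (mfderiv (𝓡 n) 𝓘(ℝ, ℰ) φ₁ (1 : G) : ℰ →L[ℝ] ℰ) (mulInvariantVectorField_one X)
  rw [e]
  exact h

theorem exists_mulInvariantVectorField_eq (g : G) (v : ℰ) :
    ∃ X : LieAlg (n := n) G, (mulInvariantVectorField (I := 𝓡 n) X g : ℰ) = v := by
  have h1 := mfderiv_comp (I := 𝓡 n) (I' := 𝓡 n) (I'' := 𝓡 n) g
    (mdifferentiable_mul_left' (n := n) g (g⁻¹ * g)) (mdifferentiable_mul_left' (n := n) g⁻¹ g)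
  have h2 : (fun a : G => g * a) ∘ (fun a : G => g⁻¹ * a) = id := by
    funext a; simp
  rw [h2, mfderiv_id] at h1
  have h3 : g⁻¹ * g = 1 := inv_mul_cancel g
  rw [h3] at h1
  refine ⟨(mfderiv (𝓡 n) (𝓡 n) (fun a : G => g⁻¹ * a) g : ℰ →L[ℝ] ℰ) v, ?_⟩
  exact (congrArg (fun T : ℰ →L[ℝ] ℰ => T v) h1).symm

/-- Conjugation by an element with trivial adjoint action is the identity near `1`. -/
theorem eventually_conj_eq {h : G} (hh : Ad (n := n) h = ContinuousLinearMap.id ℝ _) :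
    ∀ᶠ g in 𝓝 (1 : G), h * g * h⁻¹ = g := by
  have hc := isInvertible_leftFrame (n := n) (G := G)
  obtain ⟨e, he⟩ := hc
  -- The parallelism is the Maurer–Cartan form, in coordinates the inverse of the left invariant
  -- frame.
  have hκ : ContDiffAt ℝ ∞ (fun z => (leftFrame (n := n) G z).inverse) (φ₁ 1) := by
    refine ContDiffAt.comp (E := ℰ) (F := ℰ →L[ℝ] ℰ) (G := ℰ →L[ℝ] ℰ)
      (g := ContinuousLinearMap.inverse) (φ₁ 1) ?_ contDiffAt_leftFrame
    rw [← he]; exact contDiffAt_map_inverse (𝕜 := ℝ) (E := ℰ) (F := ℰ) e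
  have hinv : ∀ᶠ g in 𝓝 (1 : G), (leftFrame (n := n) G (φ₁ g)).IsInvertible := by
    have h1 : ContinuousAt (fun g : G => leftFrame (n := n) G (φ₁ g)) 1 :=
      ContinuousAt.comp (f := φ₁) contDiffAt_leftFrame.continuousAt (continuousAt_extChartAt 1)
    refine h1.eventually (p := fun T : ℰ →L[ℝ] ℰ => T.IsInvertible) ?_
    refine Filter.Eventually.mono (p := fun T : ℰ →L[ℝ] ℰ =>
      T ∈ Set.range ((↑) : (ℰ ≃L[ℝ] ℰ) → ℰ →L[ℝ] ℰ)) ?_ fun T hT => hT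
    beta_reduce
    rw [← he]
    exact (ContinuousLinearEquiv.isOpen (𝕜 := ℝ) (E := ℰ) (F := ℰ)).mem_nhds ⟨e, rfl⟩
  have hsrc : ∀ᶠ g in 𝓝 (1 : G), g ∈ (φ₁).source := extChartAt_source_mem_nhds 1
  have inv_eq : ∀ (T : ℰ →L[ℝ] ℰ) (v w : ℰ), T.IsInvertible → v = T w → T.inverse v = w :=
    fun T v w hT => hT.inverse_apply_eq.2
  have hconj : Filter.Tendsto (fun g : G => h * g * h⁻¹) (𝓝 1) (𝓝 1) := by
    have := (contMDiff_conj (n := n) h).continuous.tendsto 1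
    simpa using this
  refine eventuallyEq_of_coframe_manifold (N := G) (n := n) (u := 1) (b := 1)
    (F := fun g => h * g * h⁻¹) (F' := id)
    (κ := fun z => (leftFrame (n := n) G z).inverse)
    (θ := fun y => (leftFrame (n := n) G (φ₁ y)).inverse.comp
      (mfderiv (𝓡 n) 𝓘(ℝ, ℰ) φ₁ y : ℰ →L[ℝ] ℰ))
    (hκ.of_le (WithTop.coe_le_coe.2 le_top)) (Filter.Eventually.of_forall fun y v => rfl) ?_
    (by simp) rfl (Filter.Eventually.of_forall fun w => (contMDiff_conj (n := n) h).contMDiffAt)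
    (Filter.Eventually.of_forall fun w => contMDiffAt_id) ?_
  · have : IsManifold (𝓡 n) 1 G := IsManifold.of_le (n := ∞) (by simp)
    have h2 := isInvertible_mfderiv_extChartAt (I := 𝓡 n)
      (mem_extChartAt_source (I := 𝓡 n) (1 : G))
    rw [← he, ContinuousLinearMap.inverse_equiv]
    exact e.symm.injective.comp h2.injective
  -- Conjugation by `h` sends the left invariant field of `X` to that of `Ad h X = X`, so it
  -- preserves the Maurer–Cartan form, as the identity does.
  · filter_upwards [hinv, hconj.eventually hinv, hsrc, hconj.eventually hsrc] with g h1 h2 h3 h4 ξ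
    obtain ⟨X, rfl⟩ := exists_mulInvariantVectorField_eq g ξ
    have e1 := mfderiv_conj_mulInvariantVectorField h g X
    rw [hh] at e1
    have key : ∀ {a : G}, (leftFrame (n := n) G (φ₁ a)).IsInvertible → a ∈ (φ₁).source →
        (leftFrame (n := n) G (φ₁ a)).inverse ((mfderiv (𝓡 n) 𝓘(ℝ, ℰ) φ₁ a : ℰ →L[ℝ] ℰ)
          (mulInvariantVectorField (I := 𝓡 n) X a)) = X := by
      intro a ha has
      exact inv_eq _ _ _ ha (leftFrame_apply has X).symm
    have e2 := key h2 h4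
    have e3 := key h1 h3
    refine Eq.trans (congrArg (fun v : ℰ => (leftFrame (n := n) G (φ₁ (h * g * h⁻¹))).inverse
      ((mfderiv (𝓡 n) 𝓘(ℝ, ℰ) φ₁ (h * g * h⁻¹) : ℰ →L[ℝ] ℰ) v)) e1) (e2.trans ?_)
    rw [mfderiv_id]
    exact e3.symm

theorem isOpen_centralizer {h : G} (hh : Ad (n := n) h = ContinuousLinearMap.id ℝ _) :
    IsOpen (Subgroup.centralizer {h} : Set G) := by
  have : IsTopologicalGroup G := topologicalGroup_of_lieGroup (𝓡 n) ∞
  refine Subgroup.isOpen_of_mem_nhds (g := 1) _ ?_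
  filter_upwards [eventually_conj_eq hh] with g hg
  rw [SetLike.mem_coe, Subgroup.mem_centralizer_singleton_iff]
  exact mul_inv_eq_iff_eq_mul.1 hg |>.symm

/-- If `G / P` is connected, then every element of `P` with trivial adjoint action lies in the
kernel of the geometry. -/
theorem mem_normalCore_of_connectedSpace {P : Subgroup G} [ConnectedSpace (G ⧸ P)] {h : G}
    (hP : h ∈ P) (hh : Ad (n := n) h = ContinuousLinearMap.id ℝ _) : h ∈ P.normalCore := by
  have : IsTopologicalGroup G := topologicalGroup_of_lieGroup (𝓡 n) ∞
  set H := Subgroup.centralizer {h}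
  have hH : IsOpen (H : Set G) := isOpen_centralizer hh
  have hopen : ∀ g : G, IsOpen ((fun a : G => (a : G ⧸ P)) '' ((fun a => a * g) '' (H : Set G))) :=
    fun g => QuotientGroup.isOpenMap_coe _ ((isOpenMap_mul_right g) _ hH)
  set S := (fun a : G => (a : G ⧸ P)) '' (H : Set G) with hS
  have hSo : IsOpen S := by simpa using hopen 1
  -- All orbits of the open subgroup `H` on `G ⧸ P` are open, so the complement of one of them is
  -- open.
  have hSc : IsClosed S := by
    rw [← isOpen_compl_iff, isOpen_iff_mem_nhds]
    intro y hy
    obtain ⟨g, rfl⟩ := QuotientGroup.mk_surjective y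
    refine Filter.mem_of_superset ((hopen g).mem_nhds ⟨g, ⟨1, H.one_mem, one_mul g⟩, rfl⟩) ?_
    rintro _ ⟨_, ⟨a, ha, rfl⟩, rfl⟩ ⟨b, hb, hab⟩
    refine hy ⟨a⁻¹ * b, H.mul_mem (H.inv_mem ha) hb, ?_⟩
    rw [QuotientGroup.eq] at hab ⊢
    simpa [mul_assoc] using hab
  have hSu : S = Set.univ := IsClopen.eq_univ ⟨hSc, hSo⟩ ⟨_, 1, H.one_mem, rfl⟩
  intro g
  have hg : ((g⁻¹ : G) : G ⧸ P) ∈ S := hSu ▸ Set.mem_univ _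
  obtain ⟨a, ha, hag⟩ := hg
  rw [QuotientGroup.eq] at hag
  have ha' : a * h = h * a := (Subgroup.mem_centralizer_singleton_iff.1 ha)
  -- Transitivity gives `a` commuting with `h` and `a⁻¹ * g⁻¹ ∈ P`, so this conjugate of `h` is
  -- already one by an element of `P`.
  have e : g * h * g⁻¹ = (a⁻¹ * g⁻¹)⁻¹ * h * (a⁻¹ * g⁻¹) := by
    rw [mul_inv_rev, inv_inv, inv_inv, mul_assoc g a h, ha']; group
  rw [e]
  exact P.mul_mem (P.mul_mem (P.inv_mem hag) hP) hag

theorem Ad_conj_eq_id {g h : G} (hh : Ad (n := n) h = ContinuousLinearMap.id ℝ _) :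
    Ad (n := n) (g * h * g⁻¹) = ContinuousLinearMap.id ℝ (LieAlg (n := n) G) := by
  refine ContinuousLinearMap.ext fun X => ?_
  rw [Ad_mul_apply, Ad_mul_apply, hh]
  exact Ad_apply_inv g X

end
end
end ParabolicGeometry
-- Principal bundle structure and the product rule for the Cartan connection.
namespace ParabolicGeometry
noncomputable section

section Action

variable {P B : Type*} [Group P] [MulAction Pᵐᵒᵖ B]

theorem rAct_one (u : B) : rAct u (1 : P) = u := by simp [rAct]

theorem rAct_rAct (u : B) (g h : P) : rAct (rAct u g) h = rAct u (g * h) := by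
  simp [rAct, mul_smul]

end Action

namespace CartanGeometry

variable {n k m : ℕ} {G : Type*} [TopologicalSpace G]
  [ChartedSpace (EuclideanSpace ℝ (Fin n)) G] [Group G]
  {P : Subgroup G} [ChartedSpace (EuclideanSpace ℝ (Fin k)) P]
  {B : Type*} [TopologicalSpace B] [ChartedSpace (EuclideanSpace ℝ (Fin n)) B]
  [IsManifold (𝓡 n) ∞ B] [MulAction (↥P)ᵐᵒᵖ B]
  {M : Type*} [TopologicalSpace M] [ChartedSpace (EuclideanSpace ℝ (Fin m)) M]
  (C : CartanGeometry (n := n) (k := k) (m := m) P B M)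

include C in
theorem rAct_injective {u : B} {g h : P} (he : rAct u g = rAct u h) : g = h := by
  obtain ⟨e, hx, -, -, heq⟩ := C.exists_trivialization (C.proj u)
  have hu : u ∈ e.source := e.mem_source.2 hx
  have h1 := heq u hu g
  rw [he, heq u hu h] at h1
  exact (mul_left_cancel (Prod.ext_iff.1 h1).2).symm

theorem eq_rAct_of_mem_baseSet {e : Bundle.Trivialization P C.proj}
    (heq : ∀ u ∈ e.source, ∀ h : P, e (rAct u h) = ((e u).1, (e u).2 * h)) {u w : B}
    (hu : C.proj u ∈ e.baseSet) (hw : C.proj w = C.proj u) :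
    w = rAct u ((e u).2⁻¹ * (e w).2) := by
  have hu' : u ∈ e.source := e.mem_source.2 hu
  have hw' : w ∈ e.source := e.mem_source.2 (hw ▸ hu)
  refine e.injOn hw' (e.mem_source.2 (by rwa [C.proj_rAct])) ?_
  change e w = e (rAct u _)
  rw [heq u hu', mul_inv_cancel_left, e.coe_fst hu', ← hw, ← e.coe_fst hw']

theorem exists_eq_rAct {u w : B} (h : C.proj w = C.proj u) : ∃ g : P, w = rAct u g := by
  obtain ⟨e, hx, -, -, heq⟩ := C.exists_trivialization (C.proj u)
  exact ⟨_, C.eq_rAct_of_mem_baseSet heq hx h⟩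

theorem map_proj_nhds (u : B) : Filter.map C.proj (𝓝 u) = 𝓝 (C.proj u) := by
  obtain ⟨e, hx, -⟩ := C.exists_trivialization (C.proj u)
  exact e.map_proj_nhds (e.mem_source.2 hx)

theorem surjective_proj : Function.Surjective C.proj := by
  intro x
  obtain ⟨e, hx, -⟩ := C.exists_trivialization x
  exact ⟨_, e.proj_symm_apply' hx (x := 1)⟩

include C in
theorem contMDiff_rAct_right (h : P) : ContMDiff (𝓡 n) (𝓡 n) ∞ (fun u : B => rAct u h) :=
  C.contMDiff_rAct.comp (contMDiff_id.prodMk contMDiff_const)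

include C in
theorem tendsto_rAct_right (u : B) (h : P) :
    Filter.Tendsto (fun w : B => rAct w h) (𝓝 u) (𝓝 (rAct u h)) :=
  (C.contMDiff_rAct_right h).continuous.tendsto u

theorem exists_trivialization_smoothAt (u : B) : ∃ e : Bundle.Trivialization P C.proj,
    C.proj u ∈ e.baseSet ∧
    (∀ w ∈ e.source, ContMDiffAt (𝓡 n) ((𝓡 m).prod (𝓡 k)) ∞ e w) ∧
    (∀ y ∈ e.target, ContMDiffAt ((𝓡 m).prod (𝓡 k)) (𝓡 n) ∞ e.toOpenPartialHomeomorph.symm y) ∧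
    ∀ u ∈ e.source, ∀ h : P, e (rAct u h) = ((e u).1, (e u).2 * h) := by
  obtain ⟨e, hx, h1, h2, heq⟩ := C.exists_trivialization (C.proj u)
  exact ⟨e, hx, fun w hw => h1.contMDiffAt (e.open_source.mem_nhds hw),
    fun y hy => h2.contMDiffAt (e.open_target.mem_nhds hy), heq⟩

/-- Two smooth maps into the total space over the same map into the base differ by a smooth map
into the structure group. -/
theorem exists_eventually_eq_rAct [LieGroup (𝓡 k) ∞ P] {S T : B → B} {u : B}
    (hS : ∀ᶠ w in 𝓝 u, ContMDiffAt (𝓡 n) (𝓡 n) ∞ S w)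
    (hT : ∀ᶠ w in 𝓝 u, ContMDiffAt (𝓡 n) (𝓡 n) ∞ T w)
    (h : ∀ᶠ w in 𝓝 u, C.proj (T w) = C.proj (S w)) :
    ∃ f : B → P, ∀ᶠ w in 𝓝 u, T w = rAct (S w) (f w) ∧ ContMDiffAt (𝓡 n) (𝓡 k) ∞ f w := by
  obtain ⟨e, hx, h1, -, heq⟩ := C.exists_trivialization_smoothAt (S u)
  refine ⟨fun w => (e (S w)).2⁻¹ * (e (T w)).2, ?_⟩
  have hSs : ∀ᶠ w in 𝓝 u, S w ∈ e.source :=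
    hS.self_of_nhds.continuousAt.eventually (e.open_source.mem_nhds (e.mem_source.2 hx))
  filter_upwards [hS, hT, h, hSs] with w hw1 hw2 hw3 hw4
  have hw5 : T w ∈ e.source := e.mem_source.2 (hw3 ▸ e.mem_source.1 hw4)
  refine ⟨C.eq_rAct_of_mem_baseSet heq (e.mem_source.1 hw4) hw3, ?_⟩
  exact ((h1 _ hw4).comp w hw1).snd.inv.mul ((h1 _ hw5).comp w hw2).snd

/-- The Cartan connection as a map into the linear endomorphisms of the model space. -/
def form (u : B) : EuclideanSpace ℝ (Fin n) →L[ℝ] LieAlg (n := n) G := C.conn u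

theorem bijective_form (u : B) : Function.Bijective (C.form u) := C.bijective_conn u

/-- The differential of a map `B → B` as a linear endomorphism of the model space. -/
def diff (F : B → B) (u : B) : EuclideanSpace ℝ (Fin n) →L[ℝ] EuclideanSpace ℝ (Fin n) :=
  mfderiv (𝓡 n) (𝓡 n) F u

theorem form_rAct (u : B) (h : P) (ξ : EuclideanSpace ℝ (Fin n)) :
    C.form (rAct u h) (diff (fun w : B => rAct w h) u ξ) = Ad ((h : G)⁻¹) (C.form u ξ) :=
  C.conn_rAct u h ξ

variable (P) in
/-- The differential at `1` of the inclusion of the structure group, restricted along a map. -/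
def dval (f : B → P) (u : B) : EuclideanSpace ℝ (Fin n) →L[ℝ] LieAlg (n := n) G :=
  (mfderiv (𝓡 k) (𝓡 n) (Subtype.val : P → G) 1 :
    EuclideanSpace ℝ (Fin k) →L[ℝ] EuclideanSpace ℝ (Fin n)).comp
    (mfderiv (𝓡 n) (𝓡 k) f u : EuclideanSpace ℝ (Fin n) →L[ℝ] EuclideanSpace ℝ (Fin k))

/-- The product rule for the action of a group valued function. -/
theorem form_diff_rAct {S : B → B} {f : B → P} {w : B} (hS : ContMDiffAt (𝓡 n) (𝓡 n) ∞ S w)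
    (hf : ContMDiffAt (𝓡 n) (𝓡 k) ∞ f w) (hfw : f w = 1) (ξ : EuclideanSpace ℝ (Fin n)) :
    C.form (S w) (diff (fun w => rAct (S w) (f w)) w ξ) =
      C.form (S w) (diff S w ξ) + dval (k := k) P f w ξ := by
  have h1 := mfderiv_comp_prodMk (N₁ := B) (N₂ := P) (N₃ := B)
    (F₀ := EuclideanSpace ℝ (Fin n)) (F₁ := EuclideanSpace ℝ (Fin n))
    (F₂ := EuclideanSpace ℝ (Fin k)) (F₃ := EuclideanSpace ℝ (Fin n))
    (Φ := fun q : B × P => rAct q.1 q.2) (a := S) (b := f) (x := w)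
    (C.contMDiff_rAct.mdifferentiable (by simp) _) (hS.mdifferentiableAt (by simp))
    (hf.mdifferentiableAt (by simp)) ξ
  have h2 := congrArg (C.form (S w)) h1
  refine h2.trans ((map_add (C.form (S w)) _ _).trans ?_)
  have e1 : (fun z : B => rAct z (f w)) = id := by
    funext z; rw [hfw, rAct_one]; rfl
  refine congrArg₂ (· + ·) ?_ ?_
  · refine congrArg (C.form (S w)) ?_
    have h3 : diff (n := n) (fun z : B => rAct z (f w)) (S w) = ContinuousLinearMap.id ℝ _ := by
      rw [e1]; exact mfderiv_id
    exact congrArg (fun T : EuclideanSpace ℝ (Fin n) →L[ℝ] EuclideanSpace ℝ (Fin n) =>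
      T (diff S w ξ)) h3
  · have h4 : ∀ (b : P) (Y : EuclideanSpace ℝ (Fin k)), b = 1 → C.form (S w)
        (mfderiv (𝓡 k) (𝓡 n) (fun h : P => rAct (S w) h) b Y : EuclideanSpace ℝ (Fin n)) =
        (mfderiv (𝓡 k) (𝓡 n) (Subtype.val : P → G) 1 :
          EuclideanSpace ℝ (Fin k) →L[ℝ] EuclideanSpace ℝ (Fin n)) Y := by
      rintro b Y rfl
      have h5 := C.conn_fundamental (S w) Y
      have h6 : C.form (rAct (S w) (1 : P)) = C.form (S w) := by rw [rAct_one]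
      exact (congrArg (fun T : EuclideanSpace ℝ (Fin n) →L[ℝ] LieAlg (n := n) G => T
        (mfderiv (𝓡 k) (𝓡 n) (fun h : P => rAct (S w) h) 1 Y : EuclideanSpace ℝ (Fin n)))
        h6).symm.trans h5
    exact h4 (f w) _ hfw

end CartanGeometry
end
end ParabolicGeometry
-- The Cartan connection modulo `𝔭` and as an absolute parallelism.
namespace ParabolicGeometry
noncomputable section
namespace CartanGeometry

variable {n k m : ℕ} {G : Type*} [TopologicalSpace G]
  [ChartedSpace (EuclideanSpace ℝ (Fin n)) G] [Group G]
  {P : Subgroup G} [ChartedSpace (EuclideanSpace ℝ (Fin k)) P]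
  {B : Type*} [TopologicalSpace B] [ChartedSpace (EuclideanSpace ℝ (Fin n)) B]
  [IsManifold (𝓡 n) ∞ B] [MulAction (↥P)ᵐᵒᵖ B]
  {M : Type*} [TopologicalSpace M] [ChartedSpace (EuclideanSpace ℝ (Fin m)) M]
  (C : CartanGeometry (n := n) (k := k) (m := m) P B M)

omit [IsManifold (𝓡 n) ∞ B] [MulAction (↥P)ᵐᵒᵖ B] in
theorem diff_comp {F H : B → B} {u : B} (hF : ContMDiffAt (𝓡 n) (𝓡 n) ∞ F (H u))
    (hH : ContMDiffAt (𝓡 n) (𝓡 n) ∞ H u) :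
    diff (n := n) (fun w => F (H w)) u = (diff F (H u)).comp (diff H u) :=
  mfderiv_comp (I := 𝓡 n) (I' := 𝓡 n) (I'' := 𝓡 n) u (hF.mdifferentiableAt (by simp))
    (hH.mdifferentiableAt (by simp))

omit [IsManifold (𝓡 n) ∞ B] [MulAction (↥P)ᵐᵒᵖ B] in
theorem diff_congr {F H : B → B} {u : B} (h : F =ᶠ[𝓝 u] H) :
    diff (n := n) F u = diff H u := by
  exact h.mfderiv_eq

/-- The differential of the projection. -/
def diffProj (u : B) : EuclideanSpace ℝ (Fin n) →L[ℝ] EuclideanSpace ℝ (Fin m) :=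
  mfderiv (𝓡 n) (𝓡 m) C.proj u

theorem mdifferentiableAt_proj (u : B) : MDifferentiableAt (𝓡 n) (𝓡 m) C.proj u :=
  C.contMDiff_proj.mdifferentiable (by simp) u

theorem diffProj_diff {F : B → B} {H : M → M} {u : B} (hF : ContMDiffAt (𝓡 n) (𝓡 n) ∞ F u)
    (hH : MDifferentiableAt (𝓡 m) (𝓡 m) H (C.proj u))
    (h : ∀ᶠ w in 𝓝 u, C.proj (F w) = H (C.proj w)) (ξ : EuclideanSpace ℝ (Fin n)) :
    C.diffProj (F u) (diff F u ξ) =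
      (mfderiv (𝓡 m) (𝓡 m) H (C.proj u) (C.diffProj u ξ) : EuclideanSpace ℝ (Fin m)) := by
  have h1 := mfderiv_comp (I := 𝓡 n) (I' := 𝓡 n) (I'' := 𝓡 m) u (C.mdifferentiableAt_proj (F u))
    (hF.mdifferentiableAt (by simp))
  have h2 := mfderiv_comp (I := 𝓡 n) (I' := 𝓡 m) (I'' := 𝓡 m) u hH (C.mdifferentiableAt_proj u)
  have h3 : C.proj ∘ F =ᶠ[𝓝 u] H ∘ C.proj := h
  exact congrArg (fun T : EuclideanSpace ℝ (Fin n) →L[ℝ] EuclideanSpace ℝ (Fin m) => T ξ)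
    (h1.symm.trans (h3.mfderiv_eq.trans h2))

variable [LieGroup (𝓡 n) ∞ G] {Γ : OneGrading (LieAlg (n := n) G)}

omit [IsManifold (𝓡 n) ∞ B] [MulAction (↥P)ᵐᵒᵖ B] in
theorem dval_mem (hP : IsParabolic (k := k) Γ P) (f : B → P) (u : B)
    (ξ : EuclideanSpace ℝ (Fin n)) : dval (k := k) P f u ξ ∈ Γ.filtration 0 := by
  have h := hP.range_mfderiv
  rw [← SetLike.mem_coe, ← h]
  exact ⟨_, rfl⟩

/-- The Cartan connection maps vertical tangent vectors to `𝔭`. -/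
theorem form_mem_of_diffProj_eq_zero (hP : IsParabolic (k := k) Γ P) {u : B}
    {ξ : EuclideanSpace ℝ (Fin n)} (hξ : C.diffProj u ξ = 0) : C.form u ξ ∈ Γ.filtration 0 := by
  have := hP.lieGroup
  obtain ⟨e, hx, h1, h2, -⟩ := C.exists_trivialization_smoothAt u
  have hu : u ∈ e.source := e.mem_source.2 hx
  set b := (e u).2
  -- `S` freezes the group coordinate, so it factors through `proj` and its differential kills
  -- vertical vectors. In the product rule for `id = S · f` only the derivative of `f` remains, and
  -- this lies in `𝔭`.
  let S : B → B := fun w => e.toOpenPartialHomeomorph.symm (C.proj w, b)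
  have hSu : S u = u := by
    have : (C.proj u, b) = e u := Prod.ext (e.coe_fst hu).symm rfl
    change e.toOpenPartialHomeomorph.symm (C.proj u, b) = u
    rw [this]
    exact e.left_inv hu
  have hbase : ∀ᶠ w in 𝓝 u, C.proj w ∈ e.baseSet :=
    C.contMDiff_proj.continuous.continuousAt.eventually (e.open_baseSet.mem_nhds hx)
  have hsymm : ∀ y ∈ e.baseSet, ContMDiffAt (𝓡 m) (𝓡 n) ∞
      (fun y => e.toOpenPartialHomeomorph.symm (y, b)) y := fun y hy =>
    (h2 (y, b) (e.mem_target.2 hy)).comp (f := fun y : M => (y, b)) y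
      (contMDiffAt_id.prodMk contMDiffAt_const)
  have hS : ∀ᶠ w in 𝓝 u, ContMDiffAt (𝓡 n) (𝓡 n) ∞ S w := by
    filter_upwards [hbase] with w hw
    exact (hsymm _ hw).comp w C.contMDiff_proj.contMDiffAt
  obtain ⟨f, hf⟩ := C.exists_eventually_eq_rAct (T := id) hS
    (Filter.Eventually.of_forall fun w => contMDiffAt_id) (by
      filter_upwards [hbase] with w hw
      exact (e.proj_symm_apply' hw).symm)
  have hfu : f u = 1 := by
    have := hf.self_of_nhds.1
    rw [hSu] at this
    exact C.rAct_injective (this.symm.trans (rAct_one u).symm)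
  have h3 := C.form_diff_rAct hS.self_of_nhds hf.self_of_nhds.2 hfu ξ
  have h4 : diff (n := n) (fun w => rAct (S w) (f w)) u = ContinuousLinearMap.id ℝ _ := by
    rw [← diff_congr (hf.mono fun w hw => hw.1)]
    exact mfderiv_id
  have h5 : diff S u ξ = 0 := by
    have h6 := mfderiv_comp (I := 𝓡 n) (I' := 𝓡 m) (I'' := 𝓡 n) u
      ((hsymm _ hx).mdifferentiableAt (by simp)) (C.mdifferentiableAt_proj u)
    refine (congrArg (fun T : EuclideanSpace ℝ (Fin n) →L[ℝ] EuclideanSpace ℝ (Fin n) => T ξ)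
      h6).trans ?_
    refine (congrArg (mfderiv (𝓡 m) (𝓡 n) (fun y => e.toOpenPartialHomeomorph.symm (y, b))
      (C.proj u) : EuclideanSpace ℝ (Fin m) →L[ℝ] EuclideanSpace ℝ (Fin n)) hξ).trans ?_
    exact ContinuousLinearMap.map_zero _
  rw [h4, h5, hSu, map_zero, zero_add] at h3
  exact h3 ▸ dval_mem hP f u ξ

/-- If a connection preserving map over a map with differential `-id` maps `u` to `u · g`,
then `g` acts by `-id` on `𝔤 / 𝔭`. -/
theorem actsBy_neg_one (hP : IsParabolic (k := k) Γ P) {F : B → B} {H : M → M} {u : B} {g : P}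
    (hF : ContMDiffAt (𝓡 n) (𝓡 n) ∞ F u) (hH : MDifferentiableAt (𝓡 m) (𝓡 m) H (C.proj u))
    (h : ∀ᶠ w in 𝓝 u, C.proj (F w) = H (C.proj w))
    (hform : ∀ ξ, C.form (F u) (diff F u ξ) = C.form u ξ)
    (hneg : ∀ ζ : EuclideanSpace ℝ (Fin m),
      (mfderiv (𝓡 m) (𝓡 m) H (C.proj u) ζ : EuclideanSpace ℝ (Fin m)) = -ζ)
    (hg : F u = rAct u g) : Γ.ActsBy (adEquiv (g : G)) (-1) := by
  refine hP.actsBy (by norm_num) fun X => ?_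
  obtain ⟨ξ, rfl⟩ := (C.bijective_form u).2 X
  rw [neg_one_smul, sub_neg_eq_add]
  have h1 := C.form_rAct u g ξ
  have h2 := hform ξ
  have h3 := C.diffProj_diff hF hH h ξ
  have h4 := C.diffProj_diff (u := u) (H := id) (C.contMDiff_rAct_right g).contMDiffAt mdifferentiableAt_id
    (Filter.Eventually.of_forall fun w => C.proj_rAct w g) ξ
  rw [mfderiv_id] at h4
  rw [hg] at h2 h3
  -- The sum is `ω` of two vectors at `u · g`, the images of `ξ` under right translation and under
  -- `F`. Their projections to `M` are opposite, so their sum is vertical.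
  rw [← h1, ← h2, ← map_add]
  refine C.form_mem_of_diffProj_eq_zero hP ?_
  rw [map_add]
  have h5 := h3.trans (hneg _)
  have h6 : C.diffProj (rAct u g) (diff (fun w => rAct w g) u ξ) = C.diffProj u ξ := h4
  rw [h5, h6]
  exact add_neg_cancel _

-- `ω` is a smooth coframe on `B`, so `eventuallyEq_of_coframe_manifold` applies to its expression
-- `κ` in the chart at the common value of the two maps.
omit [LieGroup (𝓡 n) ∞ G] in
theorem eventuallyEq_of_form {F F' : B → B} {u : B}
    (hF : ∀ᶠ w in 𝓝 u, ContMDiffAt (𝓡 n) (𝓡 n) ∞ F w)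
    (hF' : ∀ᶠ w in 𝓝 u, ContMDiffAt (𝓡 n) (𝓡 n) ∞ F' w) (hu : F u = F' u)
    (h : ∀ᶠ w in 𝓝 u, ∀ ξ, C.form (F w) (diff F w ξ) = C.form (F' w) (diff F' w ξ)) :
    F =ᶠ[𝓝 u] F' := by
  have : IsManifold (𝓡 n) 1 B := IsManifold.of_le (n := ∞) (by simp)
  set b := F u with hb
  set β := extChartAt (𝓡 n) b
  let κ : EuclideanSpace ℝ (Fin n) → EuclideanSpace ℝ (Fin n) →L[ℝ] EuclideanSpace ℝ (Fin n) :=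
    fun z => (C.form (β.symm z)).comp (mfderivWithin 𝓘(ℝ, EuclideanSpace ℝ (Fin n)) (𝓡 n) β.symm
      β.target z : EuclideanSpace ℝ (Fin n) →L[ℝ] EuclideanSpace ℝ (Fin n))
  have ho : IsOpen β.target := isOpen_extChartAt_target b
  have hκ : ContDiffOn ℝ ∞ κ β.target := by
    rw [contDiffOn_clm_apply]
    intro v
    rw [← contMDiffOn_iff_contDiffOn]
    have h1 := (contMDiffOn_extChartAt_symm (I := 𝓡 n) (n := ∞) b).contMDiffOn_tangentMapWithin
      (m := ∞) (by simp) ho.uniqueMDiffOn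
    have h2 : ContMDiffOn 𝓘(ℝ, EuclideanSpace ℝ (Fin n))
        (𝓘(ℝ, EuclideanSpace ℝ (Fin n))).tangent ∞
        (fun z => (⟨z, v⟩ : TangentBundle 𝓘(ℝ, EuclideanSpace ℝ (Fin n))
          (EuclideanSpace ℝ (Fin n)))) β.target :=
      contMDiffOn_vectorSpace_iff_contDiffOn.2 contDiffOn_const
    exact C.contMDiff_conn.comp_contMDiffOn (h1.comp h2 fun z hz => hz)
  refine eventuallyEq_of_coframe_manifold (κ := κ) (θ := C.form)
    ((hκ.contDiffAt (ho.mem_nhds (mem_extChartAt_target b))).of_le (WithTop.coe_le_coe.2 le_top))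
    ?_ (C.bijective_form b).1 rfl hu.symm hF hF' h
  filter_upwards [extChartAt_source_mem_nhds (I := 𝓡 n) b] with y hy v
  have h1 := mfderivWithin_of_isOpen (I := 𝓘(ℝ, EuclideanSpace ℝ (Fin n))) (I' := 𝓡 n)
    (f := β.symm) ho (β.map_source hy)
  have h2 := mfderivWithin_extChartAt_symm_comp_mfderiv_extChartAt' (I := 𝓡 n) hy
  rw [ModelWithCorners.range_eq_univ, mfderivWithin_univ] at h2
  have h3 := congrArg
    (fun T : EuclideanSpace ℝ (Fin n) →L[ℝ] EuclideanSpace ℝ (Fin n) => T v) h2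
  have h4 : C.form (β.symm (β y)) = C.form y := congrArg C.form (β.left_inv hy)
  refine Eq.trans ?_ (congrArg (C.form y) h3)
  refine (congrArg (fun T : EuclideanSpace ℝ (Fin n) →L[ℝ] LieAlg (n := n) G => T _) h4).trans ?_
  exact congrArg (fun T : EuclideanSpace ℝ (Fin n) →L[ℝ] EuclideanSpace ℝ (Fin n) => C.form y
    (T (mfderiv (𝓡 n) 𝓘(ℝ, EuclideanSpace ℝ (Fin n)) β y v : EuclideanSpace ℝ (Fin n)))) h1

end CartanGeometry
end
end ParabolicGeometry
-- Coverings of symmetries, involutivity, isolated fixed points.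
namespace ParabolicGeometry
noncomputable section

/-- A fixed point with differential `-id` is isolated. -/
theorem eventually_ne_of_mfderiv_eq_neg {m : ℕ} {M : Type*} [TopologicalSpace M]
    [ChartedSpace (EuclideanSpace ℝ (Fin m)) M] {s : M → M} {x : M} (hx : s x = x)
    (hs : MDifferentiableAt (𝓡 m) (𝓡 m) s x)
    (h : ∀ ζ : EuclideanSpace ℝ (Fin m),
      (mfderiv (𝓡 m) (𝓡 m) s x ζ : EuclideanSpace ℝ (Fin m)) = -ζ) :
    ∀ᶠ y in 𝓝[≠] x, s y ≠ y := by
  set α := extChartAt (𝓡 m) x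
  have h1 : HasFDerivAt (𝕜 := ℝ) (E := EuclideanSpace ℝ (Fin m)) (F := EuclideanSpace ℝ (Fin m))
      (fun z => α (s (α.symm z))) (-ContinuousLinearMap.id ℝ (EuclideanSpace ℝ (Fin m))) (α x) := by
    have h2 := hasFDerivAt_of_hasMFDerivAt (F := EuclideanSpace ℝ (Fin m))
      (F' := EuclideanSpace ℝ (Fin m)) hs.hasMFDerivAt
    rw [hx] at h2
    have e : (mfderiv (𝓡 m) (𝓡 m) s x : EuclideanSpace ℝ (Fin m) →L[ℝ] EuclideanSpace ℝ (Fin m)) =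
      -ContinuousLinearMap.id ℝ (EuclideanSpace ℝ (Fin m)) := ContinuousLinearMap.ext h
    exact e ▸ h2
  have h2 : HasFDerivAt (fun z => α (s (α.symm z)) - z) _ (α x) := h1.fun_sub (hasFDerivAt_id (α x))
  -- In the chart the differential of `s - id` at the center is `-2 id`, which is bounded below.
  have h3 := h2.eventually_ne (c := 0) ⟨1, AddMonoidHomClass.antilipschitz_of_bound _ fun z => by
    have e : (-ContinuousLinearMap.id ℝ (EuclideanSpace ℝ (Fin m)) -
        ContinuousLinearMap.id ℝ (EuclideanSpace ℝ (Fin m))) z = -((2 : ℝ) • z) := by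
      change -z - z = _
      module
    rw [e, norm_neg, norm_smul]
    norm_num
    linarith [norm_nonneg z]⟩
  have h4 : Filter.Tendsto α (𝓝[≠] x) (𝓝[≠] (α x)) := by
    refine tendsto_nhdsWithin_iff.2
      ⟨(continuousAt_extChartAt x).tendsto.mono_left nhdsWithin_le_nhds, ?_⟩
    filter_upwards [self_mem_nhdsWithin, nhdsWithin_le_nhds (extChartAt_source_mem_nhds (I := 𝓡 m) x)]
      with y hy hys he
    exact hy (α.injOn hys (mem_extChartAt_source x) he)
  filter_upwards [h4.eventually h3,
    nhdsWithin_le_nhds (extChartAt_source_mem_nhds (I := 𝓡 m) x)] with y hy hys he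
  refine hy ?_
  rw [α.left_inv hys, he]
  exact sub_self _

variable {n k m : ℕ} {G : Type*} [TopologicalSpace G]
  [ChartedSpace (EuclideanSpace ℝ (Fin n)) G] [Group G]
  {P : Subgroup G} [ChartedSpace (EuclideanSpace ℝ (Fin k)) P]
  {B : Type*} [TopologicalSpace B] [ChartedSpace (EuclideanSpace ℝ (Fin n)) B]
  [IsManifold (𝓡 n) ∞ B] [MulAction (↥P)ᵐᵒᵖ B]
  {M : Type*} [TopologicalSpace M] [ChartedSpace (EuclideanSpace ℝ (Fin m)) M]
  {C : CartanGeometry (n := n) (k := k) (m := m) P B M}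

namespace CartanGeometry

variable (C) in
/-- The map `F` is smooth and preserves the Cartan connection at the point `u`. -/
structure PreservesAt (F : B → B) (u : B) : Prop where
  contMDiffAt : ContMDiffAt (𝓡 n) (𝓡 n) ∞ F u
  form_diff : ∀ ξ, C.form (F u) (diff F u ξ) = C.form u ξ

theorem PreservesAt.comp {F H : B → B} {u : B} (hF : C.PreservesAt F (H u))
    (hH : C.PreservesAt H u) : C.PreservesAt (fun w => F (H w)) u where
  contMDiffAt := hF.contMDiffAt.comp u hH.contMDiffAt
  form_diff ξ := by
    rw [diff_comp hF.contMDiffAt hH.contMDiffAt]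
    exact (hF.form_diff _).trans (hH.form_diff ξ)

theorem preservesAt_id (u : B) : C.PreservesAt (fun w => w) u where
  contMDiffAt := contMDiffAt_id
  form_diff ξ := by
    have : diff (n := n) (fun w : B => w) u = ContinuousLinearMap.id ℝ _ := mfderiv_id
    rw [this]; rfl

variable [LieGroup (𝓡 n) ∞ G]

theorem preservesAt_rAct {h : P} (hh : Ad (n := n) (h : G) = ContinuousLinearMap.id ℝ _) (u : B) :
    C.PreservesAt (fun w => rAct w h) u where
  contMDiffAt := (C.contMDiff_rAct_right h).contMDiffAt
  form_diff ξ := by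
    rw [C.form_rAct]
    have := Ad_inv_apply (n := n) (h : G) (C.form u ξ)
    rwa [hh] at this

/-- Two connection preserving maps which differ at a point by an element with trivial adjoint
action differ by this element near the point. -/
theorem eventually_eq_rAct {F F' : B → B} {u : B} {h : P} (hF : ∀ᶠ w in 𝓝 u, C.PreservesAt F w)
    (hF' : ∀ᶠ w in 𝓝 u, C.PreservesAt F' w)
    (hh : Ad (n := n) (h : G) = ContinuousLinearMap.id ℝ _) (hu : F' u = rAct (F u) h) :
    ∀ᶠ w in 𝓝 u, F' w = rAct (F w) h := by
  have hF2 : ∀ᶠ w in 𝓝 u, C.PreservesAt (fun w => rAct (F w) h) w :=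
    hF.mono fun w hw => (preservesAt_rAct hh _).comp hw
  refine C.eventuallyEq_of_form (hF'.mono fun w hw => hw.contMDiffAt)
    (hF2.mono fun w hw => hw.contMDiffAt) hu ?_
  filter_upwards [hF', hF2] with w h1 h2 ξ
  exact (h1.form_diff ξ).trans (h2.form_diff ξ).symm

end CartanGeometry

namespace LocalAutomorphism

variable {φ : LocalAutomorphism C} {s : OpenPartialHomeomorph M M} {x : M}

theorem preservesAt (φ : LocalAutomorphism C) {u : B} (hu : u ∈ φ.total.source) :
    C.PreservesAt φ.total u where
  contMDiffAt := φ.contMDiffOn_total.contMDiffAt (φ.total.open_source.mem_nhds hu)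
  form_diff ξ := φ.conn_total u hu ξ

theorem eventually_preservesAt (φ : LocalAutomorphism C) {u : B} (hu : u ∈ φ.total.source) :
    ∀ᶠ w in 𝓝 u, C.PreservesAt φ.total w := by
  filter_upwards [φ.total.open_source.mem_nhds hu] with w hw using φ.preservesAt hw

theorem mem_source (φ : LocalAutomorphism C) {u : B} :
    u ∈ φ.total.source ↔ C.proj u ∈ φ.base.source := by rw [φ.source_eq]; rfl

theorem Covers.mem_source (h : φ.Covers s x) {u : B} (hu : C.proj u = x) : u ∈ φ.total.source :=
  φ.mem_source.2 (hu ▸ h.1)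

theorem Covers.base_center (h : φ.Covers s x) (hs : IsSymmetryAt C s x) : φ.base x = x :=
  h.2.self_of_nhds.symm.trans hs.map_center

theorem Covers.proj_total (h : φ.Covers s x) (hs : IsSymmetryAt C s x) {u : B}
    (hu : C.proj u = x) : C.proj (φ.total u) = x := by
  rw [φ.proj_total u (h.mem_source hu), hu, h.base_center hs]

theorem Covers.eventually_proj_total (h : φ.Covers s x) {u : B} (hu : C.proj u = x) :
    ∀ᶠ w in 𝓝 u, C.proj (φ.total w) = s (C.proj w) := by
  have h1 : Filter.Tendsto C.proj (𝓝 u) (𝓝 x) :=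
    hu ▸ C.contMDiff_proj.continuous.tendsto u
  filter_upwards [h1.eventually h.2, φ.total.open_source.mem_nhds (h.mem_source hu)] with w h2 h3
  rw [φ.proj_total w h3, h2]

/-- A covering of a symmetry maps each frame `u` over the center to `u · g` for some `g ∈ P`
which acts by `-id` on `𝔤 / 𝔭`. -/
theorem Covers.exists_total_eq [LieGroup (𝓡 n) ∞ G] {Γ : OneGrading (LieAlg (n := n) G)}
    (hP : IsParabolic (k := k) Γ P) (h : φ.Covers s x) (hs : IsSymmetryAt C s x) {u : B}
    (hu : C.proj u = x) :
    ∃ g : P, φ.total u = rAct u g ∧ Γ.ActsBy (adEquiv (g : G)) (-1) := by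
  obtain ⟨g, hg⟩ := C.exists_eq_rAct ((h.proj_total hs hu).trans hu.symm)
  refine ⟨g, hg, ?_⟩
  subst hu
  have h1 := φ.preservesAt (h.mem_source rfl)
  refine C.actsBy_neg_one (H := s) hP h1.contMDiffAt ?_ (h.eventually_proj_total rfl) h1.form_diff
    hs.mfderiv_center hg
  exact (hs.contMDiffOn.contMDiffAt (s.open_source.mem_nhds hs.mem_source)).mdifferentiableAt
    (by simp)

end LocalAutomorphism

/-- Symmetries are involutive. -/
theorem IsSymmetryAt.eventually_apply_apply [LieGroup (𝓡 n) ∞ G] [T2Space G]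
    {Γ : OneGrading (LieAlg (n := n) G)}
    (hss : LieAlgebra.IsSemisimple ℝ (LieAlg (n := n) G)) (hP : IsParabolic (k := k) Γ P)
    {s : OpenPartialHomeomorph M M} {x : M} (hs : IsSymmetryAt C s x) :
    ∀ᶠ y in 𝓝 x, s (s y) = y := by
  obtain ⟨E, hE⟩ := Γ.exists_gradingElement
  obtain ⟨φ, hφ⟩ := hs.exists_covering
  obtain ⟨u, hu⟩ := C.surjective_proj x
  obtain ⟨g, hg, hact⟩ := hφ.exists_total_eq hP hs hu
  have hus := hφ.mem_source hu
  have hus' := hφ.mem_source (hφ.proj_total hs hu)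
  have e1 : φ.total (φ.total u) = rAct u (g * g) := by
    rw [hg, φ.total_rAct u hus, hg, rAct_rAct]
  have hcont : Filter.Tendsto φ.total (𝓝 u) (𝓝 (φ.total u)) :=
    (φ.preservesAt hus).contMDiffAt.continuousAt
  -- `Ad (g * g) = id`, so right translation by `g * g` preserves `ω` and rigidity applies.
  have e2 : ∀ᶠ w in 𝓝 u, φ.total (φ.total w) = rAct w (g * g) := by
    refine CartanGeometry.eventually_eq_rAct (C := C) (F := fun w => w)
      (F' := fun w => φ.total (φ.total w))
      (Filter.Eventually.of_forall fun w => CartanGeometry.preservesAt_id w) ?_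
      (Ad_mul_self_eq_id hP hss hE hact) e1
    filter_upwards [φ.eventually_preservesAt hus, hcont.eventually (φ.eventually_preservesAt hus')]
      with w h1 h2 using h2.comp h1
  have e3 : ∀ᶠ w in 𝓝 u, s (s (C.proj w)) = C.proj w := by
    filter_upwards [e2, hφ.eventually_proj_total hu,
      hcont.eventually (hφ.eventually_proj_total (hφ.proj_total hs hu))] with w h1 h2 h3
    rw [← h2, ← h3, h1, C.proj_rAct]
  have := C.map_proj_nhds u
  rw [hu] at this
  rw [← this]
  exact e3

theorem IsSymmetryAt.eventually_ne {s : OpenPartialHomeomorph M M} {x : M}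
    (hs : IsSymmetryAt C s x) : ∀ᶠ y in 𝓝[≠] x, s y ≠ y :=
  eventually_ne_of_mfderiv_eq_neg hs.map_center
    ((hs.contMDiffOn.contMDiffAt (s.open_source.mem_nhds hs.mem_source)).mdifferentiableAt
      (by simp)) hs.mfderiv_center

end
end ParabolicGeometry
-- Weyl structures at the center and comparison of coverings.
namespace ParabolicGeometry
noncomputable section

variable {n k m : ℕ} {G : Type*} [TopologicalSpace G]
  [ChartedSpace (EuclideanSpace ℝ (Fin n)) G] [Group G] [LieGroup (𝓡 n) ∞ G]
  {P : Subgroup G} [ChartedSpace (EuclideanSpace ℝ (Fin k)) P]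
  {B : Type*} [TopologicalSpace B] [ChartedSpace (EuclideanSpace ℝ (Fin n)) B]
  [IsManifold (𝓡 n) ∞ B] [MulAction (↥P)ᵐᵒᵖ B]
  {M : Type*} [TopologicalSpace M] [ChartedSpace (EuclideanSpace ℝ (Fin m)) M]
  {C : CartanGeometry (n := n) (k := k) (m := m) P B M}
  {Γ : OneGrading (LieAlg (n := n) G)}

omit [TopologicalSpace B] [ChartedSpace (EuclideanSpace ℝ (Fin n)) B] [IsManifold (𝓡 n) ∞ B] in
theorem toBZero_eq_iff {u w : B} : toBZero Γ P u = toBZero Γ P w ↔ ∃ q ∈ pPlus Γ P, w = rAct u q :=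
  Quotient.eq (r := pPlusSetoid Γ P B)

theorem projZero_toBZero (u : B) : projZero Γ C (toBZero Γ P u) = C.proj u := rfl

namespace WeylStructure

variable (σ : WeylStructure Γ C)

theorem proj_toFun (v : BZero Γ P B) : C.proj (σ.toFun v) = projZero Γ C v := by
  rw [← projZero_toBZero (Γ := Γ), σ.isSection]

theorem toFun_toFun (v : BZero Γ P B) : σ.toFun (toBZero Γ P (σ.toFun v)) = σ.toFun v := by
  rw [σ.isSection]

/-- A frame in the image of a Weyl structure is mapped into this image exactly by `G₀`. -/
theorem toFun_rAct_eq_iff [T2Space G] (hss : LieAlgebra.IsSemisimple ℝ (LieAlg (n := n) G))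
    (hP : IsParabolic (k := k) Γ P) {E : LieAlg (n := n) G} (hE : Γ.IsGradingElement E)
    {u : B} (hu : σ.toFun (toBZero Γ P u) = u) {g : P} {ε : ℝ}
    (hg : Γ.ActsBy (adEquiv (g : G)) ε) :
    σ.toFun (toBZero Γ P (rAct u g)) = rAct u g ↔ Ad (g : G) E = E := by
  constructor
  · intro h
    -- With `g * q ∈ G₀`, equivariance makes `u · (g * q)` the frame of `σ` in the class of `u · g`.
    -- If `u · g` is this frame too, freeness gives `g = g * q`.
    obtain ⟨q, hq, hqE⟩ := exists_mem_pPlus_Ad_mul hP hss hE hg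
    have h1 : toBZero Γ P (rAct u g) = toBZero Γ P (rAct u (g * q)) :=
      toBZero_eq_iff.2 ⟨q, hq, (rAct_rAct u g q).symm⟩
    rw [h1, σ.equivariant u _ (mem_gZero_of_Ad_eq hE hqE), hu] at h
    rwa [C.rAct_injective h] at hqE
  · intro h
    rw [σ.equivariant u g (mem_gZero_of_Ad_eq hE h), hu]

/-- Invariance of a Weyl structure at the center of a symmetry in terms of the frames in its
image. -/
theorem invariantAt_iff [T2Space G] (hss : LieAlgebra.IsSemisimple ℝ (LieAlg (n := n) G))
    (hP : IsParabolic (k := k) Γ P) {E : LieAlg (n := n) G} (hE : Γ.IsGradingElement E)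
    {φ : LocalAutomorphism C} {s : OpenPartialHomeomorph M M} {x : M} (hφ : φ.Covers s x)
    (hs : IsSymmetryAt C s x) :
    σ.InvariantAt φ x ↔ ∀ u, C.proj u = x → σ.toFun (toBZero Γ P u) = u →
      ∀ g : P, φ.total u = rAct u g → Ad (g : G) E = E := by
  have key : ∀ u, C.proj u = x → σ.toFun (toBZero Γ P u) = u → ∀ g : P, φ.total u = rAct u g →
      (φ.pullback σ (toBZero Γ P u) = u ↔ Ad (g : G) E = E) := by
    intro u hu hσ g hg
    obtain ⟨g', hg', hact⟩ := hφ.exists_total_eq hP hs hu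
    obtain rfl : g = g' := C.rAct_injective (hg.symm.trans hg')
    have hus := hφ.mem_source hu
    rw [← σ.toFun_rAct_eq_iff hss hP hE hσ hact, LocalAutomorphism.pullback,
      φ.underlying_toBZero Γ hus, ← hg]
    have ht : σ.toFun (toBZero Γ P (φ.total u)) ∈ φ.total.target := by
      have h1 := φ.total.map_source hus
      rw [φ.target_eq, Set.mem_preimage] at h1 ⊢
      rwa [σ.proj_toFun, projZero_toBZero]
    exact ⟨fun h => by rw [← φ.total.right_inv ht, h],
      fun h => by rw [h, φ.total.left_inv hus]⟩
  constructor
  · intro h u hu hσ g hg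
    refine (key u hu hσ g hg).1 ?_
    rw [h (toBZero Γ P u) hu, hσ]
  · intro h v hv
    have hu : C.proj (σ.toFun v) = x := (σ.proj_toFun v).trans hv
    have hσ := σ.toFun_toFun v
    obtain ⟨g, hg, -⟩ := hφ.exists_total_eq hP hs hu
    have := (key _ hu hσ g hg).2 (h _ hu hσ g hg)
    rwa [σ.isSection] at this

end WeylStructure

/-- Coverings of symmetries with the same center which leave a Weyl structure invariant at the
center differ near a frame by an element with trivial adjoint action. -/
theorem exists_eventually_total_eq [T2Space G]
    (hss : LieAlgebra.IsSemisimple ℝ (LieAlg (n := n) G)) (hP : IsParabolic (k := k) Γ P)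
    {s t : OpenPartialHomeomorph M M} {φ ψ : LocalAutomorphism C} {x : M}
    (hs : IsSymmetryAt C s x) (ht : IsSymmetryAt C t x) (hφ : φ.Covers s x) (hψ : ψ.Covers t x)
    (σ : WeylStructure Γ C) (hσφ : σ.InvariantAt φ x) (hσψ : σ.InvariantAt ψ x) :
    ∃ u, C.proj u = x ∧ ∃ h : P, Ad (n := n) (h : G) = ContinuousLinearMap.id ℝ _ ∧
      ∀ᶠ w in 𝓝 u, ψ.total w = rAct (φ.total w) h := by
  obtain ⟨E, hE⟩ := Γ.exists_gradingElement
  obtain ⟨u₀, hu₀⟩ := C.surjective_proj x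
  have hu : C.proj (σ.toFun (toBZero Γ P u₀)) = x :=
    (σ.proj_toFun _).trans ((projZero_toBZero u₀).trans hu₀)
  have hσ := σ.toFun_toFun (toBZero Γ P u₀)
  generalize σ.toFun (toBZero Γ P u₀) = u at hu hσ
  obtain ⟨g, hg, hgact⟩ := hφ.exists_total_eq hP hs hu
  obtain ⟨h, hh, hhact⟩ := hψ.exists_total_eq hP ht hu
  have hgE := (σ.invariantAt_iff hss hP hE hφ hs).1 hσφ u hu hσ g hg
  have hhE := (σ.invariantAt_iff hss hP hE hψ ht).1 hσψ u hu hσ h hh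
  have hAd := Ad_inv_mul_eq_id hss hE hgact hhact hgE hhE
  refine ⟨u, hu, g⁻¹ * h, hAd, ?_⟩
  refine CartanGeometry.eventually_eq_rAct (φ.eventually_preservesAt (hφ.mem_source hu))
    (ψ.eventually_preservesAt (hψ.mem_source hu)) hAd ?_
  rw [hh, hg, rAct_rAct, mul_inv_cancel_left]

omit [LieGroup (𝓡 n) ∞ G] in
/-- If two local automorphisms differ near a frame by `h`, then they differ near the whole fiber
by a locally constant function with values in the conjugates of `h` in `P`. -/
theorem exists_locallyConstant_of_eventually_eq {φ ψ : LocalAutomorphism C} {u : B}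
    (hφ : u ∈ φ.total.source) (hψ : u ∈ ψ.total.source) {h : P}
    (hu : ∀ᶠ w in 𝓝 u, ψ.total w = rAct (φ.total w) h) :
    ∃ U ∈ 𝓝 (C.proj u), ∃ f : B → P, ∀ y : B, C.proj y ∈ U →
      y ∈ φ.total.source ∧ y ∈ ψ.total.source ∧ ψ.total y = rAct (φ.total y) (f y) ∧
      (∃ p : P, f y = p⁻¹ * h * p) ∧ ∀ᶠ w in 𝓝 y, f w = f y := by
  classical
  obtain ⟨W, hW, hWo, huW⟩ := eventually_nhds_iff.1 (hu.and
    ((φ.total.open_source.eventually_mem hφ).and (ψ.total.open_source.eventually_mem hψ)))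
  have hU : C.proj '' W ∈ 𝓝 (C.proj u) := by
    rw [← C.map_proj_nhds]
    exact Filter.image_mem_map (hWo.mem_nhds huW)
  -- Freeness makes the chosen element unique where it exists, so `f` can be computed from any known
  -- solution; the default `1` is never met over `U`.
  let f : B → P := fun y => if hy : ∃ a : P, ψ.total y = rAct (φ.total y) a then hy.choose else 1
  have key : ∀ w ∈ W, ∀ p : P, rAct w p ∈ φ.total.source ∧ rAct w p ∈ ψ.total.source ∧
      ψ.total (rAct w p) = rAct (φ.total (rAct w p)) (p⁻¹ * h * p) ∧
      f (rAct w p) = p⁻¹ * h * p := by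
    intro w hw p
    obtain ⟨h1, h2, h3⟩ := hW w hw
    have h4 : ψ.total (rAct w p) = rAct (φ.total (rAct w p)) (p⁻¹ * h * p) := by
      rw [ψ.total_rAct w h3, φ.total_rAct w h2, h1, rAct_rAct, rAct_rAct]
      congr 1; group
    refine ⟨φ.mem_source.2 ?_, ψ.mem_source.2 ?_, h4, ?_⟩
    · rw [C.proj_rAct]; exact φ.mem_source.1 h2
    · rw [C.proj_rAct]; exact ψ.mem_source.1 h3
    · have h5 : ∃ a : P, ψ.total (rAct w p) = rAct (φ.total (rAct w p)) a := ⟨_, h4⟩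
      have h6 : f (rAct w p) = h5.choose := dif_pos h5
      exact C.rAct_injective (h6 ▸ h5.choose_spec.symm.trans h4)
  refine ⟨_, hU, f, ?_⟩
  rintro y ⟨w, hw, hwy⟩
  obtain ⟨p, rfl⟩ := C.exists_eq_rAct hwy.symm
  obtain ⟨h1, h2, h3, h4⟩ := key w hw p
  refine ⟨h1, h2, h4 ▸ h3, ⟨p, h4⟩, ?_⟩
  -- Frames near `w · p` are `w' · p` with `w' ∈ W` and the same `p`, so `f` keeps the value `p⁻¹ *
  -- h * p`.
  have h5 := C.tendsto_rAct_right (rAct w p) p⁻¹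
  rw [rAct_rAct, mul_inv_cancel, rAct_one] at h5
  filter_upwards [h5.eventually (hWo.mem_nhds hw)] with y' hy'
  have h6 := (key _ hy' p).2.2.2
  rw [rAct_rAct, inv_mul_cancel, rAct_one] at h6
  rw [h6, h4]

-- Conjugates of `a` again have trivial adjoint action, so they stabilize the filtration; if `P` is
-- the full stabilizer they lie in `P`.
omit [ChartedSpace (EuclideanSpace ℝ (Fin k)) P] in
theorem mem_normalCore_of_Ad_eq_id
    (h : filtrationStabilizer Γ = (P : Set G) ∨ ConnectedSpace (G ⧸ P)) {a : P}
    (ha : Ad (n := n) (a : G) = ContinuousLinearMap.id ℝ _) : (a : G) ∈ P.normalCore := by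
  rcases h with h | h
  · intro g
    rw [← SetLike.mem_coe, ← h]
    intro i X hX
    rw [Ad_conj_eq_id ha]
    exact hX
  · exact mem_normalCore_of_connectedSpace a.2 ha

end
end ParabolicGeometry
-- Different coverings of one symmetry, and uniqueness of the invariant Weyl structure.
namespace ParabolicGeometry
noncomputable section

/-- An automorphism which differs from the identity by a map into `L₁` fixes the grading element. -/
theorem OneGrading.IsGradingElement.apply_eq_of_sub_mem {L : Type*} [LieRing L] [LieAlgebra ℝ L]
    {Γ : OneGrading L} [LieAlgebra.IsKilling ℝ L] [FiniteDimensional ℝ L] {E : L}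
    (hE : Γ.IsGradingElement E) {α : L ≃ₗ⁅ℝ⁆ L} (h : ∀ X, α X - X ∈ Γ.gr 1) : α E = E := by
  rw [← sub_eq_zero]
  refine hE.eq_zero_of_lie_gr_neg_one (h E) fun X hX => ?_
  have h1 : ⁅α E, α X⁆ = -α X := by rw [← LieEquiv.map_lie, hE.lie_neg hX, map_neg]
  have h2 : ⁅α E - E, α X - X⁆ = 0 := Γ.lie_eq_zero (by norm_num) (h E) (h X)
  -- The left side has degree `0` and the right side degree `1`, so both vanish. The identity comes
  -- from expanding `[α E - E, α X - X] = 0` and `[E, α X - X] = α X - X`.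
  have h3 : ⁅α E - E, X⁆ = (-2 : ℝ) • (α X - X) := by
    have h4 := hE.lie_one (h X)
    rw [lie_sub, sub_lie, sub_lie, h1] at h2
    rw [lie_sub] at h4
    have h5 := hE.lie_neg hX
    rw [sub_lie, h5]
    rw [h5] at h4 h2
    linear_combination (norm := module) (-1 : ℝ) • h2 - (1 : ℝ) • h4
  refine Γ.eq_zero_of_mem_of_mem (i := 0) (j := 1) (by norm_num)
    (Γ.lie_mem' 0 (by norm_num) (h E) hX) ?_
  rw [h3]
  exact Submodule.smul_mem _ _ (h X)

/-- The derivative of a map into a translate of a subspace has values in this subspace. -/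
theorem mem_of_hasMFDerivAt {F V N : Type*} [NormedAddCommGroup F] [NormedSpace ℝ F]
    [NormedAddCommGroup V] [NormedSpace ℝ V] [FiniteDimensional ℝ V] [TopologicalSpace N]
    [ChartedSpace F N] {g : N → V} {w : N} {A : F →L[ℝ] V}
    (h : HasMFDerivAt 𝓘(ℝ, F) 𝓘(ℝ, V) g w A) {p : Submodule ℝ V} {c : V}
    (hg : ∀ᶠ y in 𝓝 w, g y - c ∈ p) (ξ : F) : A ξ ∈ p := by
  by_contra hA
  obtain ⟨f, hf, hp⟩ := Submodule.exists_le_ker_of_notMem hA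
  let l : V →L[ℝ] ℝ := LinearMap.toContinuousLinearMap f
  have h1 : HasMFDerivAt 𝓘(ℝ, F) 𝓘(ℝ, ℝ) (fun y => l (g y)) w (l.comp A) :=
    HasMFDerivAt.comp w l.hasMFDerivAt h
  have h2 : HasMFDerivAt 𝓘(ℝ, F) 𝓘(ℝ, ℝ) (fun y => l (g y)) w (0 : F →L[ℝ] ℝ) := by
    refine (hasMFDerivAt_const (l c) w).congr_of_eventuallyEq ?_
    filter_upwards [hg] with y hy
    have := hp hy
    rw [LinearMap.mem_ker, map_sub, sub_eq_zero] at this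
    exact this
  exact hf (congrArg (fun T : F →L[ℝ] ℝ => T ξ) (hasMFDerivAt_unique h1 h2))

variable {n k m : ℕ} {G : Type*} [TopologicalSpace G]
  [ChartedSpace (EuclideanSpace ℝ (Fin n)) G] [Group G] [LieGroup (𝓡 n) ∞ G]
  {P : Subgroup G} [ChartedSpace (EuclideanSpace ℝ (Fin k)) P]
  {B : Type*} [TopologicalSpace B] [ChartedSpace (EuclideanSpace ℝ (Fin n)) B]
  [IsManifold (𝓡 n) ∞ B] [MulAction (↥P)ᵐᵒᵖ B]
  {M : Type*} [TopologicalSpace M] [ChartedSpace (EuclideanSpace ℝ (Fin m)) M]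
  {C : CartanGeometry (n := n) (k := k) (m := m) P B M}
  {Γ : OneGrading (LieAlg (n := n) G)}

namespace CartanGeometry

-- Freezing the value at `w`, write `F · f = (F · f(w)) · (f(w)⁻¹ f)`. The last factor is `1` at
-- `w`, so the product rule gives the transformation law `ω = Ad(f⁻¹) ω + δf`.
omit [LieGroup (𝓡 n) ∞ G] in
theorem form_eq_Ad_add_dval [LieGroup (𝓡 k) ∞ P] {F F' : B → B} {f : B → P} {w : B}
    (hF : C.PreservesAt F w) (hF' : C.PreservesAt F' w)
    (h : ∀ᶠ y in 𝓝 w, F' y = rAct (F y) (f y)) (hf : ContMDiffAt (𝓡 n) (𝓡 k) ∞ f w)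
    (ξ : EuclideanSpace ℝ (Fin n)) :
    C.form w ξ = Ad ((f w : G)⁻¹) (C.form w ξ) +
      dval (k := k) P (fun y => (f w)⁻¹ * f y) w ξ := by
  have hr := (C.contMDiff_rAct_right (f w)).contMDiffAt (x := F w)
  have hS : ContMDiffAt (𝓡 n) (𝓡 n) ∞ (fun y => rAct (F y) (f w)) w := hr.comp w hF.contMDiffAt
  have h1 := C.form_diff_rAct (f := fun y => (f w)⁻¹ * f y) hS
    ((contMDiff_mul_left (I := 𝓡 k) (n := ∞) (a := (f w)⁻¹)).contMDiffAt.comp w hf)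
    (inv_mul_cancel _) ξ
  have h2 : (fun y => rAct (rAct (F y) (f w)) ((f w)⁻¹ * f y)) =ᶠ[𝓝 w] F' := by
    filter_upwards [h] with y hy
    rw [rAct_rAct, mul_inv_cancel_left, hy]
  have h3 := C.form_rAct (F w) (f w) (diff F w ξ)
  rw [diff_congr h2, diff_comp (F := fun y => rAct y (f w)) hr hF.contMDiffAt,
    ← h.self_of_nhds, hF'.form_diff] at h1
  rw [← h.self_of_nhds, hF.form_diff] at h3
  rw [← h3]
  exact h1

/-- If two connection preserving maps over the same map differ by a smooth function `f`, then
the adjoint action of the values of `f` is trivial. -/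
theorem Ad_eq_id_of_eventually_eq_rAct (hss : LieAlgebra.IsSemisimple ℝ (LieAlg (n := n) G))
    (hP : IsParabolic (k := k) Γ P) {F F' : B → B} {f : B → P} {u : B}
    (hF : ∀ᶠ w in 𝓝 u, C.PreservesAt F w) (hF' : ∀ᶠ w in 𝓝 u, C.PreservesAt F' w)
    (h : ∀ᶠ w in 𝓝 u, F' w = rAct (F w) (f w) ∧ ContMDiffAt (𝓡 n) (𝓡 k) ∞ f w) :
    Ad (n := n) (f u : G) = ContinuousLinearMap.id ℝ _ := by
  have := hP.lieGroup
  obtain ⟨E, hE⟩ := Γ.exists_gradingElement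
  have h1 : ∀ᶠ w in 𝓝 u, ∀ ξ, C.form w ξ = Ad ((f w : G)⁻¹) (C.form w ξ) +
      dval (k := k) P (fun y => (f w)⁻¹ * f y) w ξ := by
    filter_upwards [hF, hF', h, h.eventually_nhds] with w a1 a2 a3 a4 ξ
    exact form_eq_Ad_add_dval a1 a2 (a4.mono fun y hy => hy.1) a3.2 ξ
  -- Since `δf` has values in `𝔭`, the transformation law says that `Ad(f⁻¹)` is the identity modulo
  -- `𝔭`.
  have hact : ∀ᶠ w in 𝓝 u, Γ.ActsBy (adEquiv (f w : G)) 1 := by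
    filter_upwards [h1] with w hw
    refine hP.actsBy (one_mul 1) fun X => ?_
    obtain ⟨ξ, rfl⟩ := (C.bijective_form w).2 X
    have h2 := neg_mem (dval_mem (k := k) hP (fun y => (f w)⁻¹ * f y) w ξ)
    convert h2 using 1
    linear_combination (norm := module) (-1 : ℝ) • hw ξ
  let ft : B → P := fun y => (f u)⁻¹ * f y
  have hft : ContMDiffAt (𝓡 n) (𝓡 k) ∞ ft u :=
    (contMDiff_mul_left (I := 𝓡 k) (n := ∞) (a := (f u)⁻¹)).contMDiffAt.comp u h.self_of_nhds.2
  have hft1 : ft u = 1 := inv_mul_cancel _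
  have hd : HasMFDerivAt (𝓡 n) (𝓡 n) (fun y => (ft y : G)) u (dval (k := k) P ft u) := by
    have h2 := (hP.contMDiff_val.mdifferentiable (by simp) (ft u)).hasMFDerivAt
    have h3 := HasMFDerivAt.comp u h2 (hft.mdifferentiableAt (by simp)).hasMFDerivAt
    rw [hft1] at h3
    exact h3
  -- Near `u`, `Ad(f(u)⁻¹ f) Y` stays in `Y + 𝔭`, so its derivative `[δf(ξ), Y]` lies in `𝔭`. Thus
  -- `δf(ξ)` acts trivially on `𝔤 / 𝔭`.
  have hgr : ∀ ξ, dval (k := k) P ft u ξ ∈ Γ.gr 1 := by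
    intro ξ
    refine hE.mem_gr_one_of_lie hss (dval_mem hP ft u ξ) fun Y _ => ?_
    obtain ⟨A', hA, hA'⟩ := mfderiv_Ad_comp hd (congrArg Subtype.val hft1) Y
    refine Set.mem_of_eq_of_mem (hA' ξ).symm ?_
    refine mem_of_hasMFDerivAt (V := EuclideanSpace ℝ (Fin n)) hA (c := Y) ?_ ξ
    filter_upwards [hact] with w hw
    have h2 := hw.sub_mem Y
    have h3 := hP.Ad_mem (f u)⁻¹ h2
    have h4 := hact.self_of_nhds.symm_sub Y
    have e : Ad (n := n) (ft w : G) Y = Ad (n := n) (((f u)⁻¹ : P) : G) (Ad (n := n) (f w : G) Y) :=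
      Ad_mul_apply _ _ _
    rw [one_smul] at h2 h3 h4
    rw [adEquiv_apply, map_sub] at h3
    rw [adEquiv_symm_apply] at h4
    have h5 := add_mem h3 h4
    rw [← e] at h5
    convert h5 using 1
    rw [InvMemClass.coe_inv, sub_add_sub_cancel]
    rfl
  -- Read again, the transformation law now bounds `Ad(f⁻¹) - id` by `𝔤₁` on all of `𝔤`, which
  -- forces `E` to be fixed.
  have hsub : ∀ X, (adEquiv (n := n) (f u : G)).symm X - X ∈ Γ.gr 1 := by
    intro X
    obtain ⟨ξ, rfl⟩ := (C.bijective_form u).2 X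
    have h2 := neg_mem (hgr ξ)
    have h3 := h1.self_of_nhds ξ
    rw [adEquiv_symm_apply]
    convert h2 using 1
    linear_combination (norm := module) (-1 : ℝ) • h3
  have hEE := hE.apply_eq_of_sub_mem hsub
  refine Ad_eq_id hP hss hE hact.self_of_nhds ?_
  have h2 := congrArg (adEquiv (n := n) (f u : G)) hEE
  rw [LieEquiv.apply_symm_apply] at h2
  exact h2.symm

end CartanGeometry

/-- Coverings of the same symmetry differ over the center by elements with trivial adjoint
action. -/
theorem LocalAutomorphism.Covers.Ad_eq_id (hss : LieAlgebra.IsSemisimple ℝ (LieAlg (n := n) G))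
    (hP : IsParabolic (k := k) Γ P) {φ ψ : LocalAutomorphism C} {s : OpenPartialHomeomorph M M}
    {x : M} (hφ : φ.Covers s x) (hψ : ψ.Covers s x) {u : B} (hu : C.proj u = x) {h : P}
    (hh : ψ.total u = rAct (φ.total u) h) : Ad (n := n) (h : G) = ContinuousLinearMap.id ℝ _ := by
  have := hP.lieGroup
  have h1 := φ.eventually_preservesAt (hφ.mem_source hu)
  have h2 := ψ.eventually_preservesAt (hψ.mem_source hu)
  obtain ⟨f, hf⟩ := C.exists_eventually_eq_rAct (h1.mono fun w hw => hw.contMDiffAt)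
    (h2.mono fun w hw => hw.contMDiffAt) (by
      filter_upwards [hφ.eventually_proj_total hu, hψ.eventually_proj_total hu] with w a b
      exact b.trans a.symm)
  rw [C.rAct_injective (hh.symm.trans hf.self_of_nhds.1)]
  exact CartanGeometry.Ad_eq_id_of_eventually_eq_rAct hss hP h1 h2 hf

variable [T2Space G]

/-- Invariance only concerns the action of the group elements on `E`, and those of `φ` and `ψ`
differ by a factor with trivial adjoint action. -/
theorem WeylStructure.InvariantAt.of_covers
    (hss : LieAlgebra.IsSemisimple ℝ (LieAlg (n := n) G)) (hP : IsParabolic (k := k) Γ P)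
    {φ ψ : LocalAutomorphism C} {s : OpenPartialHomeomorph M M} {x : M}
    (hs : IsSymmetryAt C s x) (hφ : φ.Covers s x) (hψ : ψ.Covers s x) {σ : WeylStructure Γ C}
    (h : σ.InvariantAt φ x) : σ.InvariantAt ψ x := by
  obtain ⟨E, hE⟩ := Γ.exists_gradingElement
  rw [σ.invariantAt_iff hss hP hE hψ hs]
  intro u hu hσ l hl
  obtain ⟨g, hg, -⟩ := hφ.exists_total_eq hP hs hu
  have hgE := (σ.invariantAt_iff hss hP hE hφ hs).1 h u hu hσ g hg
  have h1 : ψ.total u = rAct (φ.total u) (g⁻¹ * l) := by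
    rw [hl, hg, rAct_rAct, mul_inv_cancel_left]
  have h2 := hφ.Ad_eq_id hss hP hψ hu h1
  have h3 : (l : G) = g * ((g⁻¹ * l : P) : G) := by simp
  rw [h3, Ad_mul_apply, h2]
  exact hgE

/-- A Weyl structure which is invariant at the center of a symmetry is determined over the
center. -/
theorem WeylStructure.InvariantAt.toFun_eq
    (hss : LieAlgebra.IsSemisimple ℝ (LieAlg (n := n) G)) (hP : IsParabolic (k := k) Γ P)
    {φ : LocalAutomorphism C} {s : OpenPartialHomeomorph M M} {x : M}
    (hs : IsSymmetryAt C s x) (hφ : φ.Covers s x) {σ τ : WeylStructure Γ C}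
    (hσ : σ.InvariantAt φ x) (hτ : τ.InvariantAt φ x) {v : BZero Γ P B}
    (hv : projZero Γ C v = x) : σ.toFun v = τ.toFun v := by
  obtain ⟨E, hE⟩ := Γ.exists_gradingElement
  have hu : C.proj (σ.toFun v) = x := (σ.proj_toFun v).trans hv
  have hu' : C.proj (τ.toFun v) = x := (τ.proj_toFun v).trans hv
  obtain ⟨q, hq, hqv⟩ := toBZero_eq_iff.1 ((σ.isSection v).trans (τ.isSection v).symm)
  obtain ⟨g, hg, hact⟩ := hφ.exists_total_eq hP hs hu
  have hgE := (σ.invariantAt_iff hss hP hE hφ hs).1 hσ _ hu (σ.toFun_toFun v) g hg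
  -- Passing to the frame translated by `q` conjugates `g`. Invariance of `τ` therefore says that
  -- `Ad g` fixes `Ad q E = E - Z`, while `Ad g Z = -Z`.
  have hg' : φ.total (τ.toFun v) = rAct (τ.toFun v) (q⁻¹ * (g * q)) := by
    rw [hqv, φ.total_rAct _ (hφ.mem_source hu), hg, rAct_rAct, rAct_rAct, mul_inv_cancel_left]
  have hgE' := (τ.invariantAt_iff hss hP hE hφ hs).1 hτ _ hu' (τ.toFun_toFun v) _ hg'
  obtain ⟨Z, hZ, hqE, hq1⟩ := exists_Ad_eq_of_mem_pPlus hE hq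
  have h1 : Ad (n := n) (g : G) (Ad (n := n) (q : G) E) = Ad (n := n) (q : G) E := by
    have h2 := congrArg (Ad (n := n) (q : G)) hgE'
    rw [Subgroup.coe_mul, Subgroup.coe_mul, Ad_mul_apply, InvMemClass.coe_inv, Ad_apply_inv,
      Ad_mul_apply] at h2
    exact h2
  have h3 := hact.apply_gr_one hE hss hZ
  rw [adEquiv_apply] at h3
  rw [hqE, map_sub, hgE, h3] at h1
  have hZ0 : Z = 0 := by
    have h4 : (2 : ℝ) • Z = 0 := by linear_combination (norm := module) (1 : ℝ) • h1
    exact (smul_eq_zero.1 h4).resolve_left two_ne_zero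
  rw [hqv, hq1 hZ0, rAct_one]

end
end ParabolicGeometry
-- The theorem.
open ParabolicGeometry in
theorem mainTheorem4 {n k m : ℕ}
    {G : Type*} [TopologicalSpace G] [T2Space G] [SecondCountableTopology G]
    [ChartedSpace (EuclideanSpace ℝ (Fin n)) G] [Group G] [LieGroup (𝓡 n) ∞ G]
    (hG : LieAlgebra.IsSemisimple ℝ (LieAlg (n := n) G))
    (Γ : OneGrading (LieAlg (n := n) G))
    (P : Subgroup G) [ChartedSpace (EuclideanSpace ℝ (Fin k)) P]
    (hP : IsParabolic (k := k) Γ P)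
    {B : Type*} [TopologicalSpace B] [T2Space B] [SecondCountableTopology B]
    [ChartedSpace (EuclideanSpace ℝ (Fin n)) B] [IsManifold (𝓡 n) ∞ B]
    [MulAction (↥P)ᵐᵒᵖ B]
    {M : Type*} [TopologicalSpace M] [T2Space M] [SecondCountableTopology M]
    [ChartedSpace (EuclideanSpace ℝ (Fin m)) M] [IsManifold (𝓡 m) ∞ M]
    (C : CartanGeometry (n := n) (k := k) (m := m) P B M) (x : M) :
    -- coverings with invariant Weyl structures that agree at `x`
    (∀ (s t : OpenPartialHomeomorph M M) (φ ψ : LocalAutomorphism C),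
      IsSymmetryAt C s x → IsSymmetryAt C t x → φ.Covers s x → ψ.Covers t x →
      ∀ σ : WeylStructure Γ C, σ.InvariantAt φ x → σ.InvariantAt ψ x →
        (∀ᶠ y in 𝓝 x, s y = t y) ∧
        ∃ U ∈ 𝓝 x, ∃ f : B → P,
          (∀ u : B, C.proj u ∈ U →
            u ∈ φ.total.source ∧ u ∈ ψ.total.source ∧
            ψ.total u = rAct (φ.total u) (f u) ∧
            Ad (n := n) (f u : G) = ContinuousLinearMap.id ℝ (LieAlg (n := n) G) ∧
            ∀ᶠ w in 𝓝 u, f w = f u) ∧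
          ((filtrationStabilizer Γ = (P : Set G) ∨ ConnectedSpace (G ⧸ P)) →
            ∀ u : B, C.proj u ∈ U → (f u : G) ∈ P.normalCore) ∧
          ((∀ a : P, Ad (n := n) (a : G) = ContinuousLinearMap.id ℝ (LieAlg (n := n) G) →
              ∀ b : P, a * b = b * a) →
            ∃ h : P, ∀ u : B, C.proj u ∈ U → f u = h)) ∧
    -- coverings of the same symmetry share the invariant Weyl structure at `x`
    (∀ (s : OpenPartialHomeomorph M M) (φ ψ : LocalAutomorphism C),
      IsSymmetryAt C s x → φ.Covers s x → ψ.Covers s x →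
        (∀ σ : WeylStructure Γ C, σ.InvariantAt φ x ↔ σ.InvariantAt ψ x) ∧
        ∀ σ τ : WeylStructure Γ C, σ.InvariantAt φ x → τ.InvariantAt ψ x →
          ∀ v : BZero Γ P B, projZero Γ C v = x → σ.toFun v = τ.toFun v) ∧
    -- symmetries are involutive and their center is an isolated fixed point
    (∀ s : OpenPartialHomeomorph M M, IsSymmetryAt C s x →
      (∀ᶠ y in 𝓝 x, s (s y) = y) ∧ ∀ᶠ y in 𝓝[≠] x, s y ≠ y) := by
  refine ⟨fun s t φ ψ hs ht hφ hψ σ hσφ hσψ => ?_, fun s φ ψ hs hφ hψ => ⟨fun σ =>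
    ⟨fun h => h.of_covers hG hP hs hφ hψ, fun h => h.of_covers hG hP hs hψ hφ⟩,
    fun σ τ hσ hτ v hv => hσ.toFun_eq hG hP hs hφ (hτ.of_covers hG hP hs hψ hφ) hv⟩,
    fun s hs => ⟨hs.eventually_apply_apply hG hP, hs.eventually_ne⟩⟩
  obtain ⟨u, rfl, h, hAd, hu⟩ := exists_eventually_total_eq hG hP hs ht hφ hψ σ hσφ hσψ
  obtain ⟨U, hU, f, hf⟩ :=
    exists_locallyConstant_of_eventually_eq (hφ.mem_source rfl) (hψ.mem_source rfl) hu
  have hfAd : ∀ y : B, C.proj y ∈ U →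
      Ad (n := n) (f y : G) = ContinuousLinearMap.id ℝ (LieAlg (n := n) G) := by
    intro y hy
    obtain ⟨p, hp⟩ := (hf y hy).2.2.2.1
    have := Ad_conj_eq_id (g := (p : G)⁻¹) hAd
    rw [inv_inv] at this
    rw [hp]
    exact this
  refine ⟨?_, U, hU, f, fun y hy => ?_, fun hPm y hy => mem_normalCore_of_Ad_eq_id hPm (hfAd y hy),
    fun hcomm => ⟨h, fun y hy => ?_⟩⟩
  · rw [← C.map_proj_nhds u]
    change ∀ᶠ w in 𝓝 u, s (C.proj w) = t (C.proj w)
    filter_upwards [hu, hφ.eventually_proj_total rfl, hψ.eventually_proj_total rfl] with w h1 h2 h3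
    rw [← h2, ← h3, h1, C.proj_rAct]
  · obtain ⟨h1, h2, h3, -, h5⟩ := hf y hy
    exact ⟨h1, h2, h3, hfAd y hy, h5⟩
  · obtain ⟨p, hp⟩ := (hf y hy).2.2.2.1
    -- The values of `f` are the conjugates `p⁻¹ * h * p`, which all equal `h` once `h` commutes
    -- with `P`.
    rw [hp, mul_assoc, hcomm h hAd p, inv_mul_cancel_left]
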